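/- Let $k$ be a field and let $H=(H,\Delta,\varepsilon,\Phi,S,\alpha,\beta)$ be a quasi-Hopf algebra over $k$: $H$ is an associative unital algebra, $\Delta:H\to H\otimes H$ and $\varepsilon:H\to k$ are algebra maps, $\Phi=X^1\otimes X^2\otimes X^3\in H^{\otimes 3}$ is invertible with inverse $\Phi^{-1}=x^1\otimes x^2\otimes x^3=y^1\otimes y^2\otimes y^3$, $S$ is a unital algebra anti-endomorphism of $H$, $\alpha,\beta\in H$, and $(id\otimes\Delta)\Delta(h)=\Phi(\Delta\otimes id)\Delta(h)\Phi^{-1}$, $(id\otimes\varepsilon)\Delta(h)=h\otimes 1$, $(\varepsilon\otimes id)\Delta(h)=1\otimes h$, $(1\otimes\Phi)(id\otimes\Delta\otimes id)(\Phi)(\Phi\otimes 1)=(id\otimes id\otimes\Delta)(\Phi)(\Delta\otimes id\otimes id)(\Phi)$, $(id\otimes\varepsilon\otimes id)(\Phi)=1\otimes 1\otimes 1$, $S(h_1)\alpha h_2=\varepsilon(h)\alpha$, $h_1\beta S(h_2)=\varepsilon(h)\beta$, $X^1\beta S(X^2)\alpha X^3=1=S(x^1)\alpha x^2\beta S(x^3)$.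 Assume that $S$ is bijective (this is automatic if $H$ is finite dimensional). Here $\Delta(h)=h_1\otimes h_2$, and further copies of $\Phi^{\pm1}$ are denoted by other letters. Put $A=(\Phi\otimes1)(\Delta\otimes id\otimes id)(\Phi^{-1})$, $B=(\Delta\otimes id\otimes id)(\Phi)(\Phi^{-1}\otimes1)$, $\gamma=S(A^2)\alpha A^3\otimes S(A^1)\alpha A^4$, $\delta=B^1\beta S(B^4)\otimes B^2\beta S(B^3)$, and $$f=f^1\otimes f^2=(S\otimes S)(\Delta^{op}(x^1))\,\gamma\,\Delta(x^2\beta S(x^3)),\qquad f^{-1}=g^1\otimes g^2=\Delta(S(x^1)\alpha x^2)\,\delta\,(S\otimes S)(\Delta^{op}(x^3)),$$ $$p_R=p^1\otimes p^2=x^1\otimes x^2\beta S(x^3),\quad q_R=q^1\otimes q^2=X^1\otimes S^{-1}(\alpha X^3)X^2,\quad q_L=\tilde q^1\otimes\tilde q^2=S(x^1)\alpha x^2\otimes x^3 .$$ A left-right Yetter–Drinfeld module is a left $H$-module $M$ with a $k$-linear map $M\to M\otimes H$, $m\mapsto m_{(0)}\otimes m_{(1)}$, such that $\varepsilon(m_{(1)})m_{(0)}=m$,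 $h_1\cdot m_{(0)}\otimes h_2m_{(1)}=(h_2\cdot m)_{(0)}\otimes(h_2\cdot m)_{(1)}h_1$ and $$(x^2\cdot m_{(0)})_{(0)}\otimes (x^2\cdot m_{(0)})_{(1)}x^1\otimes x^3m_{(1)}=x^1\cdot(y^3\cdot m)_{(0)}\otimes x^2(y^3\cdot m)_{(1)_1}y^1\otimes x^3(y^3\cdot m)_{(1)_2}y^2 .$$ With $H$-linear and $H$-colinear maps these form a monoidal category ${}_H\mathcal{YD}^H$: $h\cdot(m\otimes n)=h_1\cdot m\otimes h_2\cdot n$; the coaction on $M\otimes N$ is $$m\otimes n\mapsto x^1X^1\cdot(y^2\cdot m)_{(0)}\otimes x^2\cdot(X^3y^3\cdot n)_{(0)}\otimes x^3(X^3y^3\cdot n)_{(1)}X^2(y^2\cdot m)_{(1)}y^1;$$ the associativity constraint is $(u\otimes v)\otimes w\mapsto X^1\cdot u\otimes(X^2\cdot v\otimes X^3\cdot w)$; the unit object is $k$, with action $\varepsilon$ and coaction $c\mapsto c\otimes 1$. Let $H_0$ be the vector space $H$ with the left adjoint action $h\triangleright h'=h_1h'S(h_2)$, the multiplication $$h\circ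 h'=X^1hS(x^1X^2)\alpha x^2X^3_1h'S(x^3X^3_2)$$ and the unit $\beta$. **(1)** $H_0$ is an algebra in the monoidal category ${}_H\mathcal{YD}^H$, with the action $\triangleright$ and the right coaction $$\rho_{H_0}(h)=x^1\tilde q^2y^2_2h_2g^2S(x^2y^3_1)\otimes x^3y^3_2S^{-1}(\tilde q^1y^2_1h_1g^1)y^1 .$$ **(2)** Suppose moreover that $H$ is finite dimensional and that $\alpha,\beta$ are normalized so that $\varepsilon(\alpha)=1$ (equivalently $\varepsilon(\beta)=1$; this can always be achieved by rescaling). Let $D(H)=H^*\otimes H$, with elements written $\varphi\bowtie h$, be the quantum double of $H$. With $\langle a\rightharpoonup\varphi\leftharpoonup b,x\rangle=\varphi(bxa)$, $(\varphi\psi)(h)=\varphi(h_1)\psi(h_2)$, $\varphi(hh')=\varphi_1(h)\varphi_2(h')$ and $$\Omega=X^1_{(1,1)}y^1x^1\otimes X^1_{(1,2)}y^2x^2_1\otimes X^1_2y^3x^2_2\otimes S^{-1}(f^1X^2x^3)\otimes S^{-1}(f^2X^3),$$ its multiplication is $$(\varphi\bowtie h)(\psi\bowtie h')=[(\Omega^1\rightharpoonup\varphi\leftharpoonup\Omega^5)(\Omega^2h_{(1,1)}\rightharpoonup\psi\leftharpoonup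 S^{-1}(h_2)\Omega^4)]\bowtie\Omega^3h_{(1,2)}h',$$ its unit is $\varepsilon\bowtie1$, its comultiplication is $$\Delta_D(\varphi\bowtie h)=(\varepsilon\bowtie X^1Y^1)(p^1_1x^1\rightharpoonup\varphi_2\leftharpoonup Y^2S^{-1}(p^2)\bowtie p^1_2x^2h_1)\otimes(X^2_1\rightharpoonup\varphi_1\leftharpoonup S^{-1}(X^3)\bowtie X^2_2Y^3x^3h_2)$$ (where $Y^1\otimes Y^2\otimes Y^3=\Phi$), its counit is $\varepsilon_D(\varphi\bowtie h)=\varepsilon(h)\varphi(S^{-1}(\alpha))$, and its reassociator $\Phi_D$ is the image of $\Phi$ under $(h\mapsto\varepsilon\bowtie h)^{\otimes3}$. Then $H_0$, with multiplication $\circ$ and unit $\beta$, is a left $D(H)$-module algebra (an algebra in the monoidal category of left $D(H)$-modules) via $$(\varphi\bowtie h)\cdot h'=\langle\varphi,\,q^2x^3y^3_2S^{-1}(\tilde q^1y^2_1(h\triangleright h')_1g^1)y^1\rangle\;q^1_1x^1\tilde q^2y^2_2(h\triangleright h')_2g^2S(q^1_2x^2y^3_1)$$ for all $\varphi\in H^*$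 and $h,h'\in H$. (This is the Schrödinger representation.) -/

import Mathlib

open scoped TensorProduct

/-!
Quasi-Hopf algebras, left-right Yetter-Drinfeld modules over them, the quantum double,
and the algebra `H₀` with its explicit coaction and its explicit action of the double.

Formulas are written with Sweedler sums: `sw T fun a b => F a b` is the sum of `F a b` over a
decomposition `T = ∑ a ⊗ b` into pure tensors.  All the functions `F` that occur are bilinear,
so that the sum does not depend on the decomposition (`sw_eq_lift`).
-/

noncomputable section

namespace QuasiHopf

section Sweedler

variable {k A B C D E M N : Type*} [Field k]
  [AddCommMonoid A] [Module k A] [AddCommMonoid B] [Module k B] [AddCommMonoid C] [Module k C]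
  [AddCommMonoid D] [Module k D] [AddCommMonoid E] [Module k E]
  [AddCommMonoid M] [Module k M] [AddCommMonoid N] [Module k N]

/-- Sweedler sum: the sum of `F a b` over a decomposition `T = ∑ a ⊗ b`. -/
def sw (T : A ⊗[k] B) (F : A → B → M) : M :=
  ∑ i ∈ (TensorProduct.exists_finset T).choose, F i.1 i.2

/-- Sweedler sum over `T = ∑ a ⊗ b ⊗ c`. -/
def sw3 (T : A ⊗[k] (B ⊗[k] C)) (F : A → B → C → M) : M :=
  sw T fun a t => sw t fun b c => F a b c

/-- Sweedler sum over `T = ∑ a ⊗ b ⊗ c ⊗ d`. -/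
def sw4 (T : A ⊗[k] (B ⊗[k] (C ⊗[k] D))) (F : A → B → C → D → M) : M :=
  sw T fun a t => sw3 t fun b c d => F a b c d

/-- Sweedler sum over `T = ∑ a ⊗ b ⊗ c ⊗ d ⊗ e`. -/
def sw5 (T : A ⊗[k] (B ⊗[k] (C ⊗[k] (D ⊗[k] E)))) (F : A → B → C → D → E → M) : M :=
  sw T fun a t => sw4 t fun b c d e => F a b c d e

/-- For a bilinear function the Sweedler sum is the value of the induced linear map. -/
theorem sw_eq_lift (L : A →ₗ[k] B →ₗ[k] M) (T : A ⊗[k] B) :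
    sw T (fun a b => L a b) = TensorProduct.lift L T := by
  conv_rhs => rw [(TensorProduct.exists_finset T).choose_spec]
  simp [sw]

/-- Linearity in a parameter of the summand. -/
theorem lin_sw {F : M → A → B → N} (T : A ⊗[k] B)
    (h : ∀ a b, IsLinearMap k fun x => F x a b) : IsLinearMap k fun x => sw T (F x) := by
  constructor
  · intro x y
    simp [sw, (h _ _).map_add, Finset.sum_add_distrib]
  · intro c x
    simp [sw, (h _ _).map_smul, Finset.smul_sum]

theorem lin_sw3 {F : M → A → B → C → N} (T : A ⊗[k] (B ⊗[k] C))
    (h : ∀ a b c, IsLinearMap k fun x => F x a b c) : IsLinearMap k fun x => sw3 T (F x) :=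
  lin_sw T fun a t => lin_sw t fun b c => h a b c

theorem lin_sw4 {F : M → A → B → C → D → N} (T : A ⊗[k] (B ⊗[k] (C ⊗[k] D)))
    (h : ∀ a b c d, IsLinearMap k fun x => F x a b c d) : IsLinearMap k fun x => sw4 T (F x) :=
  lin_sw T fun a t => lin_sw3 t fun b c d => h a b c d

theorem lin_sw5 {F : M → A → B → C → D → E → N} (T : A ⊗[k] (B ⊗[k] (C ⊗[k] (D ⊗[k] E))))
    (h : ∀ a b c d e, IsLinearMap k fun x => F x a b c d e) :
    IsLinearMap k fun x => sw5 T (F x) :=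
  lin_sw T fun a t => lin_sw4 t fun b c d e => h a b c d e

/-- Linearity in the tensor that is decomposed. -/
theorem lin_arg {G : M → A ⊗[k] B} (hG : IsLinearMap k G) {F : A → B → N}
    (h1 : ∀ b, IsLinearMap k fun a => F a b) (h2 : ∀ a, IsLinearMap k fun b => F a b) :
    IsLinearMap k fun x => sw (G x) F := by
  let L : A →ₗ[k] B →ₗ[k] N := LinearMap.mk₂ k F (fun a a' b => (h1 b).map_add a a')
    (fun c a b => (h1 b).map_smul c a) (fun a b b' => (h2 a).map_add b b')
    (fun c a b => (h2 a).map_smul c b)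
  have e : ∀ T : A ⊗[k] B, sw T F = TensorProduct.lift L T := fun T => sw_eq_lift L T
  constructor
  · intro x y
    rw [e, e, e, hG.map_add, map_add]
  · intro c x
    rw [e, e, hG.map_smul, map_smul]

/-- A function of two variables that is linear in each of them, as a linear map. -/
def bilin (F : A → B → M) (h1 : ∀ b, IsLinearMap k fun a => F a b)
    (h2 : ∀ a, IsLinearMap k fun b => F a b) : A →ₗ[k] B →ₗ[k] M :=
  LinearMap.mk₂ k F (fun a a' b => (h1 b).map_add a a') (fun c a b => (h1 b).map_smul c a)
    (fun a b b' => (h2 a).map_add b b') (fun c a b => (h2 a).map_smul c b)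

end Sweedler

/-- A quasi-Hopf algebra structure on the `k`-algebra `H`: comultiplication `Δ`, counit `ε`,
reassociator `Φ` with inverse `Φinv`, antipode `S` (an anti-endomorphism of the algebra `H`, not
assumed to be bijective) and elements `α`, `β`. -/
structure QuasiHopfAlgebra (k H : Type*) [Field k] [Ring H] [Algebra k H] where
  Δ : H →ₐ[k] H ⊗[k] H
  ε : H →ₐ[k] k
  Φ : H ⊗[k] (H ⊗[k] H)
  Φinv : H ⊗[k] (H ⊗[k] H)
  Φ_mul_Φinv : Φ * Φinv = 1
  Φinv_mul_Φ : Φinv * Φ = 1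
  /-- `(id ⊗ Δ)(Δ(h)) = Φ (Δ ⊗ id)(Δ(h)) Φ⁻¹` -/
  quasi_coassoc : ∀ h : H, Δ.toLinearMap.lTensor H (Δ h) =
    Φ * TensorProduct.assoc k H H H (Δ.toLinearMap.rTensor H (Δ h)) * Φinv
  /-- `(id ⊗ ε)(Δ(h)) = h ⊗ 1` -/
  counit_right : ∀ h : H, ε.toLinearMap.lTensor H (Δ h) = h ⊗ₜ[k] (1 : k)
  /-- `(ε ⊗ id)(Δ(h)) = 1 ⊗ h` -/
  counit_left : ∀ h : H, ε.toLinearMap.rTensor H (Δ h) = (1 : k) ⊗ₜ[k] h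
  /-- `(1 ⊗ Φ)(id ⊗ Δ ⊗ id)(Φ)(Φ ⊗ 1) = (id ⊗ id ⊗ Δ)(Φ)(Δ ⊗ id ⊗ id)(Φ)` -/
  cocycle :
    ((1 : H) ⊗ₜ[k] Φ) *
      ((TensorProduct.assoc k H H H).toLinearMap ∘ₗ Δ.toLinearMap.rTensor H).lTensor H Φ *
      (TensorProduct.assoc k H H (H ⊗[k] H)
        (TensorProduct.assoc k (H ⊗[k] H) H H
          ((TensorProduct.assoc k H H H).symm Φ ⊗ₜ[k] (1 : H)))) =
    (Δ.toLinearMap.lTensor H).lTensor H Φ *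
      TensorProduct.assoc k H H (H ⊗[k] H) (Δ.toLinearMap.rTensor (H ⊗[k] H) Φ)
  /-- `(id ⊗ ε ⊗ id)(Φ) = 1 ⊗ 1 ⊗ 1` -/
  counit_mid : (ε.toLinearMap.rTensor H).lTensor H Φ = (1 : H) ⊗ₜ[k] ((1 : k) ⊗ₜ[k] (1 : H))
  S : H →ₗ[k] H
  S_one : S 1 = 1
  S_mul : ∀ a b : H, S (a * b) = S b * S a
  α : H
  β : H
  /-- `S(h₁) α h₂ = ε(h) α` -/
  antipode_left : ∀ h : H, sw (Δ h) (fun h1 h2 => S h1 * α * h2) = ε h • α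
  /-- `h₁ β S(h₂) = ε(h) β` -/
  antipode_right : ∀ h : H, sw (Δ h) (fun h1 h2 => h1 * β * S h2) = ε h • β
  /-- `X¹ β S(X²) α X³ = 1` -/
  antipode_Φ : sw3 Φ (fun X1 X2 X3 => X1 * β * S X2 * α * X3) = 1
  /-- `S(x¹) α x² β S(x³) = 1` -/
  antipode_Φinv : sw3 Φinv (fun x1 x2 x3 => S x1 * α * x2 * β * S x3) = 1

namespace QuasiHopfAlgebra

variable {k H : Type*} [Field k] [Ring H] [Algebra k H] (Q : QuasiHopfAlgebra k H)

/-- The inverse of a bijective antipode. -/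
def Sinv (hS : Function.Bijective Q.S) : H →ₗ[k] H :=
  (LinearEquiv.ofBijective Q.S hS).symm.toLinearMap

/-! ### The elements `γ`, `δ`, `f`, `f⁻¹`, `p_R`, `q_R`, `q_L` -/

/-- `A = (Φ ⊗ 1)(Δ ⊗ id ⊗ id)(Φ⁻¹)`. -/
def tA : H ⊗[k] (H ⊗[k] (H ⊗[k] H)) :=
  sw3 Q.Φ fun X1 X2 X3 => sw3 Q.Φinv fun x1 x2 x3 => sw (Q.Δ x1) fun x11 x12 =>
    (X1 * x11) ⊗ₜ[k] ((X2 * x12) ⊗ₜ[k] ((X3 * x2) ⊗ₜ[k] x3))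

/-- `B = (Δ ⊗ id ⊗ id)(Φ)(Φ⁻¹ ⊗ 1)`. -/
def tB : H ⊗[k] (H ⊗[k] (H ⊗[k] H)) :=
  sw3 Q.Φ fun X1 X2 X3 => sw3 Q.Φinv fun x1 x2 x3 => sw (Q.Δ X1) fun X11 X12 =>
    (X11 * x1) ⊗ₜ[k] ((X12 * x2) ⊗ₜ[k] ((X2 * x3) ⊗ₜ[k] X3))

/-- `γ = S(A²) α A³ ⊗ S(A¹) α A⁴`. -/
def γ : H ⊗[k] H :=
  sw4 Q.tA fun A1 A2 A3 A4 => (Q.S A2 * Q.α * A3) ⊗ₜ[k] (Q.S A1 * Q.α * A4)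

/-- `δ = B¹ β S(B⁴) ⊗ B² β S(B³)`. -/
def δ : H ⊗[k] H :=
  sw4 Q.tB fun B1 B2 B3 B4 => (B1 * Q.β * Q.S B4) ⊗ₜ[k] (B2 * Q.β * Q.S B3)

/-- `f = (S ⊗ S)(Δᵒᵖ(x¹)) γ Δ(x² β S(x³))`. -/
def f : H ⊗[k] H :=
  sw3 Q.Φinv fun x1 x2 x3 => sw (Q.Δ x1) fun x11 x12 =>
    (Q.S x12 ⊗ₜ[k] Q.S x11) * Q.γ * Q.Δ (x2 * Q.β * Q.S x3)

/-- `f⁻¹ = Δ(S(x¹) α x²) δ (S ⊗ S)(Δᵒᵖ(x³))`. -/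
def fInv : H ⊗[k] H :=
  sw3 Q.Φinv fun x1 x2 x3 => sw (Q.Δ x3) fun x31 x32 =>
    Q.Δ (Q.S x1 * Q.α * x2) * Q.δ * (Q.S x32 ⊗ₜ[k] Q.S x31)

/-- `p_R = x¹ ⊗ x² β S(x³)`. -/
def pR : H ⊗[k] H := sw3 Q.Φinv fun x1 x2 x3 => x1 ⊗ₜ[k] (x2 * Q.β * Q.S x3)

/-- `q_R = X¹ ⊗ S⁻¹(α X³) X²`. -/
def qR (hS : Function.Bijective Q.S) : H ⊗[k] H :=
  sw3 Q.Φ fun X1 X2 X3 => X1 ⊗ₜ[k] (Q.Sinv hS (Q.α * X3) * X2)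

/-- `q_L = S(x¹) α x² ⊗ x³`. -/
def qL : H ⊗[k] H := sw3 Q.Φinv fun x1 x2 x3 => (Q.S x1 * Q.α * x2) ⊗ₜ[k] x3

/-! ### Left-right Yetter-Drinfeld modules

Objects are given by a left action `act` of `H` on `M` and a right coaction `ρ : M → M ⊗ H`. -/

section YetterDrinfeld

variable {M N : Type*} [AddCommGroup M] [Module k M] [AddCommGroup N] [Module k N]

/-- `M` with the action `act` and the coaction `ρ` is a left-right Yetter-Drinfeld module. -/
structure IsYetterDrinfeld (act : H →ₗ[k] M →ₗ[k] M) (ρ : M →ₗ[k] M ⊗[k] H) : Prop where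
  one_act : ∀ m, act 1 m = m
  mul_act : ∀ h h' m, act (h * h') m = act h (act h' m)
  counit : ∀ m, sw (ρ m) (fun m0 m1 => Q.ε m1 • m0) = m
  coassoc : ∀ m,
    (sw3 Q.Φinv fun x1 x2 x3 => sw (ρ m) fun m0 m1 => sw (ρ (act x2 m0)) fun n0 n1 =>
      n0 ⊗ₜ[k] ((n1 * x1) ⊗ₜ[k] (x3 * m1)))
    = (sw3 Q.Φinv fun x1 x2 x3 => sw3 Q.Φinv fun y1 y2 y3 =>
      sw (ρ (act y3 m)) fun n0 n1 => sw (Q.Δ n1) fun n11 n12 =>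
      act x1 n0 ⊗ₜ[k] ((x2 * n11 * y1) ⊗ₜ[k] (x3 * n12 * y2)))
  compat : ∀ h m,
    (sw (Q.Δ h) fun h1 h2 => sw (ρ m) fun m0 m1 => act h1 m0 ⊗ₜ[k] (h2 * m1))
    = (sw (Q.Δ h) fun h1 h2 => sw (ρ (act h2 m)) fun n0 n1 => n0 ⊗ₜ[k] (n1 * h1))

/-- `F` is a morphism of left-right Yetter-Drinfeld modules: `H`-linear and `H`-colinear. -/
structure IsYDHom (actM : H →ₗ[k] M →ₗ[k] M) (ρM : M →ₗ[k] M ⊗[k] H)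
    (actN : H →ₗ[k] N →ₗ[k] N) (ρN : N →ₗ[k] N ⊗[k] H) (F : M →ₗ[k] N) : Prop where
  map_act : ∀ h m, F (actM h m) = actN h (F m)
  map_coact : ∀ m, ρN (F m) = F.rTensor H (ρM m)

/-- The action on a tensor product: `h · (m ⊗ n) = h₁ · m ⊗ h₂ · n`. -/
def tensorAct (actM : H →ₗ[k] M →ₗ[k] M) (actN : H →ₗ[k] N →ₗ[k] N) :
    H →ₗ[k] (M ⊗[k] N) →ₗ[k] (M ⊗[k] N) :=
  bilin (fun h t => sw t fun m n => sw (Q.Δ h) fun h1 h2 => actM h1 m ⊗ₜ[k] actN h2 n)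
    (fun t => lin_sw t fun m n => lin_arg Q.Δ.toLinearMap.isLinear
      (fun h2 => by constructor <;> intros <;>
        simp [TensorProduct.add_tmul, TensorProduct.smul_tmul'])
      (fun h1 => by constructor <;> intros <;>
        simp [TensorProduct.tmul_add, TensorProduct.tmul_smul]))
    (fun h => lin_arg ⟨fun _ _ => rfl, fun _ _ => rfl⟩
      (fun n => lin_sw _ fun h1 h2 => by constructor <;> intros <;>
        simp [TensorProduct.add_tmul, TensorProduct.smul_tmul'])
      (fun m => lin_sw _ fun h1 h2 => by constructor <;> intros <;>
        simp [TensorProduct.tmul_add, TensorProduct.tmul_smul]))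

/-- The coaction on a tensor product:
`ρ(m ⊗ n) = x¹X¹·(y²·m)₍₀₎ ⊗ x²·(X³y³·n)₍₀₎ ⊗ x³(X³y³·n)₍₁₎X²(y²·m)₍₁₎y¹`. -/
def tensorCoact (actM : H →ₗ[k] M →ₗ[k] M) (ρM : M →ₗ[k] M ⊗[k] H)
    (actN : H →ₗ[k] N →ₗ[k] N) (ρN : N →ₗ[k] N ⊗[k] H) :
    (M ⊗[k] N) →ₗ[k] (M ⊗[k] N) ⊗[k] H :=
  TensorProduct.lift <| bilin
    (fun m n => sw3 Q.Φinv fun x1 x2 x3 => sw3 Q.Φ fun X1 X2 X3 => sw3 Q.Φinv fun y1 y2 y3 =>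
      sw (ρM (actM y2 m)) fun m0 m1 => sw (ρN (actN (X3 * y3) n)) fun n0 n1 =>
        (actM (x1 * X1) m0 ⊗ₜ[k] actN x2 n0) ⊗ₜ[k] (x3 * n1 * X2 * m1 * y1))
    (fun n => lin_sw3 _ fun x1 x2 x3 => lin_sw3 _ fun X1 X2 X3 => lin_sw3 _ fun y1 y2 y3 =>
      lin_arg (ρM ∘ₗ actM y2).isLinear
        (fun m1 => lin_sw _ fun n0 n1 => by constructor <;> intros <;>
          simp [TensorProduct.add_tmul, TensorProduct.smul_tmul'])
        (fun m0 => lin_sw _ fun n0 n1 => by constructor <;> intros <;>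
          simp [TensorProduct.tmul_add, TensorProduct.tmul_smul, mul_add, add_mul]))
    (fun m => lin_sw3 _ fun x1 x2 x3 => lin_sw3 _ fun X1 X2 X3 => lin_sw3 _ fun y1 y2 y3 =>
      lin_sw _ fun m0 m1 => lin_arg (ρN ∘ₗ actN (X3 * y3)).isLinear
        (fun n1 => by constructor <;> intros <;>
          simp [TensorProduct.add_tmul, TensorProduct.tmul_add, TensorProduct.smul_tmul'])
        (fun n0 => by constructor <;> intros <;>
          simp [TensorProduct.tmul_add, TensorProduct.tmul_smul, mul_add, add_mul]))

/-- The action on the unit object `k`: `h · c = ε(h) c`. -/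
def unitAct : H →ₗ[k] k →ₗ[k] k := LinearMap.lsmul k k ∘ₗ Q.ε.toLinearMap

/-- The coaction on the unit object `k`: `c ↦ c ⊗ 1`. -/
def unitCoact : k →ₗ[k] k ⊗[k] H := (TensorProduct.mk k k H).flip 1

/-- `M` with multiplication `μ` and unit `η` is an algebra in the monoidal category of left-right
Yetter-Drinfeld modules (tensor products, unit object and associativity constraint
`(u ⊗ v) ⊗ w ↦ X¹·u ⊗ (X²·v ⊗ X³·w)` as above, with the usual unit constraints). -/
structure IsYDAlgebra (act : H →ₗ[k] M →ₗ[k] M) (ρ : M →ₗ[k] M ⊗[k] H)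
    (μ : M →ₗ[k] M →ₗ[k] M) (η : M) : Prop where
  yetterDrinfeld : Q.IsYetterDrinfeld act ρ
  mul_hom : IsYDHom (Q.tensorAct act act) (Q.tensorCoact act ρ act ρ) act ρ (TensorProduct.lift μ)
  one_hom : IsYDHom Q.unitAct unitCoact act ρ (LinearMap.toSpanSingleton k M η)
  mul_assoc : ∀ a b c, μ (μ a b) c =
    sw3 Q.Φ fun X1 X2 X3 => μ (act X1 a) (μ (act X2 b) (act X3 c))
  one_mul : ∀ a, μ η a = a
  mul_one : ∀ a, μ a η = a

end YetterDrinfeld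

/-! ### The algebra `H₀` and its coaction -/

/-- The left adjoint action `h ▷ h' = h₁ h' S(h₂)`. -/
def adj : H →ₗ[k] H →ₗ[k] H :=
  bilin (fun h h' => sw (Q.Δ h) fun h1 h2 => h1 * h' * Q.S h2)
    (fun h' => lin_arg Q.Δ.toLinearMap.isLinear
      (fun h2 => by constructor <;> intros <;> simp [add_mul])
      (fun h1 => by constructor <;> intros <;> simp [mul_add]))
    (fun h => lin_sw _ fun h1 h2 => by constructor <;> intros <;> simp [mul_add, add_mul])

/-- The multiplication of `H₀`: `h ∘ h' = X¹ h S(x¹X²) α x² X³₁ h' S(x³X³₂)`. -/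
def circ : H →ₗ[k] H →ₗ[k] H :=
  bilin (fun h h' => sw3 Q.Φ fun X1 X2 X3 => sw3 Q.Φinv fun x1 x2 x3 =>
      sw (Q.Δ X3) fun X31 X32 =>
        X1 * h * Q.S (x1 * X2) * Q.α * x2 * X31 * h' * Q.S (x3 * X32))
    (fun h' => lin_sw3 _ fun X1 X2 X3 => lin_sw3 _ fun x1 x2 x3 => lin_sw _ fun X31 X32 => by
      constructor <;> intros <;> simp [mul_add, add_mul])
    (fun h => lin_sw3 _ fun X1 X2 X3 => lin_sw3 _ fun x1 x2 x3 => lin_sw _ fun X31 X32 => by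
      constructor <;> intros <;> simp [mul_add, add_mul])

/-- The coaction of `H₀`:
`ρ(h) = x¹ q̃² y²₂ h₂ g² S(x² y³₁) ⊗ x³ y³₂ S⁻¹(q̃¹ y²₁ h₁ g¹) y¹`, where `q_L = q̃¹ ⊗ q̃²` and
`f⁻¹ = g¹ ⊗ g²`. -/
def coaction (hS : Function.Bijective Q.S) : H →ₗ[k] H ⊗[k] H :=
  IsLinearMap.mk' (fun h =>
      sw3 Q.Φinv fun x1 x2 x3 => sw3 Q.Φinv fun y1 y2 y3 =>
      sw Q.qL fun q1 q2 => sw Q.fInv fun g1 g2 =>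
      sw (Q.Δ y2) fun y21 y22 => sw (Q.Δ y3) fun y31 y32 => sw (Q.Δ h) fun h1 h2 =>
        (x1 * q2 * y22 * h2 * g2 * Q.S (x2 * y31)) ⊗ₜ[k]
          (x3 * y32 * Q.Sinv hS (q1 * y21 * h1 * g1) * y1))
    (lin_sw3 _ fun x1 x2 x3 => lin_sw3 _ fun y1 y2 y3 => lin_sw _ fun q1 q2 =>
      lin_sw _ fun g1 g2 => lin_sw _ fun y21 y22 => lin_sw _ fun y31 y32 =>
      lin_arg Q.Δ.toLinearMap.isLinear
        (fun h2 => by constructor <;> intros <;>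
          simp [TensorProduct.tmul_add, TensorProduct.tmul_smul, mul_add, add_mul])
        (fun h1 => by constructor <;> intros <;>
          simp [TensorProduct.add_tmul, TensorProduct.smul_tmul', mul_add, add_mul]))

/-! ### The quantum double `D(H) = H* ⋈ H` -/

/-- The bimodule structure of `H*`: `a ⇀ φ ↼ b`, the functional `x ↦ φ(b x a)`. -/
def bimod (a : H) (φ : Module.Dual k H) (b : H) : Module.Dual k H :=
  φ ∘ₗ LinearMap.mulLeft k b ∘ₗ LinearMap.mulRight k a

/-- The convolution product of `H*`: `(φψ)(h) = φ(h₁) ψ(h₂)`. -/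
def conv (φ ψ : Module.Dual k H) : Module.Dual k H :=
  LinearMap.mul' k k ∘ₗ TensorProduct.map φ ψ ∘ₗ Q.Δ.toLinearMap

/-- The comultiplication `φ ↦ φ₁ ⊗ φ₂` of `H*`, with `φ(h h') = φ₁(h) φ₂(h')`. -/
def dualComul [FiniteDimensional k H] :
    Module.Dual k H →ₗ[k] Module.Dual k H ⊗[k] Module.Dual k H :=
  (TensorProduct.dualDistribEquiv k H H).symm.toLinearMap ∘ₗ (LinearMap.mul' k H).dualMap

theorem dualComul_spec [FiniteDimensional k H] (φ : Module.Dual k H) (a b : H) :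
    TensorProduct.dualDistrib k H H (dualComul φ) (a ⊗ₜ[k] b) = φ (a * b) := by
  have h : TensorProduct.dualDistrib k H H (dualComul φ) = (LinearMap.mul' k H).dualMap φ :=
    (TensorProduct.dualDistribEquiv k H H).apply_symm_apply _
  rw [h]
  simp

/-- `Ω = X¹₍₁,₁₎ y¹ x¹ ⊗ X¹₍₁,₂₎ y² x²₁ ⊗ X¹₂ y³ x²₂ ⊗ S⁻¹(f¹ X² x³) ⊗ S⁻¹(f² X³)`. -/
def Ω (hS : Function.Bijective Q.S) : H ⊗[k] (H ⊗[k] (H ⊗[k] (H ⊗[k] H))) :=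
  sw3 Q.Φ fun X1 X2 X3 => sw3 Q.Φinv fun y1 y2 y3 => sw3 Q.Φinv fun x1 x2 x3 =>
  sw Q.f fun f1 f2 => sw (Q.Δ X1) fun X11 X12 => sw (Q.Δ X11) fun X111 X112 =>
  sw (Q.Δ x2) fun x21 x22 =>
    (X111 * y1 * x1) ⊗ₜ[k] ((X112 * y2 * x21) ⊗ₜ[k] ((X12 * y3 * x22) ⊗ₜ[k]
      (Q.Sinv hS (f1 * X2 * x3) ⊗ₜ[k] Q.Sinv hS (f2 * X3))))

/-- The underlying space `H* ⊗ H` of the quantum double; `φ ⋈ h` is `φ ⊗ h`. -/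
abbrev Double (k H : Type*) [Field k] [Ring H] [Algebra k H] : Type _ := Module.Dual k H ⊗[k] H

/-- The element `φ ⋈ h` of the quantum double. -/
def bow (φ : Module.Dual k H) (h : H) : Double k H := φ ⊗ₜ[k] h

theorem bow_add_left (φ φ' : Module.Dual k H) (h : H) : bow (φ + φ') h = bow φ h + bow φ' h :=
  TensorProduct.add_tmul _ _ _

theorem bow_add_right (φ : Module.Dual k H) (h h' : H) : bow φ (h + h') = bow φ h + bow φ h' :=
  TensorProduct.tmul_add _ _ _

theorem bow_smul_left (c : k) (φ : Module.Dual k H) (h : H) : bow (c • φ) h = c • bow φ h :=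
  (TensorProduct.smul_tmul' _ _ _).symm

theorem bow_smul_right (c : k) (φ : Module.Dual k H) (h : H) : bow φ (c • h) = c • bow φ h :=
  TensorProduct.tmul_smul _ _ _

/-- The product of `φ ⋈ h` and `ψ ⋈ h'`:
`[(Ω¹ ⇀ φ ↼ Ω⁵)(Ω² h₍₁,₁₎ ⇀ ψ ↼ S⁻¹(h₂) Ω⁴)] ⋈ Ω³ h₍₁,₂₎ h'`. -/
def doubleMulAux (hS : Function.Bijective Q.S) (φ : Module.Dual k H) (h : H)
    (ψ : Module.Dual k H) (h' : H) : Double k H :=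
  sw5 (Q.Ω hS) fun Ω1 Ω2 Ω3 Ω4 Ω5 => sw (Q.Δ h) fun h1 h2 => sw (Q.Δ h1) fun h11 h12 =>
    Q.conv (bimod Ω1 φ Ω5) (bimod (Ω2 * h11) ψ (Q.Sinv hS h2 * Ω4)) ⊗ₜ[k] (Ω3 * h12 * h')

theorem bimod_add (a : H) (φ φ' : Module.Dual k H) (b : H) :
    bimod a (φ + φ') b = bimod a φ b + bimod a φ' b := rfl

theorem bimod_smul (a : H) (c : k) (φ : Module.Dual k H) (b : H) :
    bimod a (c • φ) b = c • bimod a φ b := rfl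

theorem bimod_add_left (a a' : H) (φ : Module.Dual k H) (b : H) :
    bimod (a + a') φ b = bimod a φ b + bimod a' φ b := by
  ext; simp [bimod, mul_add]

theorem bimod_smul_left (a : H) (c : k) (φ : Module.Dual k H) (b : H) :
    bimod (c • a) φ b = c • bimod a φ b := by
  ext; simp [bimod]

theorem bimod_add_right (a : H) (φ : Module.Dual k H) (b b' : H) :
    bimod a φ (b + b') = bimod a φ b + bimod a φ b' := by
  ext; simp [bimod, add_mul]

theorem bimod_smul_right (a : H) (c : k) (φ : Module.Dual k H) (b : H) :
    bimod a φ (c • b) = c • bimod a φ b := by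
  ext; simp [bimod]

theorem conv_add (φ ψ ψ' : Module.Dual k H) :
    Q.conv φ (ψ + ψ') = Q.conv φ ψ + Q.conv φ ψ' := by
  simp [conv, TensorProduct.map_add_right, LinearMap.add_comp, LinearMap.comp_add]

theorem add_conv (φ φ' ψ : Module.Dual k H) :
    Q.conv (φ + φ') ψ = Q.conv φ ψ + Q.conv φ' ψ := by
  simp [conv, TensorProduct.map_add_left, LinearMap.add_comp, LinearMap.comp_add]

theorem conv_smul (c : k) (φ ψ : Module.Dual k H) : Q.conv φ (c • ψ) = c • Q.conv φ ψ := by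
  simp [conv, TensorProduct.map_smul_right, LinearMap.smul_comp, LinearMap.comp_smul]

theorem smul_conv (c : k) (φ ψ : Module.Dual k H) : Q.conv (c • φ) ψ = c • Q.conv φ ψ := by
  simp [conv, TensorProduct.map_smul_left, LinearMap.smul_comp, LinearMap.comp_smul]

theorem lin_doubleMulAux_fst (hS : Function.Bijective Q.S) (h : H) (ψ : Module.Dual k H) (h' : H) :
    IsLinearMap k fun φ => Q.doubleMulAux hS φ h ψ h' := by
  unfold doubleMulAux
  exact lin_sw5 _ fun _ _ _ _ _ => lin_sw _ fun _ _ => lin_sw _ fun _ _ => by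
    constructor <;> intros <;> simp [bimod_add, bimod_smul, add_conv, smul_conv,
      TensorProduct.add_tmul, TensorProduct.smul_tmul']

theorem lin_doubleMulAux_snd (hS : Function.Bijective Q.S) (φ ψ : Module.Dual k H) (h' : H) :
    IsLinearMap k fun h => Q.doubleMulAux hS φ h ψ h' := by
  unfold doubleMulAux
  exact lin_sw5 _ fun _ _ _ _ _ => lin_arg Q.Δ.toLinearMap.isLinear
    (fun h2 => lin_arg Q.Δ.toLinearMap.isLinear
      (fun h12 => by
        constructor <;> intros <;> simp [bimod_add_left, bimod_smul_left, conv_add,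
          conv_smul, mul_add, TensorProduct.add_tmul, TensorProduct.smul_tmul'])
      (fun h11 => by
        constructor <;> intros <;> simp [mul_add, add_mul, TensorProduct.tmul_add]))
    (fun h1 => lin_sw _ fun h11 h12 => by
      constructor <;> intros <;> simp [bimod_add_right, bimod_smul_right, conv_add,
        conv_smul, add_mul, TensorProduct.add_tmul, TensorProduct.smul_tmul'])

theorem lin_doubleMulAux_trd (hS : Function.Bijective Q.S) (φ : Module.Dual k H) (h h' : H) :
    IsLinearMap k fun ψ => Q.doubleMulAux hS φ h ψ h' := by
  unfold doubleMulAux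
  exact lin_sw5 _ fun _ _ _ _ _ => lin_sw _ fun _ _ => lin_sw _ fun _ _ => by
    constructor <;> intros <;> simp [bimod_add, bimod_smul, conv_add, conv_smul,
      TensorProduct.add_tmul, TensorProduct.smul_tmul']

theorem lin_doubleMulAux_fth (hS : Function.Bijective Q.S) (φ : Module.Dual k H) (h : H)
    (ψ : Module.Dual k H) : IsLinearMap k fun h' => Q.doubleMulAux hS φ h ψ h' := by
  unfold doubleMulAux
  exact lin_sw5 _ fun _ _ _ _ _ => lin_sw _ fun _ _ => lin_sw _ fun _ _ => by
    constructor <;> intros <;> simp [mul_add, TensorProduct.tmul_add]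

/-- The multiplication of the quantum double. -/
def doubleMul (hS : Function.Bijective Q.S) : Double k H →ₗ[k] Double k H →ₗ[k] Double k H :=
  bilin (fun d e => sw d fun φ h => sw e fun ψ h' => Q.doubleMulAux hS φ h ψ h')
    (fun _ => lin_arg ⟨fun _ _ => rfl, fun _ _ => rfl⟩
      (fun h => lin_sw _ fun ψ h' => Q.lin_doubleMulAux_fst hS h ψ h')
      (fun φ => lin_sw _ fun ψ h' => Q.lin_doubleMulAux_snd hS φ ψ h'))
    (fun _ => lin_sw _ fun φ h => lin_arg ⟨fun _ _ => rfl, fun _ _ => rfl⟩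
      (fun h' => Q.lin_doubleMulAux_trd hS φ h h')
      (fun ψ => Q.lin_doubleMulAux_fth hS φ h ψ))

/-- The embedding `i_D(h) = ε ⋈ h`. -/
def iD : H →ₗ[k] Double k H := TensorProduct.mk k (Module.Dual k H) H Q.ε.toLinearMap

/-- The unit `ε ⋈ 1`. -/
def doubleOne : Double k H := Q.iD 1

/-- The comultiplication of the quantum double:
`Δ_D(φ ⋈ h) = (ε ⋈ X¹Y¹)(p¹₁x¹ ⇀ φ₂ ↼ Y²S⁻¹(p²) ⋈ p¹₂x²h₁) ⊗ (X²₁ ⇀ φ₁ ↼ S⁻¹(X³) ⋈ X²₂Y³x³h₂)`. -/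
def doubleComul (hS : Function.Bijective Q.S) [FiniteDimensional k H] :
    Double k H →ₗ[k] Double k H ⊗[k] Double k H :=
  TensorProduct.lift <| bilin
    (fun φ h => sw3 Q.Φ fun X1 X2 X3 => sw3 Q.Φ fun Y1 Y2 Y3 => sw3 Q.Φinv fun x1 x2 x3 =>
      sw Q.pR fun p1 p2 => sw (Q.Δ p1) fun p11 p12 => sw (Q.Δ X2) fun X21 X22 =>
      sw (dualComul φ) fun φ1 φ2 => sw (Q.Δ h) fun h1 h2 =>
        Q.doubleMul hS (Q.iD (X1 * Y1))
            (bow (bimod (p11 * x1) φ2 (Y2 * Q.Sinv hS p2)) (p12 * x2 * h1)) ⊗ₜ[k]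
          bow (bimod X21 φ1 (Q.Sinv hS X3)) (X22 * Y3 * x3 * h2))
    (fun h => lin_sw3 _ fun _ _ _ => lin_sw3 _ fun _ _ _ => lin_sw3 _ fun _ _ _ =>
      lin_sw _ fun _ _ => lin_sw _ fun _ _ => lin_sw _ fun _ _ =>
      lin_arg dualComul.isLinear
        (fun φ2 => lin_sw _ fun _ _ => by
          constructor <;> intros <;> simp [bow_add_left, bow_smul_left, bimod_add, bimod_smul,
            TensorProduct.tmul_add, TensorProduct.smul_tmul'])
        (fun φ1 => lin_sw _ fun _ _ => by
          constructor <;> intros <;> simp [bow_add_left, bow_smul_left, bimod_add, bimod_smul,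
            TensorProduct.add_tmul, TensorProduct.smul_tmul']))
    (fun φ => lin_sw3 _ fun _ _ _ => lin_sw3 _ fun _ _ _ => lin_sw3 _ fun _ _ _ =>
      lin_sw _ fun _ _ => lin_sw _ fun _ _ => lin_sw _ fun _ _ => lin_sw _ fun _ _ =>
      lin_arg Q.Δ.toLinearMap.isLinear
        (fun h2 => by
          constructor <;> intros <;> simp [bow_add_right, bow_smul_right, mul_add,
            TensorProduct.add_tmul, TensorProduct.smul_tmul'])
        (fun h1 => by
          constructor <;> intros <;> simp [bow_add_right, bow_smul_right, mul_add,
            TensorProduct.tmul_add]))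

/-- The counit of the quantum double: `ε_D(φ ⋈ h) = ε(h) φ(S⁻¹(α))`. -/
def doubleCounit (hS : Function.Bijective Q.S) : Double k H →ₗ[k] k :=
  TensorProduct.lift <| bilin (fun φ h => Q.ε h * φ (Q.Sinv hS Q.α))
    (fun h => by constructor <;> intros <;> simp [mul_add, mul_left_comm])
    (fun φ => by constructor <;> intros <;> simp [add_mul, mul_assoc])

/-- The reassociator of the quantum double: `Φ_D = (i_D ⊗ i_D ⊗ i_D)(Φ)`. -/
def doubleReassoc : Double k H ⊗[k] (Double k H ⊗[k] Double k H) :=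
  TensorProduct.map Q.iD (TensorProduct.map Q.iD Q.iD) Q.Φ

/-- `M` with the action `act`, multiplication `μ` and unit `η` is a left `D(H)`-module algebra,
that is, an algebra in the monoidal category of left `D(H)`-modules. -/
structure IsDoubleModuleAlgebra (hS : Function.Bijective Q.S) [FiniteDimensional k H]
    {M : Type*} [AddCommGroup M] [Module k M]
    (act : Double k H →ₗ[k] M →ₗ[k] M) (μ : M →ₗ[k] M →ₗ[k] M) (η : M) : Prop where
  one_act : ∀ m, act Q.doubleOne m = m
  mul_act : ∀ d e m, act (Q.doubleMul hS d e) m = act d (act e m)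
  act_mul : ∀ d a b, act d (μ a b) =
    sw (Q.doubleComul hS d) fun d1 d2 => μ (act d1 a) (act d2 b)
  act_one : ∀ d, act d η = Q.doubleCounit hS d • η
  mul_assoc : ∀ a b c, μ (μ a b) c =
    sw3 Q.doubleReassoc fun X1 X2 X3 => μ (act X1 a) (μ (act X2 b) (act X3 c))
  one_mul : ∀ a, μ η a = a
  mul_one : ∀ a, μ a η = a

/-- The bilinear map
`(φ, t) ↦ ⟨φ, q² x³ y³₂ S⁻¹(q̃¹ y²₁ t₁ g¹) y¹⟩ q¹₁ x¹ q̃² y²₂ t₂ g² S(q¹₂ x² y³₁)`, where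
`q_R = q¹ ⊗ q²`, `q_L = q̃¹ ⊗ q̃²` and `f⁻¹ = g¹ ⊗ g²`. -/
def schrodingerAux (hS : Function.Bijective Q.S) : Module.Dual k H →ₗ[k] H →ₗ[k] H :=
  bilin
    (fun φ t =>
      sw (Q.qR hS) fun q1 q2 => sw (Q.Δ q1) fun q11 q12 =>
      sw3 Q.Φinv fun x1 x2 x3 => sw3 Q.Φinv fun y1 y2 y3 =>
      sw Q.qL fun r1 r2 => sw Q.fInv fun g1 g2 =>
      sw (Q.Δ y2) fun y21 y22 => sw (Q.Δ y3) fun y31 y32 => sw (Q.Δ t) fun t1 t2 =>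
        φ (q2 * x3 * y32 * Q.Sinv hS (r1 * y21 * t1 * g1) * y1) •
          (q11 * x1 * r2 * y22 * t2 * g2 * Q.S (q12 * x2 * y31)))
    (fun t => lin_sw _ fun _ _ => lin_sw _ fun _ _ => lin_sw3 _ fun _ _ _ =>
      lin_sw3 _ fun _ _ _ => lin_sw _ fun _ _ => lin_sw _ fun _ _ => lin_sw _ fun _ _ =>
      lin_sw _ fun _ _ => lin_sw _ fun _ _ =>
        ⟨fun _ _ => add_smul _ _ _, fun _ _ => mul_smul _ _ _⟩)
    (fun φ => lin_sw _ fun _ _ => lin_sw _ fun _ _ => lin_sw3 _ fun _ _ _ =>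
      lin_sw3 _ fun _ _ _ => lin_sw _ fun _ _ => lin_sw _ fun _ _ => lin_sw _ fun _ _ =>
      lin_sw _ fun _ _ => lin_arg Q.Δ.toLinearMap.isLinear
        (fun t2 => by constructor <;> intros <;> simp [mul_add, add_mul, add_smul, mul_smul])
        (fun t1 => by
          constructor <;> intros
          · simp [mul_add, add_mul]
          · simp only [mul_smul_comm, smul_mul_assoc]
            rw [smul_comm]))

/-- The action of the quantum double on `H₀`: `φ ⋈ h` sends `h'` to
`⟨φ, q² x³ y³₂ S⁻¹(q̃¹ y²₁ (h ▷ h')₁ g¹) y¹⟩ q¹₁ x¹ q̃² y²₂ (h ▷ h')₂ g² S(q¹₂ x² y³₁)`. -/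
def schrodinger (hS : Function.Bijective Q.S) : Double k H →ₗ[k] H →ₗ[k] H :=
  TensorProduct.lift <| bilin (fun φ h => Q.schrodingerAux hS φ ∘ₗ Q.adj h)
    (fun h => by constructor <;> intros <;> simp [LinearMap.add_comp, LinearMap.smul_comp])
    (fun φ => by constructor <;> intros <;> simp [LinearMap.comp_add, LinearMap.comp_smul])

end QuasiHopfAlgebra

end QuasiHopf

end

/-! The proof works with representations instead of elements. A family of operators `i : H → End P`
is treated as an object: `cv i j` is the tensor product h ↦ i(h₁)j(h₂), `as i j l` is Φ acting
through three commuting families, and `Intw` expresses naturality. The axioms become rewriting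
rules: `as_cv`, `pentagon`, and the deletion of a reassociator one of whose slots is trivial. The
antipode axioms say that inserting β (`ins`) produces an invariant, that evaluating with α (`kap`)
produces the trivial representation, and that the two zigzags are identities.

H₀ acts from the right on every representation, linearly and naturally, by `R` : p ⊗ h ↦
x³S⁻¹(αx²h)x¹p. The product `mu` is this action on the slot of H where h acts by right
multiplication by S(h), so associativity is the module axiom `R_mu`. The action on an inserted β
recovers an element of H₀ (`R_recover`). Hence the braiding `cc` of a representation v past H₀ is
controlled by one relation, `R_cc`: moving H₀ past v and then acting on x equals acting on x ⊗ v.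
From it follow the compatibilities with tensor products (`cc_cc`) and with the product (`cc_mu`). On
regular representations these, together with linearity and the unit and counit cases, are the axioms
of a Yetter-Drinfeld algebra.

The braiding must be matched with the explicit coaction (`cc_eq`, `coaction_eq`). This uses the
twist f⁻¹, which compares two antipodes along Δ, namely Δ ∘ S and (S ⊗ S) ∘ Δᵒᵖ; its relations come
from the argument for uniqueness of the antipode (`mul_twistElt`, `mul_twistElt_eq`).

For the double, let θ (`th`) be the braiding followed by q_R. The functional φ acts through the
matrix coefficient of θ on the regular representation. Two θ's compose to the θ of a tensor product,
corrected by Ω (`th_th`), which gives the product of D(H). The behaviour of θ on products in H₀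
(`th_mu`), with p_R undoing q_R (`pR_qq`), gives the comultiplication. The normalization ε(α) = 1
makes ε ⋈ h act as the adjoint action of h. -/

noncomputable section

namespace QuasiHopf

/-! ### Families of operators acting in separate tensor slots. -/

section Slots

variable {k A B C D P P' P'' : Type*} [Field k]
  [Ring A] [Algebra k A] [Ring B] [Algebra k B] [Ring C] [Algebra k C] [Ring D] [Algebra k D]
  [AddCommGroup P] [Module k P] [AddCommGroup P'] [Module k P'] [AddCommGroup P''] [Module k P'']

/-- A linear family of operators is a representation. -/
class Rep (i : A →ₗ[k] Module.End k P) : Prop where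
  one : i 1 = 1
  mul : ∀ a b u, i (a * b) u = i a (i b u)

/-- Two families of operators commute. -/
class Cm (i : A →ₗ[k] Module.End k P) (j : B →ₗ[k] Module.End k P) : Prop where
  comm : ∀ a b u, i a (j b u) = j b (i a u)

/-- `F` intertwines two families of operators. -/
class Intw (F : P →ₗ[k] P') (i : A →ₗ[k] Module.End k P) (i' : A →ₗ[k] Module.End k P') : Prop where
  intw : ∀ a u, F (i a u) = i' a (F u)

theorem Rep.one_apply (i : A →ₗ[k] Module.End k P) [Rep i] (u : P) : i 1 u = u := by
  rw [Rep.one (i := i)]; rfl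

/-- The product of two families of operators, `a ⊗ b ↦ i(a) j(b)`. -/
def ac (i : A →ₗ[k] Module.End k P) (j : B →ₗ[k] Module.End k P) :
    A ⊗[k] B →ₗ[k] Module.End k P :=
  TensorProduct.lift ((LinearMap.mul k (Module.End k P)).compl₁₂ i j)

@[simp]
theorem ac_tmul (i : A →ₗ[k] Module.End k P) (j : B →ₗ[k] Module.End k P) (a : A) (b : B) (u : P) :
    ac i j (a ⊗ₜ b) u = i a (j b u) := by
  simp [ac]

instance (i : A →ₗ[k] Module.End k P) (j : B →ₗ[k] Module.End k P) [Rep i] [Rep j] [Cm i j] :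
    Rep (ac i j) where
  one := by
    ext u
    rw [Algebra.TensorProduct.one_def, ac_tmul, Rep.one_apply, Rep.one_apply]; rfl
  mul s t u := by
    induction s using TensorProduct.induction_on with
    | zero => simp
    | add x y hx hy => simp [add_mul, hx, hy]
    | tmul a b =>
      induction t using TensorProduct.induction_on with
      | zero => simp
      | add x y hx hy => simp [mul_add, hx, hy]
      | tmul c d =>
        simp only [Algebra.TensorProduct.tmul_mul_tmul, ac_tmul, Rep.mul]
        rw [Cm.comm (i := i) (j := j) c b]

instance (i : A →ₗ[k] Module.End k P) (j : B →ₗ[k] Module.End k P) (l : C →ₗ[k] Module.End k P)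
    [Cm i l] [Cm j l] : Cm (ac i j) l where
  comm s c u := by
    induction s using TensorProduct.induction_on with
    | zero => simp
    | add x y hx hy => simp [hx, hy]
    | tmul a b => rw [ac_tmul, ac_tmul, Cm.comm (i := j) (j := l), Cm.comm (i := i) (j := l)]

instance (i : A →ₗ[k] Module.End k P) (j : B →ₗ[k] Module.End k P) (l : C →ₗ[k] Module.End k P)
    [Cm l i] [Cm l j] : Cm l (ac i j) where
  comm c s u := by
    induction s using TensorProduct.induction_on with
    | zero => simp
    | add x y hx hy => simp [hx, hy]
    | tmul a b => rw [ac_tmul, ac_tmul, Cm.comm (i := l) (j := i), Cm.comm (i := l) (j := j)]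

instance (F : P →ₗ[k] P') (i : A →ₗ[k] Module.End k P) (j : B →ₗ[k] Module.End k P)
    (i' : A →ₗ[k] Module.End k P') (j' : B →ₗ[k] Module.End k P')
    [Intw F i i'] [Intw F j j'] : Intw F (ac i j) (ac i' j') where
  intw s u := by
    induction s using TensorProduct.induction_on with
    | zero => simp
    | add x y hx hy => simp [hx, hy]
    | tmul a b => rw [ac_tmul, ac_tmul, Intw.intw (i := i) (i' := i'), Intw.intw (i := j) (i' := j')]

theorem ac_assoc (i : A →ₗ[k] Module.End k P) (j : B →ₗ[k] Module.End k P)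
    (l : C →ₗ[k] Module.End k P) (t : (A ⊗[k] B) ⊗[k] C) :
    ac i (ac j l) (TensorProduct.assoc k A B C t) = ac (ac i j) l t := by
  have : ac i (ac j l) ∘ₗ (TensorProduct.assoc k A B C).toLinearMap = ac (ac i j) l := by
    ext; simp
  exact congrArg (fun f => f t) this

theorem ac_lTensor (i : A →ₗ[k] Module.End k P) (j : C →ₗ[k] Module.End k P)
    (f : B →ₗ[k] C) (t : A ⊗[k] B) : ac i j (f.lTensor A t) = ac i (j ∘ₗ f) t := by
  have : ac i j ∘ₗ f.lTensor A = ac i (j ∘ₗ f) := by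
    ext; simp
  exact congrArg (fun f => f t) this

theorem ac_rTensor (i : C →ₗ[k] Module.End k P) (j : B →ₗ[k] Module.End k P)
    (f : A →ₗ[k] C) (t : A ⊗[k] B) : ac i j (f.rTensor B t) = ac (i ∘ₗ f) j t := by
  have : ac i j ∘ₗ f.rTensor B = ac (i ∘ₗ f) j := by
    ext; simp
  exact congrArg (fun f => f t) this

/-- Operators on the left factor of a tensor product. -/
def onl (P' : Type*) [AddCommGroup P'] [Module k P'] (i : A →ₗ[k] Module.End k P) :
    A →ₗ[k] Module.End k (P ⊗[k] P') :=
  LinearMap.rTensorHom P' ∘ₗ i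

/-- Operators on the right factor of a tensor product. -/
def onr (P : Type*) [AddCommGroup P] [Module k P] (i : A →ₗ[k] Module.End k P') :
    A →ₗ[k] Module.End k (P ⊗[k] P') :=
  LinearMap.lTensorHom P ∘ₗ i

@[simp]
theorem onl_tmul (i : A →ₗ[k] Module.End k P) (a : A) (u : P) (v : P') :
    onl P' i a (u ⊗ₜ v) = i a u ⊗ₜ v := rfl

@[simp]
theorem onr_tmul (i : A →ₗ[k] Module.End k P') (a : A) (u : P) (v : P') :
    onr P i a (u ⊗ₜ v) = u ⊗ₜ i a v := rfl

theorem ext_tmul {F G : P ⊗[k] P' →ₗ[k] P''} (h : ∀ u v, F (u ⊗ₜ v) = G (u ⊗ₜ v)) (t : P ⊗[k] P') :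
    F t = G t := by
  rw [TensorProduct.ext' h]

instance (i : A →ₗ[k] Module.End k P) [Rep i] : Rep (onl P' i) where
  one := by ext; simp [Rep.one_apply]
  mul a b u := ext_tmul (F := onl P' i (a * b)) (G := onl P' i a ∘ₗ onl P' i b)
    (by simp [Rep.mul]) u

instance (i : A →ₗ[k] Module.End k P') [Rep i] : Rep (onr P i) where
  one := by ext; simp [Rep.one_apply]
  mul a b u := ext_tmul (F := onr P i (a * b)) (G := onr P i a ∘ₗ onr P i b)
    (by simp [Rep.mul]) u

instance (i : A →ₗ[k] Module.End k P) (j : B →ₗ[k] Module.End k P') :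
    Cm (onl P' i) (onr P j) where
  comm a b u := ext_tmul (F := onl P' i a ∘ₗ onr P j b) (G := onr P j b ∘ₗ onl P' i a)
    (by simp) u

instance (i : A →ₗ[k] Module.End k P) (j : B →ₗ[k] Module.End k P') :
    Cm (onr P j) (onl P' i) where
  comm a b u := ext_tmul (F := onr P j a ∘ₗ onl P' i b) (G := onl P' i b ∘ₗ onr P j a)
    (by simp) u

instance (i : A →ₗ[k] Module.End k P) (j : B →ₗ[k] Module.End k P) [Cm i j] :
    Cm (onl P' i) (onl P' j) where
  comm a b u := ext_tmul (F := onl P' i a ∘ₗ onl P' j b) (G := onl P' j b ∘ₗ onl P' i a)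
    (by simp [Cm.comm (i := i) (j := j)]) u

instance (i : A →ₗ[k] Module.End k P') (j : B →ₗ[k] Module.End k P') [Cm i j] :
    Cm (onr P i) (onr P j) where
  comm a b u := ext_tmul (F := onr P i a ∘ₗ onr P j b) (G := onr P j b ∘ₗ onr P i a)
    (by simp [Cm.comm (i := i) (j := j)]) u

instance (F : P →ₗ[k] P') (i : A →ₗ[k] Module.End k P) (i' : A →ₗ[k] Module.End k P') [Intw F i i'] :
    Intw (F.rTensor P'') (onl P'' i) (onl P'' i') where
  intw a u := ext_tmul (F := F.rTensor P'' ∘ₗ onl P'' i a) (G := onl P'' i' a ∘ₗ F.rTensor P'')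
    (by simp [Intw.intw (F := F) (i := i) (i' := i')]) u

instance (F : P →ₗ[k] P') (i : A →ₗ[k] Module.End k P'') :
    Intw (F.rTensor P'') (onr P i) (onr P' i) where
  intw a u := ext_tmul (F := F.rTensor P'' ∘ₗ onr P i a) (G := onr P' i a ∘ₗ F.rTensor P'')
    (by simp) u

instance (F : P →ₗ[k] P') (i : A →ₗ[k] Module.End k P) (i' : A →ₗ[k] Module.End k P') [Intw F i i'] :
    Intw (F.lTensor P'') (onr P'' i) (onr P'' i') where
  intw a u := ext_tmul (F := F.lTensor P'' ∘ₗ onr P'' i a) (G := onr P'' i' a ∘ₗ F.lTensor P'')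
    (by simp [Intw.intw (F := F) (i := i) (i' := i')]) u

theorem intw_comp (F : P →ₗ[k] P') (G : P' →ₗ[k] P'') (i : A →ₗ[k] Module.End k P)
    (i' : A →ₗ[k] Module.End k P') (i'' : A →ₗ[k] Module.End k P'') [Intw F i i'] [Intw G i' i''] :
    Intw (G ∘ₗ F) i i'' where
  intw a u := by
    rw [LinearMap.comp_apply, Intw.intw (F := F) (i := i) (i' := i'),
      Intw.intw (F := G) (i := i') (i' := i'')]; rfl

end Slots

/-! ### Sweedler sums as values of linear maps. -/

section SweedlerMaps

variable {k A B C P P' : Type*} [Field k]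
  [AddCommMonoid A] [Module k A] [AddCommMonoid B] [Module k B] [AddCommMonoid C] [Module k C]
  [AddCommMonoid P] [Module k P] [AddCommMonoid P'] [Module k P']

theorem sw_apply (L : A ⊗[k] B →ₗ[k] P) (T : A ⊗[k] B) : sw T (fun a b => L (a ⊗ₜ b)) = L T := by
  have h := sw_eq_lift (TensorProduct.mk k A B |>.compr₂ L) T
  simp only [LinearMap.compr₂_apply, TensorProduct.mk_apply] at h
  rw [h, TensorProduct.lift_compr₂, TensorProduct.lift_mk, LinearMap.comp_id]

theorem sw3_apply (L : A ⊗[k] (B ⊗[k] C) →ₗ[k] P) (T : A ⊗[k] (B ⊗[k] C)) :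
    sw3 T (fun a b c => L (a ⊗ₜ (b ⊗ₜ c))) = L T := by
  rw [← sw_apply L T, sw3]
  congr 1; funext a t
  exact sw_apply (L ∘ₗ TensorProduct.mk k A (B ⊗[k] C) a) t

theorem map_sw (L : P →ₗ[k] P') (T : A ⊗[k] B) (F : A → B → P) :
    L (sw T F) = sw T fun a b => L (F a b) := by
  simp [sw]

theorem map_sw3 (L : P →ₗ[k] P') (T : A ⊗[k] (B ⊗[k] C)) (F : A → B → C → P) :
    L (sw3 T F) = sw3 T fun a b c => L (F a b c) := by
  simp only [sw3, map_sw]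

end SweedlerMaps

/-! ### Tensor products of representations and the reassociator as an operator. -/

namespace QuasiHopfAlgebra

variable {k H P P' : Type*} [Field k] [Ring H] [Algebra k H] (Q : QuasiHopfAlgebra k H)
  [AddCommGroup P] [Module k P] [AddCommGroup P'] [Module k P']

/-- The tensor product of two families of operators: `h ↦ i(h₁) j(h₂)`. -/
def cv (i j : H →ₗ[k] Module.End k P) : H →ₗ[k] Module.End k P := ac i j ∘ₗ Q.Δ.toLinearMap

/-- The reassociator acting through three families of operators. -/
def as (i j l : H →ₗ[k] Module.End k P) : Module.End k P := ac i (ac j l) Q.Φ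

/-- The inverse reassociator acting through three families of operators. -/
def asi (i j l : H →ₗ[k] Module.End k P) : Module.End k P := ac i (ac j l) Q.Φinv

/-- The trivial family of operators, given by the counit. -/
def tr (P : Type*) [AddCommGroup P] [Module k P] : H →ₗ[k] Module.End k P :=
  (LinearMap.toSpanSingleton k (Module.End k P) 1) ∘ₗ Q.ε.toLinearMap

@[simp]
theorem tr_apply (h : H) (u : P) : Q.tr P h u = Q.ε h • u := by simp [tr]

instance : Rep (Q.tr P) where
  one := by ext; simp
  mul a b u := by rw [tr_apply, tr_apply, tr_apply, map_mul, mul_smul]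

instance (i : H →ₗ[k] Module.End k P) : Cm (Q.tr P) i where
  comm a b u := by simp

instance (i : H →ₗ[k] Module.End k P) : Cm i (Q.tr P) where
  comm a b u := by simp

theorem cv_apply (i j : H →ₗ[k] Module.End k P) (h : H) : Q.cv i j h = ac i j (Q.Δ h) := rfl

theorem cv_apply_sw (i j : H →ₗ[k] Module.End k P) (h : H) (u : P) :
    Q.cv i j h u = sw (Q.Δ h) fun a b => i a (j b u) := by
  rw [cv_apply]
  exact (sw_apply ((LinearMap.applyₗ u) ∘ₗ ac i j) _).symm.trans (by simp)

theorem as_apply_sw (i j l : H →ₗ[k] Module.End k P) (u : P) :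
    Q.as i j l u = sw3 Q.Φ fun a b c => i a (j b (l c u)) :=
  (sw3_apply ((LinearMap.applyₗ u) ∘ₗ ac i (ac j l)) _).symm.trans (by simp)

theorem asi_apply_sw (i j l : H →ₗ[k] Module.End k P) (u : P) :
    Q.asi i j l u = sw3 Q.Φinv fun a b c => i a (j b (l c u)) :=
  (sw3_apply ((LinearMap.applyₗ u) ∘ₗ ac i (ac j l)) _).symm.trans (by simp)

instance (i j : H →ₗ[k] Module.End k P) [Rep i] [Rep j] [Cm i j] : Rep (Q.cv i j) where
  one := by rw [cv_apply, map_one, Rep.one]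
  mul a b u := by rw [cv_apply, cv_apply, cv_apply, map_mul, Rep.mul]

instance {A : Type*} [Ring A] [Algebra k A] (i j : H →ₗ[k] Module.End k P)
    (l : A →ₗ[k] Module.End k P) [Cm i l] [Cm j l] : Cm (Q.cv i j) l where
  comm a b u := by rw [cv_apply, Cm.comm]

instance {A : Type*} [Ring A] [Algebra k A] (i j : H →ₗ[k] Module.End k P)
    (l : A →ₗ[k] Module.End k P) [Cm l i] [Cm l j] : Cm l (Q.cv i j) where
  comm a b u := by rw [cv_apply, Cm.comm]

instance intw_cv (F : P →ₗ[k] P') (i j : H →ₗ[k] Module.End k P) (i' j' : H →ₗ[k] Module.End k P')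
    [Intw F i i'] [Intw F j j'] : Intw F (Q.cv i j) (Q.cv i' j') where
  intw a u := by rw [cv_apply, cv_apply, Intw.intw (F := F) (i := ac i j) (i' := ac i' j')]

section Associativity

variable (i j l m : H →ₗ[k] Module.End k P)

theorem asi_as [Rep i] [Rep j] [Rep l] [Cm i j] [Cm i l] [Cm j l] (u : P) :
    Q.asi i j l (Q.as i j l u) = u := by
  rw [asi, as, ← Rep.mul, Q.Φinv_mul_Φ, Rep.one_apply]

theorem as_asi [Rep i] [Rep j] [Rep l] [Cm i j] [Cm i l] [Cm j l] (u : P) :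
    Q.as i j l (Q.asi i j l u) = u := by
  rw [asi, as, ← Rep.mul, Q.Φ_mul_Φinv, Rep.one_apply]

/-- Quasi-coassociativity, read as H-linearity of the associativity constraint (i ⊗ j) ⊗ l → i ⊗ (j
⊗ l). -/
theorem as_cv [Rep i] [Rep j] [Rep l] [Cm i j] [Cm i l] [Cm j l] (h : H) (u : P) :
    Q.as i j l (Q.cv (Q.cv i j) l h u) = Q.cv i (Q.cv j l) h (Q.as i j l u) := by
  have e := congrArg (fun t => t * Q.Φ) (Q.quasi_coassoc h)
  simp only [mul_assoc, Q.Φinv_mul_Φ, mul_one] at e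
  have e' := congrArg (fun t => ac i (ac j l) t u) e
  simp only [Rep.mul] at e'
  rw [ac_lTensor, ac_assoc, ac_rTensor] at e'
  exact e'.symm

theorem asi_cv [Rep i] [Rep j] [Rep l] [Cm i j] [Cm i l] [Cm j l] (h : H) (u : P) :
    Q.asi i j l (Q.cv i (Q.cv j l) h u) = Q.cv (Q.cv i j) l h (Q.asi i j l u) := by
  conv_lhs => rw [← Q.as_asi i j l u]
  rw [← as_cv, asi_as]

theorem pentagon [Rep i] [Rep j] [Rep l] [Rep m] [Cm i j] [Cm i l] [Cm i m] [Cm j l] [Cm j m]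
    [Cm l m] (u : P) :
    Q.as j l m (Q.as i (Q.cv j l) m (Q.as i j l u)) =
      Q.as i j (Q.cv l m) (Q.as (Q.cv i j) l m u) := by
  have e := congrArg (fun t => ac i (ac j (ac l m)) t u) Q.cocycle
  simp only [Rep.mul, ac_tmul, Rep.one_apply] at e
  rw [ac_lTensor, ac_lTensor, ac_assoc, ac_assoc, ac_assoc, ac_rTensor, ac_tmul,
    Rep.one_apply] at e
  -- After regrouping legs, each factor of the cocycle equation is one reassociator; these three
  -- identities treat Φ ⊗ 1, (id ⊗ Δ ⊗ id)(Φ) and (id ⊗ id ⊗ Δ)(Φ).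
  have e1 : ac (ac i j) l ((TensorProduct.assoc k H H H).symm Q.Φ) = Q.as i j l := by
    rw [← ac_assoc, LinearEquiv.apply_symm_apply]; rfl
  have e2 : ac j (ac l m) ∘ₗ ((TensorProduct.assoc k H H H).toLinearMap ∘ₗ
      Q.Δ.toLinearMap.rTensor H) = ac (Q.cv j l) m := by
    ext a b : 3
    simp only [TensorProduct.AlgebraTensorModule.curry_apply, LinearMap.restrictScalars_self,
      TensorProduct.curry_apply, LinearMap.comp_apply, LinearMap.rTensor_tmul, LinearEquiv.coe_coe,
      ac_assoc]
    ext u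
    simp [cv_apply]
  have e3 : ac j (ac l m) ∘ₗ Q.Δ.toLinearMap.lTensor H = ac j (Q.cv l m) := by
    ext; simp [cv_apply]
  rw [e1, e2, e3] at e
  exact e

end Associativity

end QuasiHopfAlgebra

/-! ### Trivial slots, solved forms of the pentagon, naturality. -/

namespace QuasiHopfAlgebra

variable {k H P P' P'' : Type*} [Field k] [Ring H] [Algebra k H] (Q : QuasiHopfAlgebra k H)
  [AddCommGroup P] [Module k P] [AddCommGroup P'] [Module k P'] [AddCommGroup P''] [Module k P'']

section Counit

theorem cv_tr (i : H →ₗ[k] Module.End k P) : Q.cv i (Q.tr P) = i := by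
  ext h u
  have : ac i (Q.tr P) = ac i ((LinearMap.toSpanSingleton k (Module.End k P) 1)) ∘ₗ
      Q.ε.toLinearMap.lTensor H := by
    ext; simp
  rw [cv_apply, this, LinearMap.comp_apply, Q.counit_right]
  simp

theorem tr_cv (i : H →ₗ[k] Module.End k P) : Q.cv (Q.tr P) i = i := by
  ext h u
  have : ac (Q.tr P) i = ac ((LinearMap.toSpanSingleton k (Module.End k P) 1)) i ∘ₗ
      Q.ε.toLinearMap.rTensor H := by
    ext; simp
  rw [cv_apply, this, LinearMap.comp_apply, Q.counit_left]
  simp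

theorem as_tr_mid (i l : H →ₗ[k] Module.End k P) [Rep i] [Rep l] (u : P) :
    Q.as i (Q.tr P) l u = u := by
  have : ac i (ac (Q.tr P) l) = ac i (ac (LinearMap.toSpanSingleton k (Module.End k P) 1) l) ∘ₗ
      (Q.ε.toLinearMap.rTensor H).lTensor H := by
    ext; simp
  rw [as, this, LinearMap.comp_apply, Q.counit_mid]
  simp [Rep.one_apply]

variable (i j l : H →ₗ[k] Module.End k P)

/-- Only the middle counit axiom is assumed. With two adjacent trivial slots the pentagon says that
this operator is idempotent; being invertible, it is the identity. -/
theorem as_tr_left [Rep j] [Rep l] [Cm j l] (u : P) : Q.as (Q.tr P) j l u = u := by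
  have e := Q.pentagon (Q.tr P) (Q.tr P) j l u
  simp only [tr_cv, as_tr_mid] at e
  have e2 := congrArg (Q.asi (Q.tr P) j l) e
  rwa [asi_as, asi_as] at e2

theorem as_tr_right [Rep i] [Rep j] [Cm i j] (u : P) : Q.as i j (Q.tr P) u = u := by
  have e := Q.pentagon i j (Q.tr P) (Q.tr P) u
  simp only [cv_tr, as_tr_mid] at e
  have e2 := congrArg (Q.asi i j (Q.tr P)) e
  rwa [asi_as, asi_as] at e2

theorem asi_tr_mid [Rep i] [Rep l] [Cm i l] (u : P) : Q.asi i (Q.tr P) l u = u := by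
  conv_lhs => rw [← Q.as_tr_mid i l u]
  rw [asi_as]

theorem asi_tr_left [Rep j] [Rep l] [Cm j l] (u : P) : Q.asi (Q.tr P) j l u = u := by
  conv_lhs => rw [← Q.as_tr_left j l u]
  rw [asi_as]

theorem asi_tr_right [Rep i] [Rep j] [Cm i j] (u : P) : Q.asi i j (Q.tr P) u = u := by
  conv_lhs => rw [← Q.as_tr_right i j u]
  rw [asi_as]

end Counit

section Pentagon

variable (i j l m : H →ₗ[k] Module.End k P) [Rep i] [Rep j] [Rep l] [Rep m]
  [Cm i j] [Cm i l] [Cm i m] [Cm j l] [Cm j m] [Cm l m]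

/-- This and the next four lemmas are the pentagon solved for different pairs of its five operators;
the later diagram chases consist of rewriting with them. -/
theorem pentagon_inv (u : P) :
    Q.asi i j l (Q.asi i (Q.cv j l) m (Q.asi j l m u)) =
      Q.asi (Q.cv i j) l m (Q.asi i j (Q.cv l m) u) := by
  have e := Q.pentagon i j l m (Q.asi (Q.cv i j) l m (Q.asi i j (Q.cv l m) u))
  simp only [as_asi] at e
  conv_lhs => rw [← e]
  simp only [asi_as]

theorem pentagon_asi_as (u : P) :
    Q.asi i j (Q.cv l m) (Q.as j l m u) =
      Q.as (Q.cv i j) l m (Q.asi i j l (Q.asi i (Q.cv j l) m u)) := by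
  have e := Q.pentagon i j l m (Q.asi i j l (Q.asi i (Q.cv j l) m u))
  simp only [as_asi] at e
  rw [e, asi_as]

theorem pentagon_asi_as' (u : P) :
    Q.asi j l m (Q.as i j (Q.cv l m) u) =
      Q.as i (Q.cv j l) m (Q.as i j l (Q.asi (Q.cv i j) l m u)) := by
  have e := Q.pentagon i j l m (Q.asi (Q.cv i j) l m u)
  simp only [as_asi] at e
  rw [← e, asi_as]

theorem pentagon_as_asi (u : P) :
    Q.as (Q.cv i j) l m (Q.asi i j l u) =
      Q.asi i j (Q.cv l m) (Q.as j l m (Q.as i (Q.cv j l) m u)) := by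
  have e := Q.pentagon i j l m (Q.asi i j l u)
  simp only [as_asi] at e
  rw [e, asi_as]

theorem pentagon_as_asi' (u : P) :
    Q.as i j l (Q.asi (Q.cv i j) l m u) =
      Q.asi i (Q.cv j l) m (Q.asi j l m (Q.as i j (Q.cv l m) u)) := by
  have e := Q.pentagon i j l m (Q.asi (Q.cv i j) l m u)
  simp only [as_asi] at e
  rw [← e, asi_as, asi_as]

end Pentagon

section Intertwine

instance intw_ac {A B : Type*} [Ring A] [Algebra k A] [Ring B] [Algebra k B]
    (F : P →ₗ[k] P') (i : A →ₗ[k] Module.End k P) (j : B →ₗ[k] Module.End k P)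
    (i' : A →ₗ[k] Module.End k P') (j' : B →ₗ[k] Module.End k P')
    [Intw F i i'] [Intw F j j'] : Intw F (ac i j) (ac i' j') := inferInstance

theorem intw_as (F : P →ₗ[k] P') (i j l : H →ₗ[k] Module.End k P)
    (i' j' l' : H →ₗ[k] Module.End k P') [Intw F i i'] [Intw F j j'] [Intw F l l'] (u : P) :
    F (Q.as i j l u) = Q.as i' j' l' (F u) :=
  Intw.intw (F := F) (i := ac i (ac j l)) (i' := ac i' (ac j' l')) _ _

theorem intw_asi (F : P →ₗ[k] P') (i j l : H →ₗ[k] Module.End k P)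
    (i' j' l' : H →ₗ[k] Module.End k P') [Intw F i i'] [Intw F j j'] [Intw F l l'] (u : P) :
    F (Q.asi i j l u) = Q.asi i' j' l' (F u) :=
  Intw.intw (F := F) (i := ac i (ac j l)) (i' := ac i' (ac j' l')) _ _

instance (F : P →ₗ[k] P') : Intw F (Q.tr P) (Q.tr P') where
  intw a u := by simp

instance (i j l x : H →ₗ[k] Module.End k P) [Cm i x] [Cm j x] [Cm l x] : Intw (Q.as i j l) x x where
  intw _ _ := Cm.comm (i := ac i (ac j l)) (j := x) _ _ _

instance (i j l x : H →ₗ[k] Module.End k P) [Cm i x] [Cm j x] [Cm l x] :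
    Intw (Q.asi i j l) x x where
  intw _ _ := Cm.comm (i := ac i (ac j l)) (j := x) _ _ _

instance (i j l : H →ₗ[k] Module.End k P) [Rep i] [Rep j] [Rep l] [Cm i j] [Cm i l] [Cm j l] :
    Intw (Q.as i j l) (Q.cv (Q.cv i j) l) (Q.cv i (Q.cv j l)) where
  intw a u := Q.as_cv i j l a u

instance (i j l : H →ₗ[k] Module.End k P) [Rep i] [Rep j] [Rep l] [Cm i j] [Cm i l] [Cm j l] :
    Intw (Q.asi i j l) (Q.cv i (Q.cv j l)) (Q.cv (Q.cv i j) l) where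
  intw a u := Q.asi_cv i j l a u

theorem onl_cv (i j : H →ₗ[k] Module.End k P) : onl P' (Q.cv i j) = Q.cv (onl P' i) (onl P' j) := by
  ext h u v
  have := Intw.intw (F := (TensorProduct.mk k P P').flip v) (i := Q.cv i j)
    (i' := Q.cv (onl P' i) (onl P' j)) (self := @intw_cv _ _ _ _ _ _ _ _ _ _ _ _ _ _ _ _ _
      ⟨fun a u => by simp⟩ ⟨fun a u => by simp⟩) h u
  simpa using this

theorem onr_cv (i j : H →ₗ[k] Module.End k P') : onr P (Q.cv i j) = Q.cv (onr P i) (onr P j) := by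
  ext h u v
  have := Intw.intw (F := TensorProduct.mk k P P' u) (i := Q.cv i j)
    (i' := Q.cv (onr P i) (onr P j)) (self := @intw_cv _ _ _ _ _ _ _ _ _ _ _ _ _ _ _ _ _
      ⟨fun a u => by simp⟩ ⟨fun a u => by simp⟩) h v
  simpa using this

theorem onl_as (i j l : H →ₗ[k] Module.End k P) (u : P ⊗[k] P') :
    Q.as (onl P' i) (onl P' j) (onl P' l) u = (Q.as i j l).rTensor P' u := by
  refine ext_tmul (F := Q.as (onl P' i) (onl P' j) (onl P' l)) (G := (Q.as i j l).rTensor P')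
    (fun u v => ?_) u
  have a1 : ∀ i : H →ₗ[k] Module.End k P,
      Intw ((TensorProduct.mk k P P').flip v) i (onl P' i) := fun i => ⟨fun a u => by simp⟩
  have := a1 i; have := a1 j; have := a1 l
  exact (Q.intw_as ((TensorProduct.mk k P P').flip v) i j l (onl P' i) (onl P' j) (onl P' l) u).symm

theorem onl_asi (i j l : H →ₗ[k] Module.End k P) (u : P ⊗[k] P') :
    Q.asi (onl P' i) (onl P' j) (onl P' l) u = (Q.asi i j l).rTensor P' u := by
  refine ext_tmul (F := Q.asi (onl P' i) (onl P' j) (onl P' l)) (G := (Q.asi i j l).rTensor P')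
    (fun u v => ?_) u
  have a1 : ∀ i : H →ₗ[k] Module.End k P,
      Intw ((TensorProduct.mk k P P').flip v) i (onl P' i) := fun i => ⟨fun a u => by simp⟩
  have := a1 i; have := a1 j; have := a1 l
  exact (Q.intw_asi ((TensorProduct.mk k P P').flip v) i j l
    (onl P' i) (onl P' j) (onl P' l) u).symm

end Intertwine

section Kill

variable (F : P →ₗ[k] P') (i j l : H →ₗ[k] Module.End k P)

/-- If a map applied afterwards sends the action in one slot to the trivial one, that slot may be
replaced by the counit, and the normalization of Φ then deletes the reassociator. Slots two and
three must first be commuted to the front, which is where the `Cm` conditions enter. -/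
theorem kill_ac1 {B : Type*} [Ring B] [Algebra k B] (g : B →ₗ[k] Module.End k P)
    [hF : Intw F i (Q.tr P')] (t : H ⊗[k] B) (u : P) :
    F (ac i g t u) = F (ac (Q.tr P) g t u) := by
  refine ext_tmul (F := F ∘ₗ LinearMap.applyₗ u ∘ₗ ac i g)
    (G := F ∘ₗ LinearMap.applyₗ u ∘ₗ ac (Q.tr P) g) (fun a b => ?_) t
  simp [hF.intw]

theorem kill_ac2 [hF : Intw F j (Q.tr P')] [Cm i j] (t : H ⊗[k] (H ⊗[k] H)) (u : P) :
    F (ac i (ac j l) t u) = F (ac i (ac (Q.tr P) l) t u) := by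
  refine ext_tmul (F := F ∘ₗ LinearMap.applyₗ u ∘ₗ ac i (ac j l))
    (G := F ∘ₗ LinearMap.applyₗ u ∘ₗ ac i (ac (Q.tr P) l)) (fun a s => ?_) t
  refine ext_tmul (F := F ∘ₗ i a ∘ₗ LinearMap.applyₗ u ∘ₗ ac j l)
    (G := F ∘ₗ i a ∘ₗ LinearMap.applyₗ u ∘ₗ ac (Q.tr P) l) (fun b c => ?_) s
  simp [Cm.comm (i := i) (j := j), hF.intw]

theorem kill_ac3 [hF : Intw F l (Q.tr P')] [Cm i l] [Cm j l] (t : H ⊗[k] (H ⊗[k] H)) (u : P) :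
    F (ac i (ac j l) t u) = F (ac i (ac j (Q.tr P)) t u) := by
  refine ext_tmul (F := F ∘ₗ LinearMap.applyₗ u ∘ₗ ac i (ac j l))
    (G := F ∘ₗ LinearMap.applyₗ u ∘ₗ ac i (ac j (Q.tr P))) (fun a s => ?_) t
  refine ext_tmul (F := F ∘ₗ i a ∘ₗ LinearMap.applyₗ u ∘ₗ ac j l)
    (G := F ∘ₗ i a ∘ₗ LinearMap.applyₗ u ∘ₗ ac j (Q.tr P)) (fun b c => ?_) s
  simp [Cm.comm (i := j) (j := l), Cm.comm (i := i) (j := l), hF.intw]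

theorem kill_as1 [Intw F i (Q.tr P')] [Rep j] [Rep l] [Cm j l] (u : P) :
    F (Q.as i j l u) = F u := by
  rw [as, Q.kill_ac1]; exact congrArg F (Q.as_tr_left j l u)

theorem kill_asi1 [Intw F i (Q.tr P')] [Rep j] [Rep l] [Cm j l] (u : P) :
    F (Q.asi i j l u) = F u := by
  rw [asi, Q.kill_ac1]; exact congrArg F (Q.asi_tr_left j l u)

theorem kill_as2 [Intw F j (Q.tr P')] [Cm i j] [Rep i] [Rep l] [Cm i l] (u : P) :
    F (Q.as i j l u) = F u := by
  rw [as, Q.kill_ac2]; exact congrArg F (Q.as_tr_mid i l u)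

theorem kill_asi2 [Intw F j (Q.tr P')] [Cm i j] [Rep i] [Rep l] [Cm i l] (u : P) :
    F (Q.asi i j l u) = F u := by
  rw [asi, Q.kill_ac2]; exact congrArg F (Q.asi_tr_mid i l u)

theorem kill_as3 [Intw F l (Q.tr P')] [Cm i l] [Cm j l] [Rep i] [Rep j] [Cm i j] (u : P) :
    F (Q.as i j l u) = F u := by
  rw [as, Q.kill_ac3]; exact congrArg F (Q.as_tr_right i j u)

theorem kill_asi3 [Intw F l (Q.tr P')] [Cm i l] [Cm j l] [Rep i] [Rep j] [Cm i j] (u : P) :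
    F (Q.asi i j l u) = F u := by
  rw [asi, Q.kill_ac3]; exact congrArg F (Q.asi_tr_right i j u)

end Kill

section Inv

variable (G : P' →ₗ[k] P) (i j l : H →ₗ[k] Module.End k P)

/-- The dual principle: on vectors in the image of `G` a slot acts through the counit, so a
reassociator through that slot does nothing to them. -/
theorem inv_ac1 [hG : Intw G (Q.tr P') i] [Cm i j] [Cm i l] (t : H ⊗[k] (H ⊗[k] H)) (u : P') :
    ac i (ac j l) t (G u) = ac (Q.tr P) (ac j l) t (G u) := by
  refine ext_tmul (F := LinearMap.applyₗ (G u) ∘ₗ ac i (ac j l))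
    (G := LinearMap.applyₗ (G u) ∘ₗ ac (Q.tr P) (ac j l)) (fun a s => ?_) t
  refine ext_tmul (F := i a ∘ₗ LinearMap.applyₗ (G u) ∘ₗ ac j l)
    (G := Q.tr P a ∘ₗ LinearMap.applyₗ (G u) ∘ₗ ac j l) (fun b c => ?_) s
  simp [Cm.comm (i := i) (j := j), Cm.comm (i := i) (j := l), ← hG.intw]

theorem inv_ac2 [hG : Intw G (Q.tr P') j] [Cm j l] (t : H ⊗[k] (H ⊗[k] H)) (u : P') :
    ac i (ac j l) t (G u) = ac i (ac (Q.tr P) l) t (G u) := by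
  refine ext_tmul (F := LinearMap.applyₗ (G u) ∘ₗ ac i (ac j l))
    (G := LinearMap.applyₗ (G u) ∘ₗ ac i (ac (Q.tr P) l)) (fun a s => ?_) t
  refine ext_tmul (F := i a ∘ₗ LinearMap.applyₗ (G u) ∘ₗ ac j l)
    (G := i a ∘ₗ LinearMap.applyₗ (G u) ∘ₗ ac (Q.tr P) l) (fun b c => ?_) s
  simp [Cm.comm (i := j) (j := l), ← hG.intw]

theorem inv_ac3 [hG : Intw G (Q.tr P') l] (t : H ⊗[k] (H ⊗[k] H)) (u : P') :
    ac i (ac j l) t (G u) = ac i (ac j (Q.tr P)) t (G u) := by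
  refine ext_tmul (F := LinearMap.applyₗ (G u) ∘ₗ ac i (ac j l))
    (G := LinearMap.applyₗ (G u) ∘ₗ ac i (ac j (Q.tr P))) (fun a s => ?_) t
  refine ext_tmul (F := i a ∘ₗ LinearMap.applyₗ (G u) ∘ₗ ac j l)
    (G := i a ∘ₗ LinearMap.applyₗ (G u) ∘ₗ ac j (Q.tr P)) (fun b c => ?_) s
  simp [← hG.intw]

theorem inv_as1 [Intw G (Q.tr P') i] [Cm i j] [Cm i l] [Rep j] [Rep l] [Cm j l] (u : P') :
    Q.as i j l (G u) = G u := by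
  rw [as, Q.inv_ac1]; exact Q.as_tr_left j l _

theorem inv_asi1 [Intw G (Q.tr P') i] [Cm i j] [Cm i l] [Rep j] [Rep l] [Cm j l] (u : P') :
    Q.asi i j l (G u) = G u := by
  rw [asi, Q.inv_ac1]; exact Q.asi_tr_left j l _

theorem inv_as2 [Intw G (Q.tr P') j] [Cm j l] [Rep i] [Rep l] [Cm i l] (u : P') :
    Q.as i j l (G u) = G u := by
  rw [as, Q.inv_ac2]; exact Q.as_tr_mid i l _

theorem inv_asi2 [Intw G (Q.tr P') j] [Cm j l] [Rep i] [Rep l] [Cm i l] (u : P') :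
    Q.asi i j l (G u) = G u := by
  rw [asi, Q.inv_ac2]; exact Q.asi_tr_mid i l _

theorem inv_as3 [Intw G (Q.tr P') l] [Rep i] [Rep j] [Cm i j] (u : P') :
    Q.as i j l (G u) = G u := by
  rw [as, Q.inv_ac3]; exact Q.as_tr_right i j _

end Inv

end QuasiHopfAlgebra
-- The right action of H₀ on representations and its multiplication.
namespace QuasiHopfAlgebra

variable {k H P P' P'' : Type*} [Field k] [Ring H] [Algebra k H] (Q : QuasiHopfAlgebra k H)
  [AddCommGroup P] [Module k P] [AddCommGroup P'] [Module k P'] [AddCommGroup P''] [Module k P'']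

theorem S_Sinv (hS : Function.Bijective Q.S) (h : H) : Q.S (Q.Sinv hS h) = h :=
  (LinearEquiv.ofBijective Q.S hS).apply_symm_apply h

theorem Sinv_S (hS : Function.Bijective Q.S) (h : H) : Q.Sinv hS (Q.S h) = h :=
  (LinearEquiv.ofBijective Q.S hS).symm_apply_apply h

theorem Sinv_mul (hS : Function.Bijective Q.S) (a b : H) :
    Q.Sinv hS (a * b) = Q.Sinv hS b * Q.Sinv hS a := by
  apply hS.1
  rw [S_Sinv, Q.S_mul, S_Sinv, S_Sinv]

theorem Sinv_one (hS : Function.Bijective Q.S) : Q.Sinv hS 1 = 1 := by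
  rw [← Q.S_one, Sinv_S, Q.S_one]

/-- Left multiplication on `H`. -/
def lm (k H : Type*) [Field k] [Ring H] [Algebra k H] : H →ₗ[k] Module.End k H := LinearMap.mul k H

/-- Right multiplication on `H` by the antipode. -/
def rs : H →ₗ[k] Module.End k H := (LinearMap.mul k H).flip ∘ₗ Q.S

@[simp]
theorem lm_apply (a b : H) : lm k H a b = a * b := rfl

@[simp]
theorem rs_apply (a b : H) : Q.rs a b = b * Q.S a := rfl

instance : Rep (lm k H) where
  one := by ext; simp
  mul a b u := by simp [mul_assoc]

instance : Rep Q.rs where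
  one := by ext; simp [Q.S_one]
  mul a b u := by simp [mul_assoc, Q.S_mul]

instance : Cm (lm k H) Q.rs where
  comm a b u := by simp [mul_assoc]

instance : Cm Q.rs (lm k H) where
  comm a b u := by simp [mul_assoc]

/-- Left multiplication on the last tensor factor `H`. -/
abbrev la (P : Type*) [AddCommGroup P] [Module k P] : H →ₗ[k] Module.End k (P ⊗[k] H) :=
  onr P (lm k H)

/-- Right multiplication by the antipode on the last tensor factor `H`. -/
abbrev ra (P : Type*) [AddCommGroup P] [Module k P] : H →ₗ[k] Module.End k (P ⊗[k] H) :=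
  onr P Q.rs

/-- The adjoint action on the last tensor factor `H`. -/
abbrev es (P : Type*) [AddCommGroup P] [Module k P] : H →ₗ[k] Module.End k (P ⊗[k] H) :=
  Q.cv (la P) (Q.ra P)

/-- Insertion of `β` as a last tensor factor. -/
def ins (P : Type*) [AddCommGroup P] [Module k P] : P →ₗ[k] P ⊗[k] H :=
  (TensorProduct.mk k P H).flip Q.β

@[simp]
theorem ins_apply (p : P) : Q.ins P p = p ⊗ₜ Q.β := rfl

/-- This is h₁βS(h₂) = ε(h)β: β is an invariant of the adjoint action. -/
instance : Intw (Q.ins P) (Q.tr P) (Q.es P) where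
  intw a u := by
    rw [cv_apply_sw]
    have := congrArg (TensorProduct.mk k P H u) (Q.antipode_right a)
    rw [map_sw] at this
    simpa [← mul_assoc] using this.symm

instance (j : H →ₗ[k] Module.End k P) : Intw (Q.ins P) j (onl H j) where
  intw a u := by simp

theorem onl_tr : onl P' (Q.tr P) = Q.tr (P ⊗[k] P') := by
  ext; simp [TensorProduct.smul_tmul']

instance intw_ins_rTensor :
    Intw ((Q.ins P).rTensor P') (Q.tr (P ⊗[k] P')) (Q.cv (onl P' (la P)) (onl P' (Q.ra P))) := by
  rw [← onl_cv, ← onl_tr]; infer_instance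

theorem intw_of_cm (j : H →ₗ[k] Module.End k P) (i : H →ₗ[k] Module.End k P) [Cm j i] (g : H) :
    Intw (j g) i i where
  intw _ _ := Cm.comm _ _ _

instance (F : P →ₗ[k] P') (i j l : H →ₗ[k] Module.End k P) (m : H →ₗ[k] Module.End k P')
    [Intw F (Q.cv i (Q.cv j l)) m] :
    Intw (F.rTensor P'') (Q.cv (onl P'' i) (Q.cv (onl P'' j) (onl P'' l))) (onl P'' m) := by
  rw [← onl_cv, ← onl_cv]; infer_instance

instance (F : P →ₗ[k] P') (i j l : H →ₗ[k] Module.End k P) (i' j' l' : H →ₗ[k] Module.End k P')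
    [Intw F (Q.cv i (Q.cv j l)) (Q.cv (Q.cv j' l') i')] :
    Intw (F.rTensor P'') (Q.cv (onl P'' i) (Q.cv (onl P'' j) (onl P'' l)))
      (Q.cv (Q.cv (onl P'' j') (onl P'' l')) (onl P'' i')) := by
  rw [← onl_cv, ← onl_cv, ← onl_cv, ← onl_cv]; infer_instance

variable (hS : Function.Bijective Q.S)

/-- Evaluation `p ⊗ h ↦ i(S⁻¹(αh)) p`. -/
def kap (i : H →ₗ[k] Module.End k P) : P ⊗[k] H →ₗ[k] P :=
  TensorProduct.lift (i ∘ₗ Q.Sinv hS ∘ₗ LinearMap.mulLeft k Q.α).flip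

@[simp]
theorem kap_tmul (i : H →ₗ[k] Module.End k P) (p : P) (h : H) :
    Q.kap hS i (p ⊗ₜ h) = i (Q.Sinv hS (Q.α * h)) p := rfl

/-- This is S(h₁)αh₂ = ε(h)α, seen through S⁻¹. The remaining action, right multiplication by S,
passes through the evaluation to `i` in the next instance. -/
instance (i : H →ₗ[k] Module.End k P) [Rep i] :
    Intw (Q.kap hS i) (Q.cv (onl H i) (la P)) (Q.tr P) where
  intw g u := by
    refine ext_tmul (F := Q.kap hS i ∘ₗ Q.cv (onl H i) (la P) g) (G := Q.tr P g ∘ₗ Q.kap hS i)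
      (fun p h => ?_) u
    rw [LinearMap.comp_apply, cv_apply_sw, map_sw]
    have := congrArg (fun t => i (Q.Sinv hS (t * h)) p) (Q.antipode_left g)
    simp only [← LinearMap.mulRight_apply (R := k)] at this
    have e : ∀ t, i (Q.Sinv hS (LinearMap.mulRight k h t)) p =
      (LinearMap.applyₗ p ∘ₗ i ∘ₗ Q.Sinv hS ∘ₗ LinearMap.mulRight k h) t := fun _ => rfl
    rw [e, map_sw] at this
    simp only [LinearMap.comp_apply, LinearMap.mulRight_apply, LinearMap.applyₗ_apply_apply] at this
    simp only [onr_tmul, onl_tmul, kap_tmul, lm_apply, LinearMap.comp_apply, tr_apply, ← Rep.mul]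
    convert this using 1
    · congr 1; funext a b
      rw [mul_assoc (Q.S a), mul_assoc (Q.S a), Q.Sinv_mul hS (Q.S a), Sinv_S, mul_assoc]
    · simp

instance (i : H →ₗ[k] Module.End k P) [Rep i] : Intw (Q.kap hS i) (Q.ra P) i where
  intw g u := by
    refine ext_tmul (F := Q.kap hS i ∘ₗ Q.ra P g) (G := i g ∘ₗ Q.kap hS i)
      (fun p h => ?_) u
    simp [← mul_assoc, Q.Sinv_mul hS _ (Q.S g), Sinv_S, Rep.mul]

theorem kap_natural (F : P →ₗ[k] P') (i : H →ₗ[k] Module.End k P) (i' : H →ₗ[k] Module.End k P')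
    [hF : Intw F i i'] (u : P ⊗[k] H) : F (Q.kap hS i u) = Q.kap hS i' (F.rTensor H u) := by
  refine ext_tmul (F := F ∘ₗ Q.kap hS i) (G := Q.kap hS i' ∘ₗ F.rTensor H) (fun p h => ?_) u
  simp [hF.intw]

instance (i j : H →ₗ[k] Module.End k P) [Cm j i] : Intw (Q.kap hS i) (onl H j) j where
  intw g u := (have := intw_of_cm j i g; Q.kap_natural hS (j g) i i u).symm

/-- The right action of `H₀` on a representation: `p ⊗ h ↦ x³ S⁻¹(α x² h) x¹ p`. -/
def R (i : H →ₗ[k] Module.End k P) : P ⊗[k] H →ₗ[k] P :=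
  Q.kap hS i ∘ₗ Q.asi (onl H i) (la P) (Q.ra P)

theorem R_apply (i : H →ₗ[k] Module.End k P) (u : P ⊗[k] H) :
    Q.R hS i u = Q.kap hS i (Q.asi (onl H i) (la P) (Q.ra P) u) := rfl

theorem R_natural (F : P →ₗ[k] P') (i : H →ₗ[k] Module.End k P) (i' : H →ₗ[k] Module.End k P')
    [hF : Intw F i i'] (u : P ⊗[k] H) : F (Q.R hS i u) = Q.R hS i' (F.rTensor H u) := by
  rw [R_apply, Q.kap_natural hS F i i', Q.intw_asi (F.rTensor H) _ _ _ (onl H i') (la P') (Q.ra P')]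
  rfl

/-- Linearity of the action: Φ⁻¹ regroups the slots so that `i` and left multiplication meet, `kap`
trivializes this pair, and right multiplication by S becomes `i`. -/
instance (i : H →ₗ[k] Module.End k P) [Rep i] :
    Intw (Q.R hS i) (Q.cv (onl H i) (Q.es P)) i where
  intw g u := by
    rw [R_apply, asi_cv, Intw.intw (F := Q.kap hS i) (i' := Q.cv (Q.tr P) i), tr_cv]; rfl

instance (i j : H →ₗ[k] Module.End k P) [Rep i] [Rep j] [Cm i j] :
    Intw (Q.R hS (Q.cv i j)) (Q.cv (Q.cv (onl H i) (onl H j)) (Q.es P)) (Q.cv i j) := by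
  rw [← onl_cv]; infer_instance

instance (i j : H →ₗ[k] Module.End k P) [Cm j i] : Intw (Q.R hS i) (onl H j) j where
  intw g u := (have := intw_of_cm j i g; Q.R_natural hS (j g) i i u).symm

/-- Unitality of the action is the zigzag S(x¹)αx²βS(x³) = 1. -/
theorem R_ins (i : H →ₗ[k] Module.End k P) [Rep i] (p : P) : Q.R hS i (Q.ins P p) = p := by
  rw [R_apply, asi_apply_sw, map_sw3]
  have := congrArg (fun t => (LinearMap.applyₗ p ∘ₗ i ∘ₗ Q.Sinv hS) t) Q.antipode_Φinv
  simp only [map_sw3] at this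
  simp only [LinearMap.comp_apply, LinearMap.applyₗ_apply_apply, Sinv_one, Rep.one_apply] at this
  convert this using 2
  funext a b c
  simp only [ins_apply, onr_tmul, onl_tmul, kap_tmul, lm_apply, rs_apply, ← Rep.mul]
  rw [mul_assoc (Q.S a * _ * _), mul_assoc (Q.S a * _), mul_assoc (Q.S a), Q.Sinv_mul hS (Q.S a),
    Sinv_S]

/-- The multiplication of `H₀` on the last two tensor factors. -/
def mu (P : Type*) [AddCommGroup P] [Module k P] : (P ⊗[k] H) ⊗[k] H →ₗ[k] P ⊗[k] H :=
  Q.R hS (Q.ra P) ∘ₗ Q.as (onl H (la P)) (onl H (Q.ra P)) (Q.es (P ⊗[k] H))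

theorem mu_apply (u : (P ⊗[k] H) ⊗[k] H) : Q.mu hS P u =
    Q.R hS (Q.ra P) (Q.as (onl H (la P)) (onl H (Q.ra P)) (Q.es (P ⊗[k] H)) u) := rfl

theorem mu_ins_left (t : P ⊗[k] H) : Q.mu hS P ((Q.ins P).rTensor H t) = t := by
  -- One reassociator disappears because β is invariant, another because `kap` evaluates; what
  -- remains is the other zigzag X¹βS(X²)αX³ = 1.
  rw [mu_apply, R_apply, pentagon_asi_as', Q.inv_asi1, Q.kill_as2]
  refine ext_tmul (F := Q.kap hS (Q.ra P) ∘ₗ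
    Q.as (onl H (la P)) (onl H (Q.ra P)) (la (P ⊗[k] H)) ∘ₗ (Q.ins P).rTensor H)
    (G := LinearMap.id) (fun p h => ?_) t
  have := congrArg (fun t => (TensorProduct.mk k P H p ∘ₗ LinearMap.mulRight k h) t) Q.antipode_Φ
  simp only [map_sw3] at this
  simp only [LinearMap.comp_apply, as_apply_sw, map_sw3]
  simp only [LinearMap.comp_apply, LinearMap.mulRight_apply, TensorProduct.mk_apply, one_mul] at this
  refine Eq.trans ?_ this
  congr 1; funext a b c
  simp [← mul_assoc, S_Sinv]

theorem mu_ins_right (t : P ⊗[k] H) : Q.mu hS P (Q.ins _ t) = t := by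
  rw [mu_apply, Q.inv_as3, R_ins]

theorem mu_natural (F : P →ₗ[k] P') (u : (P ⊗[k] H) ⊗[k] H) :
    F.rTensor H (Q.mu hS P u) = Q.mu hS P' ((F.rTensor H).rTensor H u) := by
  rw [mu_apply, Q.R_natural hS (F.rTensor H) (Q.ra P) (Q.ra P'),
    Q.intw_as ((F.rTensor H).rTensor H) _ _ _ (onl H (la P')) (onl H (Q.ra P')) (Q.es (P' ⊗[k] H))]
  rfl

/-- The adjoint action on the first of the last two tensor factors. -/
abbrev es' (P : Type*) [AddCommGroup P] [Module k P] :
    H →ₗ[k] Module.End k ((P ⊗[k] H) ⊗[k] H) :=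
  Q.cv (onl H (la P)) (onl H (Q.ra P))

instance : Intw (Q.mu hS P) (Q.cv (Q.es' P) (Q.es (P ⊗[k] H))) (Q.es P) where
  intw g u := by
    rw [mu_apply, as_cv, Intw.intw (F := Q.R hS (Q.ra P)) (i' := Q.es P)]; rfl

instance (j : H →ₗ[k] Module.End k P) : Intw (Q.mu hS P) (onl H (onl H j)) (onl H j) where
  intw g u := by
    rw [mu_apply, Intw.intw (F := Q.as _ _ _) (i' := onl H (onl H j)),
      Intw.intw (F := Q.R hS (Q.ra P)) (i' := onl H j)]; rfl

/-- The module axiom: acting by a product is acting twice. The product is itself an action on the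
slot `ra`, so naturality brings `kap` inside it; after one pentagon the slot x ⊗ `la` is trivial and
only two nested actions remain. -/
theorem R_mu (x : H →ₗ[k] Module.End k P) [Rep x] (u : (P ⊗[k] H) ⊗[k] H) :
    Q.R hS x (Q.mu hS P u) = Q.R hS x ((Q.R hS x).rTensor H
      (Q.asi (onl H (onl H x)) (Q.es' P) (Q.es (P ⊗[k] H)) u)) := by
  rw [mu_apply, R_apply, ← Q.intw_asi (Q.R hS (Q.ra P)) (onl H (onl H x)) (onl H (la P))
    (Q.cv (onl H (Q.ra P)) (Q.es (P ⊗[k] H))), pentagon_asi_as]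
  have := intw_comp (Q.R hS (Q.ra P)) (Q.kap hS x) (Q.cv (onl H (onl H x)) (onl H (la P)))
    (Q.cv (onl H x) (la P)) (Q.tr P)
  rw [← LinearMap.comp_apply (Q.kap hS x), Q.kill_as1, LinearMap.comp_apply,
    Q.R_natural hS (Q.kap hS x) (Q.ra P) x, onl_asi, ← LinearMap.comp_apply (LinearMap.rTensor _ _),
    ← LinearMap.rTensor_comp]
  rfl

/-- The outer product is an action on the slot `ra`, so `R_mu` for that slot turns both sides into
two successive actions, and they differ by one pentagon. -/
theorem mu_assoc (u : ((P ⊗[k] H) ⊗[k] H) ⊗[k] H) :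
    Q.mu hS P ((Q.mu hS P).rTensor H u) = Q.mu hS P (Q.mu hS (P ⊗[k] H)
      (Q.as (onl H (Q.es' P)) (Q.es' (P ⊗[k] H)) (Q.es _) u)) := by
  rw [mu_apply, mu_apply _ _ (Q.mu hS (P ⊗[k] H) _),
    ← Q.intw_as (Q.mu hS (P ⊗[k] H)) (onl H (onl H (la P))) (onl H (onl H (Q.ra P)))
      (Q.cv (Q.es' _) (Q.es _)), R_mu]
  have e : (Q.mu hS P).rTensor H u = (Q.R hS (Q.ra P)).rTensor H
      (Q.as (onl H (onl H (la P))) (onl H (onl H (Q.ra P))) (Q.es' (P ⊗[k] H)) u) := by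
    rw [es', ← onl_cv, onl_as, ← LinearMap.comp_apply (LinearMap.rTensor _ _),
      ← LinearMap.rTensor_comp]; rfl
  rw [e, ← Q.intw_as ((Q.R hS (Q.ra P)).rTensor H) (onl H (onl H (la P)))
    (Q.cv (onl H (onl H (Q.ra P))) (Q.es' (P ⊗[k] H))) (Q.es _), es', onl_cv, ← pentagon, asi_as]

end QuasiHopfAlgebra
-- The braiding of a representation past H₀ and its characterization by the right action.
namespace QuasiHopfAlgebra

variable {k H P P' P'' : Type*} [Field k] [Ring H] [Algebra k H] (Q : QuasiHopfAlgebra k H)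
  [AddCommGroup P] [Module k P] [AddCommGroup P'] [Module k P'] [AddCommGroup P''] [Module k P'']
  (hS : Function.Bijective Q.S)

/-- The braiding of `H₀` with a representation `v`: `p ⊗ h ↦ v(h₍₁₎) p ⊗ h₍₀₎`. -/
def cc (v : H →ₗ[k] Module.End k P) : P ⊗[k] H →ₗ[k] P ⊗[k] H :=
  Q.asi (la P) (Q.ra P) (onl H v) ∘ₗ Q.R hS (Q.cv (Q.ra P) (onl H v)) ∘ₗ
    Q.asi (onl H (Q.ra P)) (onl H (onl H v)) (Q.es (P ⊗[k] H)) ∘ₗ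
    Q.as (onl H (la P)) (onl H (Q.ra P)) (Q.cv (onl H (onl H v)) (Q.es (P ⊗[k] H))) ∘ₗ
    (Q.ins P).rTensor H

theorem cc_apply' (v : H →ₗ[k] Module.End k P) (u : P ⊗[k] H) : Q.cc hS v u =
    Q.asi (la P) (Q.ra P) (onl H v) (Q.R hS (Q.cv (Q.ra P) (onl H v))
      (Q.asi (onl H (Q.ra P)) (onl H (onl H v)) (Q.es (P ⊗[k] H))
    (Q.as (onl H (la P)) (onl H (Q.ra P)) (Q.cv (onl H (onl H v)) (Q.es (P ⊗[k] H)))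
    ((Q.ins P).rTensor H u)))) := rfl

/-- A second form of the braiding: of the three reassociators given by the pentagon, the one through
the adjoint slot of the inserted β is the identity. -/
theorem cc_apply (v : H →ₗ[k] Module.End k P) [Rep v] (u : P ⊗[k] H) : Q.cc hS v u =
    Q.asi (la P) (Q.ra P) (onl H v) (Q.R hS (Q.cv (Q.ra P) (onl H v))
      (Q.as (onl H (la P)) (Q.cv (onl H (Q.ra P)) (onl H (onl H v))) (Q.es (P ⊗[k] H))
      (Q.as (onl H (la P)) (onl H (Q.ra P)) (onl H (onl H v)) ((Q.ins P).rTensor H u)))) := by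
  rw [cc_apply', pentagon_asi_as', Q.inv_asi1 ((Q.ins P).rTensor H)]

theorem cc_natural (F : P →ₗ[k] P') (v : H →ₗ[k] Module.End k P) (v' : H →ₗ[k] Module.End k P')
    [hF : Intw F v v'] (u : P ⊗[k] H) :
    F.rTensor H (Q.cc hS v u) = Q.cc hS v' (F.rTensor H u) := by
  rw [cc_apply', cc_apply', Q.intw_asi (F.rTensor H) _ _ _ (la P') (Q.ra P') (onl H v'),
    Q.R_natural hS (F.rTensor H) _ (Q.cv (Q.ra P') (onl H v')),
    Q.intw_asi ((F.rTensor H).rTensor H) _ _ _ (onl H (Q.ra P')) (onl H (onl H v')) (Q.es _),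
    Q.intw_as ((F.rTensor H).rTensor H) _ _ _ (onl H (la P')) (onl H (Q.ra P'))
      (Q.cv (onl H (onl H v')) (Q.es _))]
  congr 4
  exact ext_tmul (F := (F.rTensor H).rTensor H ∘ₗ (Q.ins P).rTensor H)
    (G := (Q.ins P').rTensor H ∘ₗ F.rTensor H) (fun p h => by simp) u

instance (v : H →ₗ[k] Module.End k P) [Rep v] :
    Intw (Q.cc hS v) (Q.cv (onl H v) (Q.es P)) (Q.cv (Q.es P) (onl H v)) where
  intw g u := by
    have h1 : (Q.ins P).rTensor H (Q.cv (onl H v) (Q.es P) g u) =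
        Q.cv (Q.es' P) (Q.cv (onl H (onl H v)) (Q.es (P ⊗[k] H))) g ((Q.ins P).rTensor H u) := by
      -- A trivial slot is created on purpose: invariance of β turns it into the adjoint action on
      -- the inserted factor.
      conv_lhs => rw [← Q.tr_cv (Q.cv (onl H v) (Q.es P))]
      exact Intw.intw _ _
    rw [cc_apply', h1, as_cv, Intw.intw (F := Q.asi _ _ _) (i' := Q.cv (onl H (la P))
      (Q.cv (Q.cv (onl H (Q.ra P)) (onl H (onl H v))) (Q.es _))),
      Intw.intw (F := Q.R hS _) (i' := Q.cv (la P) (Q.cv (Q.ra P) (onl H v))), asi_cv]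
    rfl

instance (v j : H →ₗ[k] Module.End k P) [Cm j v] : Intw (Q.cc hS v) (onl H j) (onl H j) where
  intw g u := (have := intw_of_cm j v g; Q.cc_natural hS (j g) v v u).symm

/-- For trivial `v` the definition reduces to left multiplication by the unit β of H₀. -/
theorem cc_tr (u : P ⊗[k] H) : Q.cc hS (Q.tr P) u = u := by
  simp only [cc_apply, onl_tr, cv_tr, as_tr_right]
  rw [← mu_apply, mu_ins_left, asi_tr_right]

theorem cc_ins (v : H →ₗ[k] Module.End k P) [Rep v] (p : P) :
    Q.cc hS v (Q.ins P p) = Q.ins P p := by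
  have e : (Q.ins P).rTensor H (Q.ins P p) = Q.ins _ (Q.ins P p) := by simp
  rw [cc_apply, e, ← Q.intw_as (Q.ins (P ⊗[k] H)) (la P) (Q.ra P) (onl H v), Q.inv_as3, R_ins,
    asi_as]

/-- The defining property of the braiding in terms of the right action of `H₀`. -/
theorem R_cc (x v : H →ₗ[k] Module.End k P) [Rep x] [Rep v] [Cm x v] [Cm v x] (u : P ⊗[k] H) :
    Q.R hS x (Q.asi (onl H x) (Q.es P) (onl H v) (Q.cc hS v u)) =
      Q.R hS (Q.cv x v) (Q.asi (onl H x) (onl H v) (Q.es P) u) := by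
  -- The final evaluation trivializes the slot x ⊗ `la` even when it is preceded by `R`; every
  -- reassociator whose first slot is this one can be deleted.
  have hK := intw_comp (Q.R hS (Q.cv (Q.ra P) (onl H v))) (Q.kap hS x)
    (Q.cv (onl H (onl H x)) (onl H (la P))) (Q.cv (onl H x) (la P)) (Q.tr P)
  have h1 : (Q.ins P).rTensor H (Q.asi (onl H x) (onl H v) (Q.es P) u) =
      Q.asi (onl H (onl H x)) (Q.cv (Q.es' P) (onl H (onl H v))) (Q.es (P ⊗[k] H))
        ((Q.ins P).rTensor H u) := by
    conv_lhs => rw [← Q.tr_cv (onl H v)]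
    exact Q.intw_asi _ _ _ _ _ _ _ _
  rw [R_apply, cc_apply, pentagon_inv, Q.kill_asi1,
    ← Q.intw_asi (Q.R hS (Q.cv (Q.ra P) (onl H v))) (onl H (onl H x)) (onl H (la P))
      (Q.cv (Q.cv (onl H (Q.ra P)) (onl H (onl H v))) (Q.es _)), pentagon_asi_as,
    ← LinearMap.comp_apply (Q.kap hS x), Q.kill_as1,
    ← Q.intw_asi (Q.as (onl H (la P)) (onl H (Q.ra P)) (onl H (onl H v))) (onl H (onl H x))
      (Q.cv (Q.es' P) (onl H (onl H v))) (Q.es _), ← h1, pentagon_asi_as, Q.kill_as1,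
    Q.inv_asi2 ((Q.ins P).rTensor H), LinearMap.comp_apply,
    Q.R_natural hS (Q.kap hS x) _ (Q.cv x v), onl_asi, ← LinearMap.comp_apply (LinearMap.rTensor _ _),
    ← LinearMap.rTensor_comp, ← LinearMap.comp_apply (LinearMap.rTensor _ _),
    ← LinearMap.rTensor_comp]
  -- The auxiliary β now acts on `x`, which is the identity; the extra tensor factor is gone.
  have e : (Q.kap hS x ∘ₗ Q.asi (onl H x) (la P) (Q.ra P)) ∘ₗ Q.ins P = LinearMap.id := by
    ext p; exact Q.R_ins hS x p
  rw [e, LinearMap.rTensor_id]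
  rfl

theorem R_cc_cv (x v w : H →ₗ[k] Module.End k P) [Rep x] [Rep v] [Rep w] [Cm x v] [Cm v x]
    [Cm x w] [Cm w x] [Cm v w] [Cm w v] (u : P ⊗[k] H) :
    Q.R hS x (Q.asi (onl H x) (Q.es P) (Q.cv (onl H v) (onl H w)) (Q.cc hS (Q.cv v w) u)) =
      Q.R hS (Q.cv x (Q.cv v w)) (Q.asi (onl H x) (Q.cv (onl H v) (onl H w)) (Q.es P) u) := by
  rw [← onl_cv, R_cc]

/-- The right action of `H₀` recovers an element of `P ⊗ H₀`. -/
theorem R_recover (v : H →ₗ[k] Module.End k P) [Rep v] (u : P ⊗[k] H) :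
    Q.R hS (Q.ra P) (Q.asi (onl H (Q.ra P)) (Q.es (P ⊗[k] H)) (onl H (onl H v))
      (Q.as (onl H (la P)) (onl H (Q.ra P)) (Q.cv (Q.es (P ⊗[k] H)) (onl H (onl H v)))
        ((Q.ins P).rTensor H u))) = Q.as (la P) (Q.ra P) (onl H v) u := by
  rw [pentagon_asi_as', Q.inv_asi1 ((Q.ins P).rTensor H),
    Q.intw_as (Q.R hS (Q.ra P)) _ _ _ (la P) (Q.ra P) (onl H v), ← mu_apply, mu_ins_left]

/-- Separation principle: an identity in H₀ may be tested after letting both sides act on a freshly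
inserted β. Statements about `cc` are thereby reduced to `R_cc`. -/
theorem eq_of_R_eq (v : H →ₗ[k] Module.End k P) [Rep v] (u u' : P ⊗[k] H)
    (h : Q.R hS (Q.ra P) (Q.asi (onl H (Q.ra P)) (Q.es (P ⊗[k] H)) (onl H (onl H v))
      (Q.as (onl H (la P)) (onl H (Q.ra P)) (Q.cv (Q.es (P ⊗[k] H)) (onl H (onl H v)))
        ((Q.ins P).rTensor H u))) =
      Q.R hS (Q.ra P) (Q.asi (onl H (Q.ra P)) (Q.es (P ⊗[k] H)) (onl H (onl H v))
      (Q.as (onl H (la P)) (onl H (Q.ra P)) (Q.cv (Q.es (P ⊗[k] H)) (onl H (onl H v)))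
        ((Q.ins P).rTensor H u')))) : u = u' := by
  rw [R_recover, R_recover] at h
  rw [← Q.asi_as (la P) (Q.ra P) (onl H v) u, h, asi_as]

/-- The hexagon after acting on `x`: by `R_cc` both sides are the action on x ⊗ v ⊗ w, bracketed in
two ways, and pentagons compare the bracketings. -/
theorem R_cc_cc (x v w : H →ₗ[k] Module.End k P) [Rep x] [Rep v] [Rep w] [Cm x v] [Cm v x]
    [Cm x w] [Cm w x] [Cm v w] [Cm w v] (u : P ⊗[k] H) :
    Q.R hS x (Q.asi (onl H x) (Q.es P) (Q.cv (onl H v) (onl H w))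
      (Q.as (Q.es P) (onl H v) (onl H w) (Q.cc hS v (Q.asi (onl H v) (Q.es P) (onl H w)
        (Q.cc hS w u))))) =
      Q.R hS x (Q.asi (onl H x) (Q.es P) (Q.cv (onl H v) (onl H w))
        (Q.cc hS (Q.cv v w) (Q.asi (onl H v) (onl H w) (Q.es P) u))) := by
  rw [R_cc_cv, pentagon_asi_as,
    Q.intw_as (Q.R hS x) _ _ _ x v w,
    ← Q.intw_asi (Q.cc hS v) (onl H x) (Q.cv (onl H v) (Q.es P)) (onl H w), R_cc, pentagon_inv,
    ← Q.intw_asi (Q.cc hS w) (onl H x) (onl H v) (Q.cv (onl H w) (Q.es P)), ← onl_cv, R_cc,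
    onl_cv, ← pentagon_inv, Q.R_natural hS (Q.as x v w) _ (Q.cv x (Q.cv v w)), ← onl_as, as_asi]

/-- Compatibility of the braiding with tensor products of representations. -/
theorem cc_cc (v w : H →ₗ[k] Module.End k P) [Rep v] [Rep w] [Cm v w] [Cm w v] (u : P ⊗[k] H) :
    Q.cc hS v (Q.asi (onl H v) (Q.es P) (onl H w) (Q.cc hS w u)) =
      Q.asi (Q.es P) (onl H v) (onl H w)
        (Q.cc hS (Q.cv v w) (Q.asi (onl H v) (onl H w) (Q.es P) u)) := by
  have key : Q.as (Q.es P) (onl H v) (onl H w)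
      (Q.cc hS v (Q.asi (onl H v) (Q.es P) (onl H w) (Q.cc hS w u))) =
      Q.cc hS (Q.cv v w) (Q.asi (onl H v) (onl H w) (Q.es P) u) := by
    apply Q.eq_of_R_eq hS (Q.cv v w)
    simp only [onl_cv]
    have l1 := Q.R_cc_cc hS (Q.ra P) (onl H v) (onl H w)
      (Q.as (onl H (la P)) (onl H (Q.ra P)) (Q.cv (onl H (onl H v)) (Q.cv (onl H (onl H w)) (Q.es _)))
        ((Q.ins P).rTensor H u))
    -- To reach the form of `l1`, the inserted β and then the reassociator through `la` and `ra` are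
    -- moved inwards past all the braidings.
    rw [Q.intw_as ((Q.ins P).rTensor H) _ _ _ (Q.es _) (onl H (onl H v)) (onl H (onl H w)),
      Q.cc_natural hS (Q.ins P) v (onl H v),
      Q.intw_asi ((Q.ins P).rTensor H) _ _ _ (onl H (onl H v)) (Q.es _) (onl H (onl H w)),
      Q.cc_natural hS (Q.ins P) w (onl H w),
      Q.cc_natural hS (Q.ins P) (Q.cv v w) (Q.cv (onl H v) (onl H w)),
      Q.intw_asi ((Q.ins P).rTensor H) _ _ _ (onl H (onl H v)) (onl H (onl H w)) (Q.es _)]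
    rw [← Q.intw_as (Q.as (Q.es (P ⊗[k] H)) (onl H (onl H v)) (onl H (onl H w))) (onl H (la P))
        (onl H (Q.ra P)) (Q.cv (Q.cv (Q.es (P ⊗[k] H)) (onl H (onl H v))) (onl H (onl H w))),
      ← Q.intw_as (Q.cc hS (onl H v)) (onl H (la P)) (onl H (Q.ra P))
        (Q.cv (Q.cv (onl H (onl H v)) (Q.es (P ⊗[k] H))) (onl H (onl H w))),
      ← Q.intw_as (Q.asi (onl H (onl H v)) (Q.es (P ⊗[k] H)) (onl H (onl H w))) (onl H (la P))
        (onl H (Q.ra P)) (Q.cv (onl H (onl H v)) (Q.cv (Q.es (P ⊗[k] H)) (onl H (onl H w)))),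
      ← Q.intw_as (Q.cc hS (onl H w)) (onl H (la P)) (onl H (Q.ra P))
        (Q.cv (onl H (onl H v)) (Q.cv (onl H (onl H w)) (Q.es (P ⊗[k] H)))), l1]
    have i1 : Intw (Q.cc hS (Q.cv (onl H v) (onl H w)))
        (Q.cv (Q.cv (onl H (onl H v)) (onl H (onl H w))) (Q.es (P ⊗[k] H)))
        (Q.cv (Q.es (P ⊗[k] H)) (Q.cv (onl H (onl H v)) (onl H (onl H w)))) := by
      rw [← onl_cv, ← onl_cv, ← onl_cv]; infer_instance
    rw [← Q.intw_as (Q.cc hS (Q.cv (onl H v) (onl H w))) (onl H (la P)) (onl H (Q.ra P))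
        (Q.cv (Q.cv (onl H (onl H v)) (onl H (onl H w))) (Q.es (P ⊗[k] H))),
      ← Q.intw_as (Q.asi (onl H (onl H v)) (onl H (onl H w)) (Q.es (P ⊗[k] H))) (onl H (la P))
        (onl H (Q.ra P)) (Q.cv (onl H (onl H v)) (Q.cv (onl H (onl H w)) (Q.es (P ⊗[k] H))))]
  rw [← key, asi_as]

end QuasiHopfAlgebra
-- The braiding and the multiplication of H₀.
namespace QuasiHopfAlgebra

variable {k H P P' P'' : Type*} [Field k] [Ring H] [Algebra k H] (Q : QuasiHopfAlgebra k H)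
  [AddCommGroup P] [Module k P] [AddCommGroup P'] [Module k P'] [AddCommGroup P''] [Module k P'']
  (hS : Function.Bijective Q.S)

theorem rTensor_congr_apply {F G : P →ₗ[k] P'} (h : ∀ u, F u = G u) (t : P ⊗[k] P'') :
    F.rTensor P'' t = G.rTensor P'' t := by
  rw [LinearMap.ext h]

/-- By `R_mu` the product acts through two successive actions; each passage of a factor past `v` is
absorbed by `R_cc`. Both sides become the double action on x ⊗ v. -/
theorem R_cc_mu (x v : H →ₗ[k] Module.End k P) [Rep x] [Rep v] [Cm x v] [Cm v x]
    (u : (P ⊗[k] H) ⊗[k] H) :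
    Q.R hS x (Q.asi (onl H x) (Q.es P) (onl H v) (Q.cc hS v (Q.mu hS P u))) =
      Q.R hS x (Q.asi (onl H x) (Q.es P) (onl H v) (Q.mu hS P
        (Q.asi (Q.es' P) (Q.es _) (onl H (onl H v)) (Q.cc hS (onl H v)
          (Q.as (Q.es' P) (onl H (onl H v)) (Q.es _) ((Q.cc hS v).rTensor H
            (Q.asi (onl H (onl H v)) (Q.es' P) (Q.es _) u))))))) := by
  have c1 : ∀ w : (P ⊗[k] H) ⊗[k] H, (Q.R hS x).rTensor H (Q.asi (onl H (onl H x)) (Q.es' P)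
      (onl H (onl H v)) ((Q.cc hS v).rTensor H w)) = (Q.R hS (Q.cv x v)).rTensor H
      (Q.asi (onl H (onl H x)) (onl H (onl H v)) (Q.es' P) w) := by
    intro w
    rw [es', ← onl_cv, onl_asi, onl_asi]
    simp only [← LinearMap.comp_apply, ← LinearMap.rTensor_comp]
    exact rTensor_congr_apply (fun u => Q.R_cc hS x v u) w
  rw [R_cc, ← Q.intw_asi (Q.mu hS P) (onl H (onl H x)) (onl H (onl H v))
    (Q.cv (Q.es' P) (Q.es _)), R_mu]
  simp only [onl_cv]
  rw [← Q.intw_asi (Q.mu hS P) (onl H (onl H x)) (Q.cv (Q.es' P) (Q.es _)) (onl H (onl H v)),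
    R_mu, pentagon_inv,
    Q.intw_asi ((Q.R hS x).rTensor H) (Q.cv (onl H (onl H x)) (Q.es' P)) _ _
      (onl H x) (Q.es P) (onl H v),
    ← Q.intw_asi (Q.cc hS (onl H v)) (onl H (onl H x)) (Q.es' P)
      (Q.cv (onl H (onl H v)) (Q.es _)),
    Q.cc_natural hS (Q.R hS x) (onl H v) v, R_cc,
    ← Q.intw_asi ((Q.R hS x).rTensor H) (Q.cv (onl H (onl H x)) (Q.es' P))
      (onl H (onl H v)) (Q.es _),
    ← Q.pentagon_inv (onl H (onl H x)) (Q.es' P) (onl H (onl H v)) (Q.es _), asi_as,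
    ← Q.intw_asi ((Q.cc hS v).rTensor H) (onl H (onl H x)) (Q.cv (onl H (onl H v)) (Q.es' P))
      (Q.es _), c1, pentagon_inv]

/-- Compatibility of the braiding with the multiplication of `H₀`. -/
theorem cc_mu (v : H →ₗ[k] Module.End k P) [Rep v] (u : (P ⊗[k] H) ⊗[k] H) :
    Q.cc hS v (Q.mu hS P u) = Q.mu hS P
        (Q.asi (Q.es' P) (Q.es _) (onl H (onl H v)) (Q.cc hS (onl H v)
          (Q.as (Q.es' P) (onl H (onl H v)) (Q.es _) ((Q.cc hS v).rTensor H
            (Q.asi (onl H (onl H v)) (Q.es' P) (Q.es _) u))))) := by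
  -- As for the hexagon: test on an inserted β, with `ra` in the role of `x`, and use naturality to
  -- reach `R_cc_mu`.
  apply Q.eq_of_R_eq hS v
  have key := Q.R_cc_mu hS (Q.ra P) (onl H v) (Q.as (onl H (onl H (la P)))
    (onl H (onl H (Q.ra P))) (Q.cv (onl H (onl H (onl H v))) (Q.cv (Q.es' _) (Q.es _)))
    (((Q.ins P).rTensor H).rTensor H u))
  rw [Q.cc_natural hS (Q.ins P) v (onl H v), Q.mu_natural hS (Q.ins P),
    ← Q.intw_as (Q.cc hS (onl H v)) (onl H (la P)) (onl H (Q.ra P))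
      (Q.cv (onl H (onl H v)) (Q.es (P ⊗[k] H))),
    ← Q.intw_as (Q.mu hS (P ⊗[k] H)) (onl H (onl H (la P))) (onl H (onl H (Q.ra P)))
      (Q.cv (onl H (onl H (onl H v))) (Q.cv (Q.es' (P ⊗[k] H)) (Q.es _))), key,
    Q.mu_natural hS (Q.ins P),
    Q.intw_asi (((Q.ins P).rTensor H).rTensor H) _ _ _ (Q.es' _) (Q.es _)
      (onl H (onl H (onl H v))),
    Q.cc_natural hS ((Q.ins P).rTensor H) (onl H v) (onl H (onl H v)),
    Q.intw_as (((Q.ins P).rTensor H).rTensor H) _ _ _ (Q.es' _) (onl H (onl H (onl H v)))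
      (Q.es _),
    ← Q.intw_as (Q.mu hS (P ⊗[k] H)) (onl H (onl H (la P))) (onl H (onl H (Q.ra P)))
      (Q.cv (Q.cv (Q.es' (P ⊗[k] H)) (Q.es _)) (onl H (onl H (onl H v)))),
    ← Q.intw_as (Q.asi (Q.es' (P ⊗[k] H)) (Q.es _) (onl H (onl H (onl H v))))
      (onl H (onl H (la P))) (onl H (onl H (Q.ra P)))
      (Q.cv (Q.es' (P ⊗[k] H)) (Q.cv (Q.es _) (onl H (onl H (onl H v))))),
    ← Q.intw_as (Q.cc hS (onl H (onl H v))) (onl H (onl H (la P))) (onl H (onl H (Q.ra P)))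
      (Q.cv (Q.es' (P ⊗[k] H)) (Q.cv (onl H (onl H (onl H v))) (Q.es _))),
    ← Q.intw_as (Q.as (Q.es' (P ⊗[k] H)) (onl H (onl H (onl H v))) (Q.es _))
      (onl H (onl H (la P))) (onl H (onl H (Q.ra P)))
      (Q.cv (Q.cv (Q.es' (P ⊗[k] H)) (onl H (onl H (onl H v)))) (Q.es _))]
  have e : ((Q.ins P).rTensor H).rTensor H ((Q.cc hS v).rTensor H
      (Q.asi (onl H (onl H v)) (Q.es' P) (Q.es _) u)) = (Q.cc hS (onl H v)).rTensor H
      (((Q.ins P).rTensor H).rTensor H (Q.asi (onl H (onl H v)) (Q.es' P) (Q.es _) u)) := by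
    rw [← LinearMap.comp_apply (LinearMap.rTensor H (LinearMap.rTensor H _)),
      ← LinearMap.rTensor_comp, ← LinearMap.comp_apply (LinearMap.rTensor H (Q.cc hS _)),
      ← LinearMap.rTensor_comp]
    exact rTensor_congr_apply (fun u => Q.cc_natural hS (Q.ins P) v (onl H v) u) _
  rw [e, Q.intw_asi (((Q.ins P).rTensor H).rTensor H) _ _ _ (onl H (onl H (onl H v))) (Q.es' _)
      (Q.es _),
    ← Q.intw_as ((Q.cc hS (onl H v)).rTensor H) (onl H (onl H (la P)))
      (onl H (onl H (Q.ra P))) (Q.cv (Q.cv (onl H (onl H (onl H v))) (Q.es' (P ⊗[k] H))) (Q.es _))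
      (onl H (onl H (la P))) (onl H (onl H (Q.ra P)))
      (Q.cv (Q.cv (Q.es' (P ⊗[k] H)) (onl H (onl H (onl H v)))) (Q.es _)),
    ← Q.intw_as (Q.asi (onl H (onl H (onl H v))) (Q.es' (P ⊗[k] H)) (Q.es _))
      (onl H (onl H (la P))) (onl H (onl H (Q.ra P)))
      (Q.cv (onl H (onl H (onl H v))) (Q.cv (Q.es' (P ⊗[k] H)) (Q.es _)))]

end QuasiHopfAlgebra
-- Comparison of two antipodes along one algebra map.
namespace QuasiHopfAlgebra

section Twist

variable {k H B : Type*} [Field k] [Ring H] [Algebra k H] (Q : QuasiHopfAlgebra k H)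
  [Ring B] [Algebra k B]

/-- Left multiplication by the values of `d`. -/
def ll (d : H →ₗ[k] B) : H →ₗ[k] Module.End k B := LinearMap.mul k B ∘ₗ d

/-- Right multiplication by the values of `s`. -/
def rr (s : H →ₗ[k] B) : H →ₗ[k] Module.End k B := (LinearMap.mul k B).flip ∘ₗ s

@[simp]
theorem ll_apply (d : H →ₗ[k] B) (h : H) (b : B) : ll d h b = d h * b := rfl

@[simp]
theorem rr_apply (s : H →ₗ[k] B) (h : H) (b : B) : rr s h b = b * s h := rfl

instance (d s : H →ₗ[k] B) : Cm (ll d) (rr s) where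
  comm a b u := by simp [mul_assoc]

/-- Multiplication with an element in between: `u ⊗ v ↦ u a v`. -/
def km (a : B) : B ⊗[k] B →ₗ[k] B :=
  LinearMap.mul' k B ∘ₗ (LinearMap.mulRight k a).rTensor B

@[simp]
theorem km_tmul (a u v : B) : km (k := k) a (u ⊗ₜ v) = u * a * v := rfl

instance (a : B) (s : H →ₗ[k] B) : Intw (km (k := k) a) (onr B (rr s)) (rr s) where
  intw h t := ext_tmul (F := km (k := k) a ∘ₗ onr B (rr s) h) (G := rr s h ∘ₗ km (k := k) a)
    (fun u v => by simp [mul_assoc]) t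

theorem intw_km {s d : H →ₗ[k] B} {a : B}
    (h : ∀ x, sw (Q.Δ x) (fun x1 x2 => s x1 * a * d x2) = Q.ε x • a) :
    Intw (km (k := k) a) (Q.cv (onl B (rr s)) (onr B (ll d))) (Q.tr B) where
  intw x t := by
    refine ext_tmul (F := km (k := k) a ∘ₗ Q.cv (onl B (rr s)) (onr B (ll d)) x)
      (G := Q.tr B x ∘ₗ km (k := k) a) (fun u v => ?_) t
    have := congrArg (LinearMap.mulLeft k u ∘ₗ LinearMap.mulRight k v) (h x)
    simp only [map_sw] at this
    simp only [LinearMap.comp_apply, cv_apply_sw, map_sw]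
    simpa [mul_assoc] using this

theorem intw_pt {s d : H →ₗ[k] B} {b : B}
    (h : ∀ x, sw (Q.Δ x) (fun x1 x2 => d x1 * b * s x2) = Q.ε x • b) :
    Intw (LinearMap.toSpanSingleton k B b) (Q.tr k) (Q.cv (ll d) (rr s)) where
  intw x t := by
    have := congrArg (LinearMap.lsmul k B t) (h x)
    simp only [map_sw] at this
    rw [cv_apply_sw]
    simpa [mul_assoc, mul_smul, smul_comm t] using this.symm

/-- The element `s₁(x¹) a₁ d(x²) b₂ s₂(x³)`. -/
def twistElt (s₁ : H →ₗ[k] B) (a₁ : B) (d : H →ₗ[k] B) (b₂ : B) (s₂ : H →ₗ[k] B) : B :=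
  km (k := k) a₁ (Q.asi (onl B (rr s₁)) (onr B (ll d)) (onr B (rr s₂)) (1 ⊗ₜ b₂))

theorem twistElt_eq (s₁ : H →ₗ[k] B) (a₁ : B) (d : H →ₗ[k] B) (b₂ : B) (s₂ : H →ₗ[k] B) :
    Q.twistElt s₁ a₁ d b₂ s₂ =
      sw3 Q.Φinv fun x1 x2 x3 => s₁ x1 * a₁ * (d x2 * b₂ * s₂ x3) := by
  rw [twistElt, asi_apply_sw, map_sw3]
  simp [mul_assoc]

variable {s₁ s₂ d : H →ₗ[k] B} {a₁ a₂ b₁ b₂ : B}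

instance (b c : B) (x : H →ₗ[k] Module.End k B) (y : H →ₗ[k] Module.End k k)
    [h : Intw (LinearMap.toSpanSingleton k B b) y x] :
    Intw (TensorProduct.mk k B B c ∘ₗ LinearMap.toSpanSingleton k B b) y (onr B x) where
  intw a u := by rw [LinearMap.comp_apply, h.intw]; rfl

instance (b c : B) (x : H →ₗ[k] Module.End k B) (y : H →ₗ[k] Module.End k k)
    [h : Intw (LinearMap.toSpanSingleton k B b) y x] :
    Intw ((TensorProduct.mk k B B).flip c ∘ₗ LinearMap.toSpanSingleton k B b) y (onl B x) where
  intw a u := by rw [LinearMap.comp_apply, h.intw]; rfl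

/-- The argument for uniqueness of the antipode. Multiplying by s₂(x) on the right can be completed
to the action of x on all three slots, since a₁ makes the first two trivial; past Φ⁻¹ the last two
become trivial on b₂ instead, leaving s₁(x). -/
theorem mul_twistElt [Rep (rr s₁)] [Rep (ll d)] [Rep (rr s₂)]
    [Intw (km (k := k) a₁) (Q.cv (onl B (rr s₁)) (onr B (ll d))) (Q.tr B)]
    [Intw (LinearMap.toSpanSingleton k B b₂) (Q.tr k) (Q.cv (ll d) (rr s₂))] (x : H) :
    s₁ x * Q.twistElt s₁ a₁ d b₂ s₂ = Q.twistElt s₁ a₁ d b₂ s₂ * s₂ x := by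
  have e : (1 : B) ⊗ₜ[k] b₂ =
      (TensorProduct.mk k B B 1 ∘ₗ LinearMap.toSpanSingleton k B b₂) (1 : k) := by simp
  have h1 : Q.twistElt s₁ a₁ d b₂ s₂ * s₂ x = km (k := k) a₁ (Q.cv (Q.cv (onl B (rr s₁))
      (onr B (ll d))) (onr B (rr s₂)) x (Q.asi (onl B (rr s₁)) (onr B (ll d)) (onr B (rr s₂))
        (1 ⊗ₜ b₂))) := by
    rw [Intw.intw (F := km (k := k) a₁) (i' := Q.cv (Q.tr B) (rr s₂)), tr_cv]; rfl
  have h2 : Q.cv (onl B (rr s₁)) (Q.cv (onr B (ll d)) (onr B (rr s₂))) x (1 ⊗ₜ[k] b₂) =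
      s₁ x ⊗ₜ[k] b₂ := by
    rw [cv_apply_sw]
    have : ∀ y, Q.cv (onr B (ll d)) (onr B (rr s₂)) y (1 ⊗ₜ[k] b₂) = Q.tr _ y (1 ⊗ₜ[k] b₂) := by
      intro y
      rw [← onr_cv, e, ← Intw.intw (F := TensorProduct.mk k B B 1 ∘ₗ
        LinearMap.toSpanSingleton k B b₂) (i := Q.tr k)]
      simp
    simp only [this]
    rw [← cv_apply_sw, cv_tr]
    simp
  rw [h1, ← asi_cv, h2, twistElt_eq, asi_apply_sw, map_sw3, ← LinearMap.mulLeft_apply (R := k),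
    map_sw3]
  congr 1; funext x1 x2 x3
  simp [mul_assoc]

/-- Invariance of b₁ and b₂ and evaluation by a₁ remove every reassociator except the one in the
zigzag for (s₁, a₁, b₁). -/
theorem mul_twistElt_eq [Rep (rr s₁)] [Rep (ll d)] [Rep (rr s₂)]
    [Intw (km (k := k) a₁) (Q.cv (onl B (rr s₁)) (onr B (ll d))) (Q.tr B)]
    [Intw (LinearMap.toSpanSingleton k B b₁) (Q.tr k) (Q.cv (ll d) (rr s₁))]
    [Intw (LinearMap.toSpanSingleton k B b₂) (Q.tr k) (Q.cv (ll d) (rr s₂))]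
    (hz : sw3 Q.Φ (fun X1 X2 X3 => d X1 * b₁ * s₁ X2 * a₁ * d X3) = 1) :
    b₁ * Q.twistElt s₁ a₁ d b₂ s₂ = b₂ := by
  have e1 : b₁ ⊗ₜ[k] b₂ =
      (TensorProduct.mk k B B b₁ ∘ₗ LinearMap.toSpanSingleton k B b₂) (1 : k) := by simp
  have e2 : b₁ ⊗ₜ[k] b₂ =
      ((TensorProduct.mk k B B).flip b₂ ∘ₗ LinearMap.toSpanSingleton k B b₁) (1 : k) := by simp
  have i1 : Intw (TensorProduct.mk k B B b₁ ∘ₗ LinearMap.toSpanSingleton k B b₂) (Q.tr k)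
    (Q.cv (onr B (ll d)) (onr B (rr s₂))) := by rw [← onr_cv]; infer_instance
  have i2 : Intw ((TensorProduct.mk k B B).flip b₂ ∘ₗ LinearMap.toSpanSingleton k B b₁) (Q.tr k)
    (Q.cv (onl B (ll d)) (onl B (rr s₁))) := by rw [← onl_cv]; infer_instance
  have h1 : b₁ * Q.twistElt s₁ a₁ d b₂ s₂ = km (k := k) a₁ (Q.asi (onl B (rr s₁)) (onr B (ll d))
      (onr B (rr s₂)) (b₁ ⊗ₜ b₂)) := by
    rw [twistElt_eq, asi_apply_sw, map_sw3, ← LinearMap.mulLeft_apply (R := k), map_sw3]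
    congr 1; funext x1 x2 x3
    simp [mul_assoc]
  have h2 : b₁ ⊗ₜ[k] b₂ = Q.as (onl B (ll d)) (onl B (rr s₁))
      (Q.cv (onr B (ll d)) (onr B (rr s₂))) (b₁ ⊗ₜ b₂) := by
    rw [e1, Q.inv_as3]
  rw [h1, h2, pentagon_asi_as', e2, Q.inv_asi1, Q.kill_as2, ← e2, as_apply_sw, map_sw3]
  have := congrArg (LinearMap.mulRight k b₂) hz
  rw [map_sw3] at this
  simpa [mul_assoc] using this

theorem twistElt_mul [Rep (rr s₁)] [Rep (ll d)] [Rep (rr s₂)]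
    [Intw (km (k := k) a₁) (Q.cv (onl B (rr s₁)) (onr B (ll d))) (Q.tr B)]
    [Intw (km (k := k) a₂) (Q.cv (onl B (rr s₂)) (onr B (ll d))) (Q.tr B)]
    [Intw (LinearMap.toSpanSingleton k B b₂) (Q.tr k) (Q.cv (ll d) (rr s₂))]
    (hz : sw3 Q.Φ (fun X1 X2 X3 => d X1 * b₂ * s₂ X2 * a₂ * d X3) = 1) :
    Q.twistElt s₁ a₁ d b₂ s₂ * a₂ = a₁ := by
  let K : (B ⊗[k] B) ⊗[k] B →ₗ[k] B := km (k := k) a₂ ∘ₗ (km (k := k) a₁).rTensor B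
  let K' : (B ⊗[k] B) ⊗[k] B →ₗ[k] B := km (k := k) a₁ ∘ₗ (km (k := k) a₂).lTensor B ∘ₗ
    (TensorProduct.assoc k B B B).toLinearMap
  have hK : K = K' := by ext; simp [K, K', mul_assoc]
  let t : (B ⊗[k] B) ⊗[k] B := (1 ⊗ₜ b₂) ⊗ₜ 1
  let i1 : H →ₗ[k] Module.End k ((B ⊗[k] B) ⊗[k] B) := onl B (onl B (rr s₁))
  let i2 : H →ₗ[k] Module.End k ((B ⊗[k] B) ⊗[k] B) := onl B (onr B (ll d))
  let i3 : H →ₗ[k] Module.End k ((B ⊗[k] B) ⊗[k] B) := onl B (onr B (rr s₂))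
  let i4 : H →ₗ[k] Module.End k ((B ⊗[k] B) ⊗[k] B) := onr (B ⊗[k] B) (ll d)
  have g1 : Intw K (Q.cv i1 i2) (Q.tr B) := by
    have h1 : Intw ((km (k := k) a₁).rTensor B) (Q.cv i1 i2) (Q.tr _) := by
      rw [← onl_cv, ← onl_tr]; infer_instance
    exact intw_comp _ _ _ (Q.tr _) _
  have g2 : Intw K (Q.cv i3 i4) (Q.tr B) := by
    have h1 : Intw ((km (k := k) a₁).rTensor B) (Q.cv i3 i4)
      (Q.cv (onl B (rr s₂)) (onr B (ll d))) := inferInstance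
    exact intw_comp _ _ _ (Q.cv (onl B (rr s₂)) (onr B (ll d))) _
  let G : k →ₗ[k] (B ⊗[k] B) ⊗[k] B := (TensorProduct.mk k (B ⊗[k] B) B).flip 1 ∘ₗ
    (TensorProduct.mk k B B 1 ∘ₗ LinearMap.toSpanSingleton k B b₂)
  have g3 : Intw G (Q.tr k) (Q.cv i2 i3) := by
    have h1 : Intw (TensorProduct.mk k B B 1 ∘ₗ LinearMap.toSpanSingleton k B b₂) (Q.tr k)
      (Q.cv (onr B (ll d)) (onr B (rr s₂))) := by rw [← onr_cv]; infer_instance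
    have h2 : Intw ((TensorProduct.mk k (B ⊗[k] B) B).flip 1)
      (Q.cv (onr B (ll d)) (onr B (rr s₂))) (Q.cv i2 i3) := by
        rw [← onl_cv]; exact ⟨fun a u => rfl⟩
    exact intw_comp _ _ _ (Q.cv (onr B (ll d)) (onr B (rr s₂))) _
  have et : t = G 1 := by simp [t, G]
  have c1 : Q.twistElt s₁ a₁ d b₂ s₂ * a₂ = K (Q.asi i1 i2 i3 t) := by
    rw [twistElt_eq, asi_apply_sw, map_sw3, ← LinearMap.mulRight_apply (R := k), map_sw3]
    congr 1; funext x1 x2 x3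
    simp [K, t, i1, i2, i3, mul_assoc]
  have c2 : K (Q.as i2 i3 i4 t) = a₁ := by
    rw [as_apply_sw, map_sw3]
    have := congrArg (LinearMap.mulLeft k a₁) hz
    rw [map_sw3] at this
    simpa [K, t, i2, i3, i4, mul_assoc] using this
  -- The pentagon with the middle slot trivial, by invariance of b₂. The two outer inverse
  -- reassociators are then deleted by the evaluations with a₁ and a₂, and the zigzag remains.
  have c3 : Q.asi i1 i2 i3 t =
      Q.asi (Q.cv i1 i2) i3 i4 (Q.asi i1 i2 (Q.cv i3 i4) (Q.as i2 i3 i4 t)) := by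
    rw [← pentagon_inv, asi_as]
    congr 1
    rw [et, Q.inv_asi2]
  rw [c1, c3, Q.kill_asi1, Q.kill_asi3, c2]

end Twist

end QuasiHopfAlgebra

section SweedlerMaps

variable {k A B C D P P' : Type*} [Field k]
  [AddCommMonoid A] [Module k A] [AddCommMonoid B] [Module k B] [AddCommMonoid C] [Module k C]
  [AddCommMonoid D] [Module k D]
  [AddCommMonoid P] [Module k P] [AddCommMonoid P'] [Module k P']

theorem sw4_apply (L : A ⊗[k] (B ⊗[k] (C ⊗[k] D)) →ₗ[k] P) (T : A ⊗[k] (B ⊗[k] (C ⊗[k] D))) :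
    sw4 T (fun a b c d => L (a ⊗ₜ (b ⊗ₜ (c ⊗ₜ d)))) = L T := by
  rw [← sw_apply L T, sw4]
  congr 1; funext a t
  exact sw3_apply (L ∘ₗ TensorProduct.mk k A (B ⊗[k] (C ⊗[k] D)) a) t

theorem map_sw4 (L : P →ₗ[k] P') (T : A ⊗[k] (B ⊗[k] (C ⊗[k] D))) (F : A → B → C → D → P) :
    L (sw4 T F) = sw4 T fun a b c d => L (F a b c d) := by
  simp only [sw4, map_sw, map_sw3]

theorem mul_sw {R : Type*} [Ring R] [Algebra k R] (r : R) (T : A ⊗[k] B) (F : A → B → R) :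
    r * sw T F = sw T fun a b => r * F a b := map_sw (LinearMap.mulLeft k r) T F

theorem sw_mul {R : Type*} [Ring R] [Algebra k R] (r : R) (T : A ⊗[k] B) (F : A → B → R) :
    sw T F * r = sw T fun a b => F a b * r := map_sw (LinearMap.mulRight k r) T F

end SweedlerMaps

theorem Intw.comp {k A P P' P'' : Type*} [Field k] [Ring A] [Algebra k A]
    [AddCommGroup P] [Module k P] [AddCommGroup P'] [Module k P'] [AddCommGroup P''] [Module k P'']
    {F : P →ₗ[k] P'} {G : P' →ₗ[k] P''} {i : A →ₗ[k] Module.End k P}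
    {i' : A →ₗ[k] Module.End k P'} {i'' : A →ₗ[k] Module.End k P''} (hG : Intw G i' i'')
    (hF : Intw F i i') : Intw (G ∘ₗ F) i i'' := intw_comp F G i i' i''

/-! ### The Drinfeld twist: the elements γ, δ, f, f⁻¹. -/

namespace QuasiHopfAlgebra

variable {k H : Type*} [Field k] [Ring H] [Algebra k H] (Q : QuasiHopfAlgebra k H)

/-- `h ↦ S(h₂) ⊗ S(h₁)`. -/
def SΔ : H →ₗ[k] H ⊗[k] H :=
  TensorProduct.map Q.S Q.S ∘ₗ (TensorProduct.comm k H H).toLinearMap ∘ₗ Q.Δ.toLinearMap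

theorem SΔ_apply (h : H) : Q.SΔ h = sw (Q.Δ h) fun h1 h2 => Q.S h2 ⊗ₜ[k] Q.S h1 :=
  (sw_apply (TensorProduct.map Q.S Q.S ∘ₗ (TensorProduct.comm k H H).toLinearMap) (Q.Δ h)).symm

theorem ll_Δ : ll Q.Δ.toLinearMap = Q.cv (onl H (lm k H)) (la H) := by
  ext h a b
  have := sw_apply (LinearMap.mulRight k (a ⊗ₜ[k] b)) (Q.Δ h)
  simp [cv_apply_sw]
  simpa using this.symm

theorem rr_SΔ : rr Q.SΔ = Q.cv (Q.ra H) (onl H Q.rs) := by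
  ext h a b
  simp only [TensorProduct.AlgebraTensorModule.curry_apply, LinearMap.restrictScalars_self,
      TensorProduct.curry_apply, cv_apply_sw, rr_apply, SΔ_apply]
  rw [← LinearMap.mulLeft_apply (R := k), map_sw]
  simp

theorem onr_tr {P P' : Type*} [AddCommGroup P] [Module k P] [AddCommGroup P'] [Module k P'] :
    onr P (Q.tr P') = Q.tr (P ⊗[k] P') := by
  ext; simp

instance : Rep (ll Q.Δ.toLinearMap) := by rw [ll_Δ]; infer_instance
instance : Rep (rr Q.SΔ) := by rw [rr_SΔ]; infer_instance
instance : Rep (rr (Q.Δ.toLinearMap ∘ₗ Q.S)) where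
  one := by ext; simp [Q.S_one]
  mul a b u := by simp [mul_assoc, Q.S_mul]

/-- `(u₁ ⊗ u₂) ⊗ (v₁ ⊗ v₂) ↦ u₁ α v₁ ⊗ u₂ α v₂`. -/
def kαα : (H ⊗[k] H) ⊗[k] (H ⊗[k] H) →ₗ[k] H ⊗[k] H :=
  (km (k := k) Q.α).lTensor H ∘ₗ (km (k := k) Q.α).rTensor (H ⊗[k] H) ∘ₗ
    (TensorProduct.tensorTensorTensorComm k H H H H).toLinearMap

@[simp]
theorem kαα_tmul (u1 u2 v1 v2 : H) : Q.kαα ((u1 ⊗ₜ u2) ⊗ₜ (v1 ⊗ₜ v2)) =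
    (u1 * Q.α * v1) ⊗ₜ[k] (u2 * Q.α * v2) := rfl

instance : Intw (km (k := k) Q.α) (Q.cv (onl H Q.rs) (la H)) (Q.tr H) :=
  Q.intw_km (s := Q.S) (d := LinearMap.id) Q.antipode_left

instance : Intw (LinearMap.toSpanSingleton k H Q.β) (Q.tr k) (Q.cv (lm k H) Q.rs) :=
  Q.intw_pt (s := Q.S) (d := LinearMap.id) Q.antipode_right

theorem sw4_tA {M : Type*} [AddCommGroup M] [Module k M]
    (L : H ⊗[k] (H ⊗[k] (H ⊗[k] H)) →ₗ[k] M) : L Q.tA =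
    sw3 Q.Φ fun X1 X2 X3 => sw3 Q.Φinv fun x1 x2 x3 => sw (Q.Δ x1) fun x11 x12 =>
    L ((X1 * x11) ⊗ₜ[k] ((X2 * x12) ⊗ₜ[k] ((X3 * x2) ⊗ₜ[k] x3))) := by
  simp only [tA, map_sw3, map_sw]

theorem sw4_tB {M : Type*} [AddCommGroup M] [Module k M]
    (L : H ⊗[k] (H ⊗[k] (H ⊗[k] H)) →ₗ[k] M) : L Q.tB =
    sw3 Q.Φ fun X1 X2 X3 => sw3 Q.Φinv fun x1 x2 x3 => sw (Q.Δ X1) fun X11 X12 =>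
    L ((X11 * x1) ⊗ₜ[k] ((X12 * x2) ⊗ₜ[k] ((X2 * x3) ⊗ₜ[k] X3))) := by
  simp only [tB, map_sw3, map_sw]

theorem ac_tA {P : Type*} [AddCommGroup P] [Module k P] (i j l m : H →ₗ[k] Module.End k P)
    [Rep i] [Rep j] [Rep l] [Rep m] [Cm i j] [Cm i l] [Cm i m] [Cm j l] [Cm j m]
    [Cm l m] (u : P) : ac i (ac j (ac l m)) Q.tA u = Q.as i j l (Q.asi (Q.cv i j) l m u) := by
  have := Q.sw4_tA (LinearMap.applyₗ u ∘ₗ ac i (ac j (ac l m)))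
  simp only [LinearMap.comp_apply, LinearMap.applyₗ_apply_apply] at this
  rw [this, as_apply_sw]
  congr 1; funext a b c
  rw [asi_apply_sw, map_sw3, map_sw3, map_sw3]
  congr 1; funext x y z
  rw [cv_apply_sw, map_sw, map_sw, map_sw]
  congr 1; funext p q
  simp only [ac_tmul, Rep.mul]
  rw [Cm.comm (i := i) (j := j) p b, Cm.comm (i := j) (j := l) q c,
    Cm.comm (i := i) (j := l) p c]

theorem ac_tB {P : Type*} [AddCommGroup P] [Module k P] (i j l m : H →ₗ[k] Module.End k P)
    [Rep i] [Rep j] [Rep l] [Rep m] [Cm i j] [Cm i l] [Cm i m] [Cm j l] [Cm j m]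
    [Cm l m] (u : P) : ac i (ac j (ac l m)) Q.tB u = Q.as (Q.cv i j) l m (Q.asi i j l u) := by
  have := Q.sw4_tB (LinearMap.applyₗ u ∘ₗ ac i (ac j (ac l m)))
  simp only [LinearMap.comp_apply, LinearMap.applyₗ_apply_apply] at this
  rw [this, as_apply_sw]
  congr 1; funext a b c
  rw [asi_apply_sw, map_sw3, map_sw3, map_sw3]
  congr 1; funext x y z
  rw [cv_apply_sw]
  congr 1; funext p q
  simp only [ac_tmul, Rep.mul]
  rw [Cm.comm (i := l) (j := m) z c, Cm.comm (i := j) (j := l) y b, Cm.comm (i := j) (j := m) y c,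
    Cm.comm (i := i) (j := j) x q, Cm.comm (i := i) (j := l) x b, Cm.comm (i := i) (j := m) x c]

/-- γ is a pair of α-evaluations, one for each tensor factor, preceded by the reassociators encoded
in A; this form makes its invariance a formal matter. -/
theorem km_γ : km (k := k) Q.γ = Q.kαα ∘ₗ
    Q.as (onl _ (Q.ra H)) (onl _ (onl H Q.rs)) (onr (H ⊗[k] H) (onl H (lm k H))) ∘ₗ
    Q.asi (Q.cv (onl _ (Q.ra H)) (onl _ (onl H Q.rs))) (onr (H ⊗[k] H) (onl H (lm k H)))
      (onr (H ⊗[k] H) (la H)) := by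
  ext u1 u2 v1 v2
  simp only [TensorProduct.AlgebraTensorModule.curry_apply, LinearMap.restrictScalars_self,
      TensorProduct.curry_apply, LinearMap.comp_apply, km_tmul]
  rw [← ac_tA, γ, ← LinearMap.mulRight_apply (R := k), ← LinearMap.mulLeft_apply (R := k), map_sw4,
    map_sw4]
  have := sw4_apply (Q.kαα ∘ₗ LinearMap.applyₗ ((u1 ⊗ₜ u2) ⊗ₜ (v1 ⊗ₜ v2)) ∘ₗ
    ac (onl _ (Q.ra H)) (ac (onl _ (onl H Q.rs)) (ac (onr (H ⊗[k] H) (onl H (lm k H)))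
      (onr (H ⊗[k] H) (la H))))) Q.tA
  refine Eq.trans ?_ this
  congr 1; funext a b c d
  simp [mul_assoc]

theorem δ_eq : Q.δ = Q.as (Q.cv (onl H (lm k H)) (la H)) (Q.ra H) (onl H Q.rs)
    (Q.asi (onl H (lm k H)) (la H) (Q.ra H) (Q.β ⊗ₜ Q.β)) := by
  rw [← ac_tB, δ]
  have := sw4_apply (LinearMap.applyₗ (Q.β ⊗ₜ Q.β) ∘ₗ
    ac (onl H (lm k H)) (ac (la H) (ac (Q.ra H) (onl H Q.rs)))) Q.tB
  refine Eq.trans ?_ this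
  congr 1; funext a b c d
  simp [mul_assoc]

/-- δ plays the part of β for the antipode (S ⊗ S)Δᵒᵖ along Δ: the outer β is invariant, the second
β is inserted between its two slots, and the reassociators of B are linear. -/
instance : Intw (LinearMap.toSpanSingleton k _ Q.δ) (Q.tr k)
    (Q.cv (ll Q.Δ.toLinearMap) (rr Q.SΔ)) := by
  have h : LinearMap.toSpanSingleton k _ Q.δ =
      Q.as (Q.cv (onl H (lm k H)) (la H)) (Q.ra H) (onl H Q.rs) ∘ₗ
      Q.asi (onl H (lm k H)) (la H) (Q.ra H) ∘ₗ Q.ins H ∘ₗ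
      LinearMap.toSpanSingleton k H Q.β := by
    ext; simp [δ_eq]
  rw [h, ll_Δ, rr_SΔ]
  have i1 : Intw (Q.ins H) (Q.cv (lm k H) Q.rs) (Q.cv (Q.cv (onl H (lm k H)) (Q.es H))
      (onl H Q.rs)) := by
    have : Intw (Q.ins H) (Q.cv (Q.cv (lm k H) (Q.tr H)) Q.rs)
      (Q.cv (Q.cv (onl H (lm k H)) (Q.es H)) (onl H Q.rs)) := inferInstance
    rwa [cv_tr] at this
  have i2 : Intw (Q.asi (onl H (lm k H)) (la H) (Q.ra H))
      (Q.cv (Q.cv (onl H (lm k H)) (Q.es H)) (onl H Q.rs))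
      (Q.cv (Q.cv (Q.cv (onl H (lm k H)) (la H)) (Q.ra H)) (onl H Q.rs)) := inferInstance
  have i3 : Intw (Q.as (Q.cv (onl H (lm k H)) (la H)) (Q.ra H) (onl H Q.rs))
      (Q.cv (Q.cv (Q.cv (onl H (lm k H)) (la H)) (Q.ra H)) (onl H Q.rs))
      (Q.cv (Q.cv (onl H (lm k H)) (la H)) (Q.cv (Q.ra H) (onl H Q.rs))) := inferInstance
  exact i3.comp (i2.comp (i1.comp inferInstance))

instance : Intw (km (k := k) Q.γ) (Q.cv (onl _ (rr Q.SΔ)) (onr _ (ll Q.Δ.toLinearMap)))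
    (Q.tr _) := by
  rw [km_γ, ll_Δ, rr_SΔ, onl_cv, onr_cv]
  have e : ∀ {F G : (H ⊗[k] H) ⊗[k] (H ⊗[k] H) →ₗ[k] (H ⊗[k] H) ⊗[k] (H ⊗[k] H)},
      (∀ u1 u2 v1 v2, F ((u1 ⊗ₜ u2) ⊗ₜ (v1 ⊗ₜ v2)) = G ((u1 ⊗ₜ u2) ⊗ₜ (v1 ⊗ₜ v2))) →
      ∀ t, F t = G t := fun h => ext_tmul fun u v => ext_tmul (F := _ ∘ₗ
        (TensorProduct.mk k _ _).flip v) (G := _ ∘ₗ (TensorProduct.mk k _ _).flip v)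
        (fun u1 u2 => ext_tmul (F := _ ∘ₗ TensorProduct.mk k _ _ (u1 ⊗ₜ u2))
          (G := _ ∘ₗ TensorProduct.mk k _ _ (u1 ⊗ₜ u2)) (fun v1 v2 => h u1 u2 v1 v2) v) u
  -- `T` brings together the two slots that each α joins; `t1` to `t4` record where the four actions
  -- go.
  let T := (TensorProduct.tensorTensorTensorComm k H H H H).toLinearMap
  have t1 : Intw T (onl _ (Q.ra H)) (onr (H ⊗[k] H) (onl H Q.rs)) :=
    ⟨fun a => e (F := T ∘ₗ onl _ (Q.ra H) a) (G := onr (H ⊗[k] H) (onl H Q.rs) a ∘ₗ T)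
      fun _ _ _ _ => rfl⟩
  have t2 : Intw T (onl _ (onl H Q.rs)) (onl (H ⊗[k] H) (onl H Q.rs)) :=
    ⟨fun a => e (F := T ∘ₗ onl _ (onl H Q.rs) a) (G := onl (H ⊗[k] H) (onl H Q.rs) a ∘ₗ T)
      fun _ _ _ _ => rfl⟩
  have t3 : Intw T (onr _ (onl H (lm k H))) (onl (H ⊗[k] H) (la H)) :=
    ⟨fun a => e (F := T ∘ₗ onr _ (onl H (lm k H)) a) (G := onl (H ⊗[k] H) (la H) a ∘ₗ T)
      fun _ _ _ _ => rfl⟩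
  have t4 : Intw T (onr _ (la H)) (onr (H ⊗[k] H) (la H)) :=
    ⟨fun a => e (F := T ∘ₗ onr _ (la H) a) (G := onr (H ⊗[k] H) (la H) a ∘ₗ T)
      fun _ _ _ _ => rfl⟩
  -- Evaluating the inner pair leaves a trivial representation between the slots of the outer pair,
  -- so that the second α can evaluate these.
  have t5 : Intw ((km (k := k) Q.α).rTensor (H ⊗[k] H))
      (Q.cv (Q.cv (onr (H ⊗[k] H) (onl H Q.rs)) (Q.cv (onl (H ⊗[k] H) (onl H Q.rs))
        (onl (H ⊗[k] H) (la H)))) (onr (H ⊗[k] H) (la H)))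
      (Q.cv (onr H (onl H Q.rs)) (onr H (la H))) := by
    have : Intw ((km (k := k) Q.α).rTensor (H ⊗[k] H)) (Q.cv (onl (H ⊗[k] H) (onl H Q.rs))
        (onl (H ⊗[k] H) (la H))) (Q.tr _) := by
      rw [← onl_cv, ← onl_tr]; infer_instance
    have : Intw ((km (k := k) Q.α).rTensor (H ⊗[k] H))
      (Q.cv (Q.cv (onr (H ⊗[k] H) (onl H Q.rs)) (Q.cv (onl (H ⊗[k] H) (onl H Q.rs))
        (onl (H ⊗[k] H) (la H)))) (onr (H ⊗[k] H) (la H)))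
      (Q.cv (Q.cv (onr H (onl H Q.rs)) (Q.tr _)) (onr H (la H))) := inferInstance
    rwa [cv_tr] at this
  have t6 : Intw ((km (k := k) Q.α).lTensor H) (Q.cv (onr H (onl H Q.rs)) (onr H (la H)))
      (Q.tr _) := by
    rw [← onr_cv, ← onr_tr]; infer_instance
  have t7 : Intw T (Q.cv (Q.cv (onl _ (Q.ra H)) (Q.cv (onl _ (onl H Q.rs))
      (onr (H ⊗[k] H) (onl H (lm k H))))) (onr (H ⊗[k] H) (la H)))
      (Q.cv (Q.cv (onr (H ⊗[k] H) (onl H Q.rs)) (Q.cv (onl (H ⊗[k] H) (onl H Q.rs))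
        (onl (H ⊗[k] H) (la H)))) (onr (H ⊗[k] H) (la H))) := inferInstance
  exact (t6.comp (t5.comp t7)).comp (.comp (i' := Q.cv (Q.cv (Q.cv (onl _ (Q.ra H))
      (onl _ (onl H Q.rs))) (onr (H ⊗[k] H) (onl H (lm k H)))) (onr (H ⊗[k] H) (la H)))
      inferInstance inferInstance)

instance : Intw (km (k := k) (Q.Δ Q.α)) (Q.cv (onl _ (rr (Q.Δ.toLinearMap ∘ₗ Q.S)))
    (onr _ (ll Q.Δ.toLinearMap))) (Q.tr _) := Q.intw_km fun x => by
  have := congrArg Q.Δ.toLinearMap (Q.antipode_left x)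
  rw [map_sw] at this
  simpa using this

instance : Intw (LinearMap.toSpanSingleton k _ (Q.Δ Q.β)) (Q.tr k)
    (Q.cv (ll Q.Δ.toLinearMap) (rr (Q.Δ.toLinearMap ∘ₗ Q.S))) := Q.intw_pt fun x => by
  have := congrArg Q.Δ.toLinearMap (Q.antipode_right x)
  rw [map_sw] at this
  simpa using this

theorem Δ_antipode_Φ : sw3 Q.Φ (fun X1 X2 X3 => Q.Δ.toLinearMap X1 * Q.Δ Q.β *
    (Q.Δ.toLinearMap ∘ₗ Q.S) X2 * Q.Δ Q.α * Q.Δ.toLinearMap X3) = 1 := by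
  have := congrArg Q.Δ.toLinearMap (Q.antipode_Φ)
  rw [map_sw3] at this
  simpa using this

/-- f⁻¹ compares Δ ∘ S with (S ⊗ S)Δᵒᵖ and f compares them in the other direction. Only the
intertwining relations are needed; that f and f⁻¹ are mutually inverse plays no role. -/
theorem fInv_eq : Q.fInv =
    Q.twistElt (Q.Δ.toLinearMap ∘ₗ Q.S) (Q.Δ Q.α) Q.Δ.toLinearMap Q.δ Q.SΔ := by
  rw [twistElt_eq, fInv]
  congr 1; funext x1 x2 x3
  rw [SΔ_apply, mul_sw, mul_sw]
  simp [mul_assoc]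

theorem f_eq : Q.f =
    Q.twistElt Q.SΔ Q.γ Q.Δ.toLinearMap (Q.Δ Q.β) (Q.Δ.toLinearMap ∘ₗ Q.S) := by
  rw [twistElt_eq, f]
  congr 1; funext x1 x2 x3
  rw [SΔ_apply, sw_mul, sw_mul]
  simp [mul_assoc]

/-- `Δ(S(h)) f⁻¹ = f⁻¹ (S(h₂) ⊗ S(h₁))`. -/
theorem ΔS_mul_fInv (h : H) : Q.Δ (Q.S h) * Q.fInv = Q.fInv * Q.SΔ h := by
  rw [fInv_eq]; exact Q.mul_twistElt (s₁ := Q.Δ.toLinearMap ∘ₗ Q.S) h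

/-- `Δ(β) f⁻¹ = δ`. -/
theorem Δβ_mul_fInv : Q.Δ Q.β * Q.fInv = Q.δ := by
  rw [fInv_eq]; exact Q.mul_twistElt_eq (s₁ := Q.Δ.toLinearMap ∘ₗ Q.S) Q.Δ_antipode_Φ

/-- `(S(h₂) ⊗ S(h₁)) f = f Δ(S(h))`. -/
theorem SΔ_mul_f (h : H) : Q.SΔ h * Q.f = Q.f * Q.Δ (Q.S h) := by
  rw [f_eq]; exact Q.mul_twistElt (s₂ := Q.Δ.toLinearMap ∘ₗ Q.S) h

/-- `f Δ(α) = γ`. -/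
theorem f_mul_Δα : Q.f * Q.Δ Q.α = Q.γ := by
  rw [f_eq]; exact Q.twistElt_mul (s₂ := Q.Δ.toLinearMap ∘ₗ Q.S) Q.Δ_antipode_Φ

end QuasiHopfAlgebra
-- The explicit form of the braiding.
namespace QuasiHopfAlgebra

variable {k H P P' P'' : Type*} [Field k] [Ring H] [Algebra k H] (Q : QuasiHopfAlgebra k H)
  [AddCommGroup P] [Module k P] [AddCommGroup P'] [Module k P'] [AddCommGroup P''] [Module k P'']
  (hS : Function.Bijective Q.S)

/-- Insertion of a vector of `P` as first factor, `a ⊗ b ↦ (p ⊗ a) ⊗ b`. -/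
def insl (p : P) : H ⊗[k] H →ₗ[k] (P ⊗[k] H) ⊗[k] H := (TensorProduct.mk k P H p).rTensor H

@[simp]
theorem insl_tmul (p : P) (a b : H) : insl (k := k) p (a ⊗ₜ b) = (p ⊗ₜ a) ⊗ₜ b := rfl

instance (p : P) (i : H →ₗ[k] Module.End k H) :
    Intw (insl (k := k) p) (onl H i) (onl H (onr P i)) where
  intw a t := ext_tmul (F := insl (k := k) p ∘ₗ onl H i a) (G := onl H (onr P i) a ∘ₗ insl p)
    (fun _ _ => rfl) t

instance (p : P) (i : H →ₗ[k] Module.End k H) :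
    Intw (insl (k := k) p) (onr H i) (onr (P ⊗[k] H) i) where
  intw a t := ext_tmul (F := insl (k := k) p ∘ₗ onr H i a) (G := onr (P ⊗[k] H) i a ∘ₗ insl p)
    (fun _ _ => rfl) t

/-- The map `p ⊗ h ↦ p ⊗ Δ(h) f⁻¹`. -/
def Δg (P : Type*) [AddCommGroup P] [Module k P] : P ⊗[k] H →ₗ[k] (P ⊗[k] H) ⊗[k] H :=
  (TensorProduct.assoc k P H H).symm.toLinearMap ∘ₗ
    (LinearMap.mulRight k Q.fInv ∘ₗ Q.Δ.toLinearMap).lTensor P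

theorem assoc_symm_tmul (p : P) (t : H ⊗[k] H) :
    (TensorProduct.assoc k P H H).symm (p ⊗ₜ t) = insl p t :=
  ext_tmul (F := (TensorProduct.assoc k P H H).symm.toLinearMap ∘ₗ TensorProduct.mk k P _ p)
    (G := insl p) (fun _ _ => rfl) t

theorem Δg_tmul (p : P) (h : H) : Q.Δg P (p ⊗ₜ h) = insl p (Q.Δ h * Q.fInv) := by
  rw [← assoc_symm_tmul]; rfl

instance : Intw (Q.Δg P) (la P) (Q.cv (onl H (la P)) (la (P ⊗[k] H))) where
  intw a t := by
    refine ext_tmul (F := Q.Δg P ∘ₗ la P a)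
      (G := Q.cv (onl H (la P)) (la (P ⊗[k] H)) a ∘ₗ Q.Δg P) (fun p h => ?_) t
    rw [LinearMap.comp_apply, LinearMap.comp_apply, Δg_tmul,
      ← Intw.intw (F := insl p) (i := Q.cv (onl H (lm k H)) (la H)), ← ll_Δ]
    simp [Δg_tmul, mul_assoc]

/-- The purpose of the twist: by Δ(S(a))f⁻¹ = f⁻¹(S(a₂) ⊗ S(a₁)), right multiplication by S(a) is
split over the two factors in opposite order. -/
instance : Intw (Q.Δg P) (Q.ra P) (Q.cv (Q.ra (P ⊗[k] H)) (onl H (Q.ra P))) where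
  intw a t := by
    refine ext_tmul (F := Q.Δg P ∘ₗ Q.ra P a)
      (G := Q.cv (Q.ra (P ⊗[k] H)) (onl H (Q.ra P)) a ∘ₗ Q.Δg P) (fun p h => ?_) t
    rw [LinearMap.comp_apply, LinearMap.comp_apply, Δg_tmul,
      ← Intw.intw (F := insl p) (i := Q.cv (Q.ra H) (onl H Q.rs)), ← rr_SΔ]
    simp [Δg_tmul, mul_assoc, ΔS_mul_fInv]

/-- Insertion of `δ`. -/
def insδ (P : Type*) [AddCommGroup P] [Module k P] : P →ₗ[k] (P ⊗[k] H) ⊗[k] H :=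
  Q.Δg P ∘ₗ Q.ins P

theorem insδ_apply (p : P) : Q.insδ P p = insl p Q.δ := by
  rw [← Q.Δβ_mul_fInv, ← Δg_tmul]; rfl

instance : Intw (Q.insδ P) (Q.tr P) (Q.cv (Q.cv (onl H (la P)) (la (P ⊗[k] H)))
    (Q.cv (Q.ra (P ⊗[k] H)) (onl H (Q.ra P)))) :=
  Intw.comp (i' := Q.es P) inferInstance inferInstance

/-- One pentagon changes the bracketing of δ; the factor through the invariant second β disappears.
-/
theorem insδ_eq (p : P) : Q.insδ P p = Q.asi (onl H (la P)) (la (P ⊗[k] H))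
    (Q.cv (Q.ra (P ⊗[k] H)) (onl H (Q.ra P))) (Q.as (la (P ⊗[k] H)) (Q.ra (P ⊗[k] H))
      (onl H (Q.ra P)) (Q.ins _ (Q.ins P p))) := by
  have e : Q.ins _ (Q.ins P p) = insl p (Q.β ⊗ₜ[k] Q.β) := rfl
  rw [insδ_apply, δ_eq, Q.intw_as (insl p) _ _ _ (Q.cv (onl H (la P)) (la (P ⊗[k] H)))
    (Q.ra (P ⊗[k] H)) (onl H (Q.ra P)), Q.intw_asi (insl p) _ _ _ (onl H (la P)) (la (P ⊗[k] H))
    (Q.ra (P ⊗[k] H)), pentagon_as_asi, ← e, Q.inv_as2 (Q.ins (P ⊗[k] H))]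

/-- The twisted insertion appearing in the explicit form of the coaction. -/
def twΔ (v : H →ₗ[k] Module.End k P) : (P ⊗[k] H) ⊗[k] H →ₗ[k] P ⊗[k] H :=
  (Q.kap hS v).rTensor H ∘ₗ Q.asi (onl H (onl H v)) (onl H (la P)) (la (P ⊗[k] H)) ∘ₗ
    Q.asi (onl H (onl H v)) (Q.cv (onl H (la P)) (la (P ⊗[k] H)))
      (Q.cv (Q.ra (P ⊗[k] H)) (onl H (Q.ra P)))

theorem twΔ_apply (v : H →ₗ[k] Module.End k P) (u : (P ⊗[k] H) ⊗[k] H) : Q.twΔ hS v u =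
  (Q.kap hS v).rTensor H (Q.asi (onl H (onl H v)) (onl H (la P)) (la (P ⊗[k] H))
    (Q.asi (onl H (onl H v)) (Q.cv (onl H (la P)) (la (P ⊗[k] H)))
      (Q.cv (Q.ra (P ⊗[k] H)) (onl H (Q.ra P))) u)) := rfl

instance intw_kap_rTensor (v : H →ₗ[k] Module.End k P) [Rep v] : Intw ((Q.kap hS v).rTensor H)
    (Q.cv (onl H (onl H v)) (onl H (la P))) (Q.tr (P ⊗[k] H)) := by
  rw [← onl_cv, ← onl_tr]; infer_instance

/-- The explicit formula at β: by the form `insδ_eq` of δ, the evaluation meets the first inserted β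
in the zigzag `R_ins`, and the second β survives. -/
theorem twΔ_insδ (v : H →ₗ[k] Module.End k P) [Rep v] (p : P) :
    Q.twΔ hS v (Q.insδ P p) = Q.as (la P) (Q.ra P) (onl H v) (Q.ins P p) := by
  have e : (Q.kap hS v).rTensor H (Q.ins (P ⊗[k] H) (Q.asi (onl H v) (la P) (Q.ra P)
      (Q.ins P p))) = Q.ins P (Q.R hS v (Q.ins P p)) := rfl
  have h : Intw (Q.ins (P ⊗[k] H)) (Q.ra P) (Q.cv (Q.es (P ⊗[k] H)) (onl H (Q.ra P))) := by
    have : Intw (Q.ins (P ⊗[k] H)) (Q.cv (Q.tr _) (Q.ra P))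
      (Q.cv (Q.es (P ⊗[k] H)) (onl H (Q.ra P))) := inferInstance
    rwa [tr_cv] at this
  rw [insδ_eq, twΔ_apply, pentagon_inv, Q.kill_asi1,
    ← Q.intw_asi (Q.as (la (P ⊗[k] H)) (Q.ra (P ⊗[k] H)) (onl H (Q.ra P))) (onl H (onl H v))
      (onl H (la P)) (Q.cv (Q.es (P ⊗[k] H)) (onl H (Q.ra P))),
    Q.intw_as ((Q.kap hS v).rTensor H) _ _ _ (la P) (Q.ra P) (onl H v),
    ← Q.intw_asi (Q.ins (P ⊗[k] H)) (onl H v) (la P) (Q.ra P), e, R_ins]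

/-- Write an element as β times itself. Then it enters both sides only through `R`, which is
natural, and agreement on the inserted β is `twΔ_insδ`. -/
theorem cc_eq (v : H →ₗ[k] Module.End k P) [Rep v] (u : P ⊗[k] H) :
    Q.cc hS v u = Q.asi (la P) (Q.ra P) (onl H v) (Q.twΔ hS v (Q.Δg P u)) := by
  have e1 : Q.Δg P u = Q.R hS (Q.cv (Q.ra (P ⊗[k] H)) (onl H (Q.ra P)))
      (Q.as (Q.cv (onl H (onl H (la P))) (onl H (la (P ⊗[k] H)))) (Q.cv (onl H (Q.ra (P ⊗[k] H)))
        (onl H (onl H (Q.ra P)))) (Q.es _) ((Q.insδ P).rTensor H u)) := by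
    conv_lhs => rw [← Q.mu_ins_left hS u]
    have j2 : Intw ((Q.Δg P).rTensor H) (onl H (la P)) (Q.cv (onl H (onl H (la P))) (onl H (la
      (P ⊗[k] H)))) := by
      rw [← onl_cv]; infer_instance
    have j4 : Intw ((Q.Δg P).rTensor H) (onl H (Q.ra P)) (Q.cv (onl H (Q.ra (P ⊗[k] H))) (onl H
      (onl H (Q.ra P)))) := by
      rw [← onl_cv]; infer_instance
    rw [mu_apply, Q.R_natural hS (Q.Δg P) (Q.ra P) (Q.cv (Q.ra (P ⊗[k] H)) (onl H (Q.ra P))),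
      Q.intw_as ((Q.Δg P).rTensor H) _ _ _ (Q.cv (onl H (onl H (la P))) (onl H (la (P ⊗[k] H))))
        (Q.cv (onl H (Q.ra (P ⊗[k] H))) (onl H (onl H (Q.ra P)))) (Q.es _),
      ← LinearMap.comp_apply (LinearMap.rTensor _ _), ← LinearMap.rTensor_comp]
    rfl
  have e2 : Q.as (onl H (la P)) (onl H (Q.ra P)) (onl H (onl H v)) ((Q.ins P).rTensor H u) =
      ((Q.kap hS v).rTensor H).rTensor H (Q.asi (onl H (onl H (onl H v))) (onl H (onl H (la P)))
        (onl H (la (P ⊗[k] H))) (Q.asi (onl H (onl H (onl H v))) (Q.cv (onl H (onl H (la P)))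
          (onl H (la (P ⊗[k] H))))
        (Q.cv (onl H (Q.ra (P ⊗[k] H))) (onl H (onl H (Q.ra P)))) ((Q.insδ P).rTensor H u))) := by
    rw [← onl_cv, ← onl_cv, onl_as, onl_asi, onl_asi]
    simp only [← LinearMap.comp_apply, ← LinearMap.rTensor_comp]
    exact rTensor_congr_apply (fun p => (Q.twΔ_insδ hS v p).symm) u
  have j3 : Intw (Q.R hS (Q.cv (Q.ra (P ⊗[k] H)) (onl H (Q.ra P)))) (Q.cv (onl H (onl H (la P)))
    (onl H (la (P ⊗[k] H))))
      (Q.cv (onl H (la P)) (la (P ⊗[k] H))) := inferInstance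
  have j4 : Intw (Q.R hS (Q.cv (Q.ra (P ⊗[k] H)) (onl H (Q.ra P)))) (Q.cv (Q.cv (onl H (Q.ra
    (P ⊗[k] H))) (onl H (onl H (Q.ra P)))) (Q.es _))
      (Q.cv (Q.ra (P ⊗[k] H)) (onl H (Q.ra P))) := inferInstance
  have j5 : Intw ((Q.kap hS v).rTensor H) (Q.cv (Q.ra (P ⊗[k] H)) (onl H (Q.ra P)))
      (Q.cv (Q.ra P) (onl H v)) := inferInstance
  have j6 : Intw ((Q.insδ P).rTensor H) (Q.tr _) (Q.cv (Q.cv (onl H (onl H (la P))) (onl H (la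
    (P ⊗[k] H)))) (Q.cv (onl H (Q.ra (P ⊗[k] H))) (onl H (onl H (Q.ra P))))) := by
    rw [← onl_cv, ← onl_cv, ← onl_cv, ← onl_tr]; infer_instance
  have j7 : Intw (((Q.kap hS v).rTensor H).rTensor H) (Q.cv (Q.cv (onl H (onl H (onl H v))) (onl H
    (onl H (la P)))) (onl H (la (P ⊗[k] H)))) (onl H (la P)) := by
    have : Intw (((Q.kap hS v).rTensor H).rTensor H) (Q.cv (onl H (onl H (onl H v))) (onl H (onl H
      (la P)))) (Q.tr _) := by
      rw [← onl_cv, ← onl_tr]; infer_instance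
    have : Intw (((Q.kap hS v).rTensor H).rTensor H) (Q.cv (Q.cv (onl H (onl H (onl H v))) (onl H
      (onl H (la P)))) (onl H (la (P ⊗[k] H))))
      (Q.cv (Q.tr _) (onl H (la P))) := inferInstance
    rwa [tr_cv] at this
  have j8 : Intw (((Q.kap hS v).rTensor H).rTensor H) (Q.cv (onl H (Q.ra (P ⊗[k] H))) (onl H
    (onl H (Q.ra P))))
      (Q.cv (onl H (Q.ra P)) (onl H (onl H v))) := inferInstance
  rw [cc_apply, e2, twΔ_apply, e1,
    ← Q.intw_asi (Q.R hS (Q.cv (Q.ra (P ⊗[k] H)) (onl H (Q.ra P)))) (onl H (onl H (onl H v)))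
      (Q.cv (onl H (onl H (la P))) (onl H (la (P ⊗[k] H))))
      (Q.cv (Q.cv (onl H (Q.ra (P ⊗[k] H))) (onl H (onl H (Q.ra P)))) (Q.es _)), pentagon_asi_as,
    Q.inv_asi2 ((Q.insδ P).rTensor H) (onl H (onl H (onl H v)))
      (Q.cv (Q.cv (onl H (onl H (la P))) (onl H (la (P ⊗[k] H))))
        (Q.cv (onl H (Q.ra (P ⊗[k] H))) (onl H (onl H (Q.ra P))))) (Q.es _) u,
    ← Q.intw_asi (Q.R hS (Q.cv (Q.ra (P ⊗[k] H)) (onl H (Q.ra P)))) (onl H (onl H (onl H v)))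
      (onl H (onl H (la P))) (onl H (la (P ⊗[k] H))),
    Q.intw_as (Q.asi (onl H (onl H (onl H v))) (onl H (onl H (la P))) (onl H (la
      (P ⊗[k] H)))) _ _ _ (Q.cv (Q.cv (onl H (onl H (onl H v))) (onl H (onl H (la P)))) (onl H (la
        (P ⊗[k] H)))) (Q.cv (onl H (Q.ra (P ⊗[k] H))) (onl H (onl H (Q.ra P)))) (Q.es _),
    Q.R_natural hS ((Q.kap hS v).rTensor H) _ (Q.cv (Q.ra P) (onl H v)),
    Q.intw_as (((Q.kap hS v).rTensor H).rTensor H)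
      (Q.cv (Q.cv (onl H (onl H (onl H v))) (onl H (onl H (la P)))) (onl H (la (P ⊗[k] H))))
      (Q.cv (onl H (Q.ra (P ⊗[k] H))) (onl H (onl H (Q.ra P)))) (Q.es _) (onl H (la P))
      (Q.cv (onl H (Q.ra P)) (onl H (onl H v))) (Q.es _)]

end QuasiHopfAlgebra

section SweedlerSums

variable {k A B C D M : Type*} [Field k]
  [AddCommMonoid A] [Module k A] [AddCommMonoid B] [Module k B] [AddCommMonoid C] [Module k C]
  [AddCommMonoid D] [Module k D] [AddCommMonoid M]

theorem sw_comm (T : A ⊗[k] B) (T' : C ⊗[k] D) (F : A → B → C → D → M) :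
    (sw T fun a b => sw T' fun c d => F a b c d) = sw T' fun c d => sw T fun a b => F a b c d :=
  Finset.sum_comm

theorem sw_congr (T : A ⊗[k] B) {F G : A → B → M} (h : ∀ a b, F a b = G a b) : sw T F = sw T G := by
  congr 1; funext a b; exact h a b

theorem sw3_congr (T : A ⊗[k] (B ⊗[k] C)) {F G : A → B → C → M}
    (h : ∀ a b c, F a b c = G a b c) : sw3 T F = sw3 T G := by
  congr 1; funext a b c; exact h a b c

end SweedlerSums

section SweedlerMaps

variable {k A B C D P P' : Type*} [Field k]
  [AddCommGroup A] [Module k A] [AddCommGroup B] [Module k B] [AddCommGroup C] [Module k C]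
  [AddCommGroup D] [Module k D]
  [AddCommGroup P] [Module k P] [AddCommGroup P'] [Module k P']

theorem sw_mul_apply {R R' : Type*} [Ring R] [Algebra k R] [Ring R'] [Algebra k R']
    (L : R ⊗[k] R' →ₗ[k] P) (S T : R ⊗[k] R') :
    (sw S fun a b => sw T fun c d => L ((a * c) ⊗ₜ (b * d))) = L (S * T) := by
  rw [← LinearMap.mulLeft_apply (R := k) S, ← LinearMap.comp_apply,
    ← sw_apply (L ∘ₗ LinearMap.mulLeft k S) T, sw_comm]
  refine sw_congr _ fun c d => ?_
  rw [LinearMap.comp_apply, LinearMap.mulLeft_apply, ← LinearMap.mulRight_apply (R := k),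
    ← LinearMap.comp_apply, ← sw_apply (L ∘ₗ LinearMap.mulRight k _) S]
  exact sw_congr _ fun a b => by simp

end SweedlerMaps

/-! ### The coaction as the braiding with the regular representation. -/

namespace QuasiHopfAlgebra

variable {k H : Type*} [Field k] [Ring H] [Algebra k H] (Q : QuasiHopfAlgebra k H)
  (hS : Function.Bijective Q.S)

theorem sw_qL_apply {M : Type*} [AddCommGroup M] [Module k M] (L : H ⊗[k] H →ₗ[k] M) :
    (sw Q.qL fun a b => L (a ⊗ₜ b)) =
      sw3 Q.Φinv fun x1 x2 x3 => L ((Q.S x1 * Q.α * x2) ⊗ₜ x3) := by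
  rw [sw_apply, qL, map_sw3]

/-- The explicit form of the coaction is the braiding with the regular representation. -/
theorem coaction_eq (h : H) : Q.coaction hS h =
    (TensorProduct.comm k H H).toLinearMap (Q.cc hS (lm k H) (1 ⊗ₜ h)) := by
  rw [coaction, IsLinearMap.mk'_apply, cc_eq, Δg_tmul, twΔ_apply, Q.asi_apply_sw (la H), map_sw3,
    Q.asi_apply_sw _ (Q.cv (onl H (la H)) (la (H ⊗[k] H)))]
  refine sw3_congr _ fun x1 x2 x3 => ?_
  simp only [map_sw3]
  refine sw3_congr _ fun y1 y2 y3 => ?_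
  set W := Q.Δ h * Q.fInv with hW
  have eW : insl (k := k) (1 : H) W = sw W fun a b => (1 ⊗ₜ[k] a) ⊗ₜ[k] b :=
    (sw_apply (insl (k := k) (1 : H)) W).symm
  rw [Q.cv_apply_sw (onl H (la H)), eW, Q.cv_apply_sw (Q.ra (H ⊗[k] H))]
  simp only [map_sw]
  -- The sums over Δ(h) and f⁻¹ merge into one sum over the product Δ(h)f⁻¹, the element that `Δg`
  -- inserts.
  have e1 : ∀ r1 r2 y21 y22 y31 y32 : H, (sw (Q.Δ h) fun h1 h2 => sw Q.fInv fun g1 g2 =>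
      (x1 * r2 * y22 * h2 * g2 * Q.S (x2 * y31)) ⊗ₜ[k]
          (x3 * y32 * Q.Sinv hS (r1 * y21 * h1 * g1) * y1)) = sw W fun a b =>
      (x1 * r2 * y22 * b * Q.S (x2 * y31)) ⊗ₜ[k] (x3 * y32 * Q.Sinv hS (r1 * y21 * a) * y1) := by
    intro r1 r2 y21 y22 y31 y32
    let L : H ⊗[k] H →ₗ[k] H ⊗[k] H := (TensorProduct.comm k H H).toLinearMap ∘ₗ
      TensorProduct.map (LinearMap.mulLeft k (x3 * y32) ∘ₗ LinearMap.mulRight k y1 ∘ₗ Q.Sinv hS ∘ₗ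
        LinearMap.mulLeft k (r1 * y21))
        (LinearMap.mulLeft k (x1 * r2 * y22) ∘ₗ LinearMap.mulRight k (Q.S (x2 * y31)))
    have h1 := sw_mul_apply L (Q.Δ h) Q.fInv
    rw [← sw_apply L] at h1
    simpa only [L, LinearMap.comp_apply, TensorProduct.map_tmul, LinearMap.mulLeft_apply,
      LinearMap.mulRight_apply, LinearEquiv.coe_coe, TensorProduct.comm_tmul, mul_assoc] using h1
  have e2 : ∀ a b y21 y22 y31 y32 : H, (sw Q.qL fun r1 r2 =>
      (x1 * r2 * y22 * b * Q.S (x2 * y31)) ⊗ₜ[k] (x3 * y32 * Q.Sinv hS (r1 * y21 * a) * y1)) =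
      sw3 Q.Φinv fun z1 z2 z3 => (x1 * z3 * y22 * b * Q.S (x2 * y31)) ⊗ₜ[k]
        (x3 * y32 * Q.Sinv hS (Q.S z1 * Q.α * z2 * y21 * a) * y1) := by
    intro a b y21 y22 y31 y32
    let L : H ⊗[k] H →ₗ[k] H ⊗[k] H := (TensorProduct.comm k H H).toLinearMap ∘ₗ
      TensorProduct.map (LinearMap.mulLeft k (x3 * y32) ∘ₗ LinearMap.mulRight k y1 ∘ₗ Q.Sinv hS ∘ₗ
        LinearMap.mulRight k (y21 * a))
        (LinearMap.mulLeft k x1 ∘ₗ LinearMap.mulRight k (y22 * b * Q.S (x2 * y31)))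
    have h1 := Q.sw_qL_apply L
    simpa only [L, LinearMap.comp_apply, TensorProduct.map_tmul, LinearMap.mulLeft_apply,
      LinearMap.mulRight_apply, LinearEquiv.coe_coe, TensorProduct.comm_tmul, mul_assoc] using h1
  simp only [sw_comm Q.fInv, e1]
  simp only [sw_comm Q.qL, e2]
  simp only [Q.asi_apply_sw]
  refine sw_congr _ fun y21 y22 => sw_congr _ fun y31 y32 => sw_congr _ fun a b => ?_
  simp only [map_sw3]
  refine sw3_congr _ fun z1 z2 z3 => ?_
  simp only [onl_tmul, onr_tmul, lm_apply, rs_apply, LinearMap.rTensor_tmul, kap_tmul,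
    LinearEquiv.coe_coe, TensorProduct.comm_tmul, mul_one, Q.S_mul, Sinv_mul, Sinv_S, mul_assoc]

end QuasiHopfAlgebra
-- H₀ as an algebra in the Yetter-Drinfeld category.
namespace QuasiHopfAlgebra

variable {k H P P' P'' : Type*} [Field k] [Ring H] [Algebra k H] (Q : QuasiHopfAlgebra k H)
  [AddCommGroup P] [Module k P] [AddCommGroup P'] [Module k P'] [AddCommGroup P''] [Module k P'']
  (hS : Function.Bijective Q.S)

theorem bilin_apply {A B M : Type*} [AddCommMonoid A] [Module k A] [AddCommMonoid B] [Module k B]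
    [AddCommMonoid M] [Module k M] (F : A → B → M) (h1 : ∀ b, IsLinearMap k fun a => F a b)
    (h2 : ∀ a, IsLinearMap k fun b => F a b) (a : A) (b : B) : bilin F h1 h2 a b = F a b := rfl

theorem adj_apply (h h' : H) :
    Q.adj h h' = sw (Q.Δ h) fun h1 h2 => h1 * h' * Q.S h2 := rfl

theorem circ_apply (h h' : H) : Q.circ h h' =
    sw3 Q.Φ fun X1 X2 X3 => sw3 Q.Φinv fun x1 x2 x3 => sw (Q.Δ X3) fun X31 X32 =>
      X1 * h * Q.S (x1 * X2) * Q.α * x2 * X31 * h' * Q.S (x3 * X32) := rfl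

theorem adj_eq : Q.adj = Q.cv (lm k H) Q.rs := by
  ext h a
  rw [adj_apply, cv_apply_sw]
  simp [mul_assoc]

theorem es_eq : Q.es P = onr P Q.adj := by
  rw [adj_eq, onr_cv]

theorem es'_eq : Q.es' P = onl H (onr P Q.adj) := by
  rw [adj_eq, onr_cv, onl_cv]

instance : Rep Q.adj := by rw [adj_eq]; infer_instance

/-- A vector p of a representation is the image of 1 under the intertwiner h ↦ v(h)p from the
regular one, so the coaction determines every braiding. -/
theorem cc_tmul (v : H →ₗ[k] Module.End k P) [Rep v] (p : P) (h : H) :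
    Q.cc hS v (p ⊗ₜ h) = sw (Q.coaction hS h) fun h0 h1 => v h1 p ⊗ₜ[k] h0 := by
  let F : H →ₗ[k] P := v.flip p
  have hF : Intw F (lm k H) v := ⟨fun a u => by simp [F, Rep.mul]⟩
  have e : p ⊗ₜ[k] h = F.rTensor H (1 ⊗ₜ[k] h) := by simp [F, Rep.one_apply]
  rw [e, ← Q.cc_natural hS F (lm k H) v]
  have := sw_apply (F.rTensor H ∘ₗ (TensorProduct.comm k H H).toLinearMap) (Q.coaction hS h)
  rw [coaction_eq] at this ⊢
  have c : ∀ t : H ⊗[k] H, (TensorProduct.comm k H H).toLinearMap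
      ((TensorProduct.comm k H H).toLinearMap t) = t := fun t => by simp
  rw [LinearMap.comp_apply, c] at this
  exact this.symm

theorem mu_tmul (p : P) (a b : H) : Q.mu hS P ((p ⊗ₜ a) ⊗ₜ b) = p ⊗ₜ Q.circ a b := by
  rw [mu_apply, as_apply_sw, map_sw3, circ_apply]
  change _ = TensorProduct.mk k P H p _
  rw [map_sw3]
  refine sw3_congr _ fun X1 X2 X3 => ?_
  rw [R_apply, asi_apply_sw, map_sw3, map_sw3]
  refine sw3_congr _ fun x1 x2 x3 => ?_
  rw [cv_apply_sw, map_sw, map_sw, map_sw, map_sw, map_sw, map_sw, map_sw]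
  refine sw_congr _ fun X31 X32 => ?_
  simp only [onl_tmul, onr_tmul, lm_apply, rs_apply, kap_tmul, TensorProduct.mk_apply, Q.S_mul,
    S_Sinv, mul_assoc]

theorem sw_tmul {A B M N : Type*} [AddCommGroup A] [Module k A] [AddCommGroup B] [Module k B]
    [AddCommGroup M] [Module k M] [AddCommGroup N] [Module k N] (T : A ⊗[k] B) (F : A → B → M)
    (n : N) : sw T F ⊗ₜ[k] n = sw T fun a b => F a b ⊗ₜ[k] n :=
  map_sw ((TensorProduct.mk k M N).flip n) T F

theorem one_tmul_inj {M : Type*} [AddCommGroup M] [Module k M] {a b : M}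
    (h : (1 : k) ⊗ₜ[k] a = (1 : k) ⊗ₜ[k] b) : a = b := by
  simpa using congrArg (TensorProduct.lid k M) h

theorem mu_insl (p : P) (t : H ⊗[k] H) :
    Q.mu hS P (insl p t) = p ⊗ₜ TensorProduct.lift Q.circ t :=
  ext_tmul (F := Q.mu hS P ∘ₗ insl p) (G := TensorProduct.mk k P H p ∘ₗ TensorProduct.lift Q.circ)
    (fun a b => by simp [mu_tmul]) t

theorem cc_one_tmul (h : H) : Q.cc hS (lm k H) (1 ⊗ₜ h) =
    (TensorProduct.comm k H H).toLinearMap (Q.coaction hS h) := by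
  rw [coaction_eq]
  simp

theorem comm_inj {s t : H ⊗[k] H} (h : (TensorProduct.comm k H H).toLinearMap s =
    (TensorProduct.comm k H H).toLinearMap t) : s = t := (TensorProduct.comm k H H).injective h

theorem coaction_β : Q.coaction hS Q.β = Q.β ⊗ₜ 1 := by
  have := Q.cc_ins hS (lm k H) 1
  rw [ins_apply] at this
  rw [coaction_eq, this]
  simp

theorem adj_β (h : H) : Q.adj h Q.β = Q.ε h • Q.β := by
  rw [adj_apply, Q.antipode_right]

theorem coaction_counit (m : H) : sw (Q.coaction hS m) (fun m0 m1 => Q.ε m1 • m0) = m := by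
  have := Q.cc_tr hS ((1 : k) ⊗ₜ m)
  rw [cc_tmul] at this
  have := congrArg (TensorProduct.lid k H).toLinearMap this
  rw [map_sw] at this
  simpa using this

theorem coaction_compat (h m : H) :
    (sw (Q.Δ h) fun h1 h2 => sw (Q.coaction hS m) fun m0 m1 => Q.adj h1 m0 ⊗ₜ[k] (h2 * m1))
    = (sw (Q.Δ h) fun h1 h2 => sw (Q.coaction hS (Q.adj h2 m)) fun n0 n1 => n0 ⊗ₜ[k] (n1 * h1)) := by
  have := Intw.intw (F := Q.cc hS (lm k H)) (i := Q.cv (onl H (lm k H)) (Q.es H))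
    (i' := Q.cv (Q.es H) (onl H (lm k H))) h (1 ⊗ₜ[k] m)
  have := congrArg (TensorProduct.comm k H H).toLinearMap this
  simp only [cv_apply_sw, es_eq, map_sw, onl_tmul, onr_tmul, cc_tmul] at this
  rw [sw_comm]
  simpa using this.symm

/-- The hexagon `cc_cc` for two regular representations, evaluated at 1 ⊗ 1. -/
theorem coaction_coassoc (m : H) :
    (sw3 Q.Φinv fun x1 x2 x3 => sw (Q.coaction hS m) fun m0 m1 =>
      sw (Q.coaction hS (Q.adj x2 m0)) fun n0 n1 => n0 ⊗ₜ[k] ((n1 * x1) ⊗ₜ[k] (x3 * m1)))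
    = (sw3 Q.Φinv fun x1 x2 x3 => sw3 Q.Φinv fun y1 y2 y3 =>
      sw (Q.coaction hS (Q.adj y3 m)) fun n0 n1 => sw (Q.Δ n1) fun n11 n12 =>
      Q.adj x1 n0 ⊗ₜ[k] ((x2 * n11 * y1) ⊗ₜ[k] (x3 * n12 * y2))) := by
  have := Q.cc_cc hS (onl H (lm k H)) (la H) (((1 : H) ⊗ₜ[k] (1 : H)) ⊗ₜ m)
  have := congrArg (TensorProduct.comm k (H ⊗[k] H) H).toLinearMap this
  simp only [es_eq] at this
  rw [asi_apply_sw, asi_apply_sw, map_sw3, map_sw3, map_sw3] at this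
  refine Eq.trans ?_ (this.trans ?_)
  · refine sw3_congr _ fun x1 x2 x3 => ?_
    simp only [cc_tmul, map_sw]
    refine sw_congr _ fun m0 m1 => ?_
    simp only [cc_tmul, map_sw, onl_tmul, onr_tmul]
    refine sw_congr _ fun n0 n1 => ?_
    simp
  · refine sw3_congr _ fun x1 x2 x3 => ?_
    rw [asi_apply_sw, map_sw3, map_sw3, map_sw3, map_sw3, map_sw3]
    refine sw3_congr _ fun y1 y2 y3 => ?_
    simp only [cc_tmul, map_sw, onl_tmul, onr_tmul]
    refine sw_congr _ fun n0 n1 => ?_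
    have := map_sw ((TensorProduct.comm k (H ⊗[k] H) H).toLinearMap ∘ₗ onr _ Q.adj x1 ∘ₗ
      onl H (onl H (lm k H)) x2 ∘ₗ onl H (la H) x3 ∘ₗ (TensorProduct.mk k (H ⊗[k] H) H).flip n0)
      (Q.Δ n1) (fun a b => (a * y1) ⊗ₜ[k] (b * y2))
    simp only [LinearMap.comp_apply, cv_apply_sw] at this ⊢
    simp [mul_assoc] at this ⊢
    exact this

theorem yetterDrinfeld : Q.IsYetterDrinfeld Q.adj (Q.coaction hS) where
  one_act := Rep.one_apply _
  mul_act := Rep.mul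
  counit := Q.coaction_counit hS
  coassoc := Q.coaction_coassoc hS
  compat := Q.coaction_compat hS

theorem tensorAct_eq {M N : Type*} [AddCommGroup M] [Module k M] [AddCommGroup N] [Module k N]
    (actM : H →ₗ[k] M →ₗ[k] M) (actN : H →ₗ[k] N →ₗ[k] N) (h : H) (t : M ⊗[k] N) :
    Q.tensorAct actM actN h t = Q.cv (onl N actM) (onr M actN) h t := by
  rw [tensorAct, bilin_apply, ← sw_apply]
  refine sw_congr _ fun m n => ?_
  rw [cv_apply_sw]
  simp

theorem circ_adj (hS : Function.Bijective Q.S) (h : H) (t : H ⊗[k] H) : TensorProduct.lift Q.circ (Q.tensorAct Q.adj Q.adj h t) =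
    Q.adj h (TensorProduct.lift Q.circ t) := by
  apply one_tmul_inj (k := k)
  have := Intw.intw (F := Q.mu hS k) (i := Q.cv (Q.es' k) (Q.es (k ⊗[k] H))) (i' := Q.es k) h
    (insl 1 t)
  simp only [es_eq, es'_eq, mu_insl, onr_tmul] at this
  rw [← this, tensorAct_eq, ← mu_insl Q hS,
    Intw.intw (F := insl (k := k) (1 : k)) (i' := Q.cv (onl H (onr k Q.adj)) (onr (k ⊗[k] H) Q.adj))]

theorem tensorCoact_tmul {M N : Type*} [AddCommGroup M] [Module k M] [AddCommGroup N] [Module k N]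
    (actM : H →ₗ[k] M →ₗ[k] M) (ρM : M →ₗ[k] M ⊗[k] H) (actN : H →ₗ[k] N →ₗ[k] N)
    (ρN : N →ₗ[k] N ⊗[k] H) (m : M) (n : N) : Q.tensorCoact actM ρM actN ρN (m ⊗ₜ n) =
    sw3 Q.Φinv fun x1 x2 x3 => sw3 Q.Φ fun X1 X2 X3 => sw3 Q.Φinv fun y1 y2 y3 =>
      sw (ρM (actM y2 m)) fun m0 m1 => sw (ρN (actN (X3 * y3) n)) fun n0 n1 =>
        (actM (x1 * X1) m0 ⊗ₜ[k] actN x2 n0) ⊗ₜ[k] (x3 * n1 * X2 * m1 * y1) := rfl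

/-- This is `cc_mu` for the regular representation at 1; its reassociators are exactly those of the
coaction on a tensor product. -/
theorem coaction_circ (a b : H) : Q.coaction hS (Q.circ a b) = (TensorProduct.lift Q.circ).rTensor H
    (Q.tensorCoact Q.adj (Q.coaction hS) Q.adj (Q.coaction hS) (a ⊗ₜ b)) := by
  have := Q.cc_mu hS (lm k H) ((1 ⊗ₜ a) ⊗ₜ b)
  rw [mu_tmul, cc_one_tmul] at this
  apply comm_inj
  rw [this, tensorCoact_tmul]
  simp only [es_eq, es'_eq]
  rw [asi_apply_sw, map_sw3, map_sw3, map_sw3]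
  refine sw3_congr _ fun x1 x2 x3 => ?_
  rw [as_apply_sw]
  simp only [map_sw3]
  refine sw3_congr _ fun X1 X2 X3 => ?_
  rw [asi_apply_sw]
  simp only [map_sw3]
  refine sw3_congr _ fun y1 y2 y3 => ?_
  simp only [onl_tmul, onr_tmul, LinearMap.rTensor_tmul, cc_tmul, sw_tmul, map_sw]
  refine sw_congr _ fun m0 m1 => ?_
  rw [← Rep.mul (i := Q.adj)]
  refine sw_congr _ fun n0 n1 => ?_
  rw [mu_tmul, ← Rep.mul (i := Q.adj)]
  simp [mul_assoc]

theorem tmul_circ_assoc (hS : Function.Bijective Q.S) (p : P) (a b c : H) :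
    p ⊗ₜ[k] Q.circ (Q.circ a b) c =
    p ⊗ₜ[k] sw3 Q.Φ fun X1 X2 X3 => Q.circ (Q.adj X1 a) (Q.circ (Q.adj X2 b) (Q.adj X3 c)) := by
  have := Q.mu_assoc hS (((p ⊗ₜ[k] a) ⊗ₜ b) ⊗ₜ c)
  let L : ((P ⊗[k] H) ⊗[k] H) ⊗[k] H →ₗ[k] P ⊗[k] H := Q.mu hS P ∘ₗ Q.mu hS (P ⊗[k] H)
  rw [LinearMap.rTensor_tmul, mu_tmul, mu_tmul, as_apply_sw] at this
  have e := map_sw3 L Q.Φ fun X1 X2 X3 => onl H (Q.es' P) X1 (Q.es' (P ⊗[k] H) X2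
    (Q.es ((P ⊗[k] H) ⊗[k] H) X3 (((p ⊗ₜ[k] a) ⊗ₜ b) ⊗ₜ c)))
  refine this.trans (e.trans ?_)
  change _ = TensorProduct.mk k P H p _
  rw [map_sw3]
  refine sw3_congr _ fun X1 X2 X3 => ?_
  simp only [es_eq, es'_eq, onl_tmul, onr_tmul, L, LinearMap.comp_apply, mu_tmul,
    TensorProduct.mk_apply]

theorem circ_assoc (hS : Function.Bijective Q.S) (a b c : H) : Q.circ (Q.circ a b) c =
    sw3 Q.Φ fun X1 X2 X3 => Q.circ (Q.adj X1 a) (Q.circ (Q.adj X2 b) (Q.adj X3 c)) :=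
  one_tmul_inj (k := k) (Q.tmul_circ_assoc hS 1 a b c)

theorem β_circ (hS : Function.Bijective Q.S) (a : H) : Q.circ Q.β a = a := by
  apply one_tmul_inj (k := k)
  rw [← Q.mu_tmul hS]
  exact Q.mu_ins_left hS (1 ⊗ₜ a)

theorem circ_β (hS : Function.Bijective Q.S) (a : H) : Q.circ a Q.β = a := by
  apply one_tmul_inj (k := k)
  rw [← Q.mu_tmul hS]
  exact Q.mu_ins_right hS (1 ⊗ₜ a)

/-- `H₀` is an algebra in the category of left-right Yetter-Drinfeld modules. -/
theorem isYDAlgebra : Q.IsYDAlgebra Q.adj (Q.coaction hS) Q.circ Q.β where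
  yetterDrinfeld := Q.yetterDrinfeld hS
  mul_hom :=
    { map_act := Q.circ_adj hS
      map_coact := ext_tmul (F := Q.coaction hS ∘ₗ TensorProduct.lift Q.circ)
        (G := (TensorProduct.lift Q.circ).rTensor H ∘ₗ
          Q.tensorCoact Q.adj (Q.coaction hS) Q.adj (Q.coaction hS)) (Q.coaction_circ hS) }
  one_hom :=
    { map_act := fun h c => by simp [unitAct, adj_β, smul_smul, mul_comm]
      map_coact := fun c => by simp [unitCoact, coaction_β, TensorProduct.smul_tmul'] }
  mul_assoc := Q.circ_assoc hS
  one_mul := Q.β_circ hS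
  mul_one := Q.circ_β hS

end QuasiHopfAlgebra
-- The elements p_R and q_R as operators.
namespace QuasiHopfAlgebra

variable {k H W W' : Type*} [Field k] [Ring H] [Algebra k H] (Q : QuasiHopfAlgebra k H)
  [AddCommGroup W] [Module k W] [AddCommGroup W'] [Module k W']
  (hS : Function.Bijective Q.S)

/-- Insertion of `1` as a last tensor factor. -/
def ist (k H W : Type*) [Field k] [Ring H] [Algebra k H] [AddCommGroup W] [Module k W] :
    W →ₗ[k] W ⊗[k] H := (TensorProduct.mk k W H).flip 1

@[simp]
theorem ist_apply (u : W) : ist k H W u = u ⊗ₜ 1 := rfl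

instance (i : H →ₗ[k] Module.End k W) : Intw (ist k H W) i (onl H i) where
  intw a u := by simp

/-- The element `q_R` acting through two families of operators: `u ↦ e(q¹) v(q²) u`. -/
def qq (e v : H →ₗ[k] Module.End k W) : W →ₗ[k] W :=
  Q.kap hS v ∘ₗ Q.as (onl H e) (onl H v) (la W) ∘ₗ ist k H W

theorem qq_apply (e v : H →ₗ[k] Module.End k W) (u : W) : Q.qq hS e v u =
    Q.kap hS v (Q.as (onl H e) (onl H v) (la W) (ist k H W u)) := rfl

theorem qq_apply_sw (e v : H →ₗ[k] Module.End k W) [Rep v] [Cm e v] (u : W) :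
    Q.qq hS e v u = sw (Q.qR hS) fun q1 q2 => e q1 (v q2 u) := by
  have h := sw_apply (LinearMap.applyₗ u ∘ₗ ac e v) (Q.qR hS)
  rw [qR, map_sw3] at h
  simp only [LinearMap.comp_apply, LinearMap.applyₗ_apply_apply, ac_tmul] at h
  rw [qR, h, qq_apply, as_apply_sw, map_sw3]
  refine sw3_congr _ fun X1 X2 X3 => ?_
  simp [Rep.mul, Cm.comm (i := e) (j := v)]

theorem qq_natural (F : W →ₗ[k] W') (e v : H →ₗ[k] Module.End k W)
    (e' v' : H →ₗ[k] Module.End k W') [Intw F e e'] [Intw F v v'] (u : W) :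
    F (Q.qq hS e v u) = Q.qq hS e' v' (F u) := by
  rw [qq_apply, Q.kap_natural hS F v v', Q.intw_as (F.rTensor H) _ _ _ (onl H e') (onl H v') (la W')]
  rfl

/-- `qq` keeps X³ in an extra factor of H, initially 1, until the final evaluation; multiplying by
S⁻¹(b) amounts to storing b there at the start. -/
theorem Sinv_qq (e v : H →ₗ[k] Module.End k W) [Rep v] (b : H) (u : W) :
    v (Q.Sinv hS b) (Q.qq hS e v u) =
      Q.kap hS v (Q.as (onl H e) (onl H v) (la W) (u ⊗ₜ b)) := by
  have : u ⊗ₜ[k] b = Q.ra W (Q.Sinv hS b) (ist k H W u) := by simp [S_Sinv]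
  rw [this, Intw.intw (F := Q.as _ _ _) (i' := Q.ra W), Intw.intw (F := Q.kap hS v) (i' := v),
    qq_apply]

/-- This is (h ⊗ 1)q_R = (1 ⊗ S⁻¹(h₂))q_RΔ(h₁): the action on `e` is completed by one on `v` and the
stored factor, which the evaluation ignores, and Φ is linear. -/
theorem act_qq (e v : H →ₗ[k] Module.End k W) [Rep e] [Rep v] [Cm e v] (h : H) (u : W) :
    e h (Q.qq hS e v u) =
      sw (Q.Δ h) fun h1 h2 => v (Q.Sinv hS h2) (Q.qq hS e v (Q.cv e v h1 u)) := by
  have h1 := Intw.intw (F := Q.kap hS v) (i := Q.cv (onl H e) (Q.cv (onl H v) (la W)))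
    (i' := Q.cv e (Q.tr W)) h (Q.as (onl H e) (onl H v) (la W) (ist k H W u))
  rw [cv_tr, ← as_cv, cv_apply_sw, map_sw, map_sw] at h1
  rw [qq_apply, ← h1]
  refine sw_congr _ fun a b => ?_
  rw [Sinv_qq, Cm.comm (i := Q.cv (onl H e) (onl H v)) (j := la W), ← onl_cv]
  rw [← Intw.intw (F := ist k H W) (i := Q.cv e v)]
  simp

/-- p_R undoes q_R: after a pentagon, β from p_R and α from q_R meet in the zigzag `R_ins`. -/
theorem pR_qq (e v : H →ₗ[k] Module.End k W) [Rep e] [Rep v] [Cm e v] (u : W) :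
    (sw Q.pR fun p1 p2 => v (Q.Sinv hS p2) (Q.qq hS e v (Q.cv e v p1 u))) = u := by
  have h := sw_apply (Q.kap hS v ∘ₗ Q.as (onl H e) (onl H v) (la W) ∘ₗ
    ((Q.cv e v).flip u).rTensor H) Q.pR
  conv at h => rhs; rw [pR, map_sw3]
  simp only [Sinv_qq]
  refine h.trans (Eq.trans ?_ ((Q.kill_asi2 (Q.kap hS v) (onl H e) (Q.cv (onl H v) (la W)) (Q.ra W)
    (Q.asi (onl H v) (la W) (Q.ra W) (Q.as (onl H e) (onl H v) (Q.es W) (Q.ins W u)))).trans ?_))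
  · rw [← pentagon_as_asi', asi_apply_sw, map_sw3, map_sw3]
    refine sw3_congr _ fun x1 x2 x3 => ?_
    rw [← onl_cv]
    simp [mul_assoc]
  · rw [Q.inv_as3]
    exact Q.R_ins hS v u

/-- Expresses (Δ ⊗ id)(q_R)Φ⁻¹ through q_R, by a pentagon one of whose factors the evaluation
deletes. It handles q_R on a product of two elements of H₀. -/
theorem qq_as (e₁ e₂ v : H →ₗ[k] Module.End k W) [Rep e₁] [Rep e₂] [Rep v] [Cm e₁ e₂] [Cm e₁ v]
    [Cm e₂ v] [Cm e₂ e₁] [Cm v e₁] (u : W) :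
    (sw3 Q.Φ fun X1 X2 X3 => e₁ X1 (v (Q.Sinv hS X3) (Q.qq hS e₂ v (Q.cv e₂ v X2 u)))) =
      Q.qq hS (Q.cv e₁ e₂) v (Q.asi e₁ e₂ v u) := by
  rw [qq_apply, Q.intw_asi (ist k H W) _ _ _ (onl H e₁) (onl H e₂) (onl H v), onl_cv,
    pentagon_as_asi, Q.kill_asi3, as_apply_sw _ _ (Q.cv (onl H e₂) (onl H v)), map_sw3, map_sw3]
  refine sw3_congr _ fun X1 X2 X3 => ?_
  rw [Sinv_qq, ← onl_cv, ← Intw.intw (F := Q.kap hS v) (i := onl H e₁),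
    ← Intw.intw (F := Q.as (onl H e₂) (onl H v) (la W)) (i := onl H e₁)]
  simp

theorem qq_tr (e : H →ₗ[k] Module.End k W) [Rep e] (u : W) :
    Q.qq hS e (Q.tr W) u = Q.ε (Q.Sinv hS Q.α) • u := by
  rw [qq_apply, onl_tr, as_tr_mid]
  simp

theorem qq_inv (G : W' →ₗ[k] W) (e v : H →ₗ[k] Module.End k W) [Rep v] [Cm e v]
    [Intw G (Q.tr W') e] (u : W') : Q.qq hS e v (G u) = v (Q.Sinv hS Q.α) (G u) := by
  have := intw_comp G (ist k H W) (Q.tr W') e (onl H e)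
  rw [qq_apply, ← LinearMap.comp_apply (ist k H W), Q.inv_as1]
  simp

end QuasiHopfAlgebra
-- Two successive operators q_R with postponed evaluations.
namespace QuasiHopfAlgebra

variable {k H W W' : Type*} [Field k] [Ring H] [Algebra k H] (Q : QuasiHopfAlgebra k H)
  [AddCommGroup W] [Module k W] [AddCommGroup W'] [Module k W']
  (hS : Function.Bijective Q.S)

section Storage

variable (e v w : H →ₗ[k] Module.End k W) [Rep e] [Rep v] [Rep w] [Cm e v] [Cm v e] [Cm e w]
  [Cm w e] [Cm v w] [Cm w v]

/-- Evaluation of two stored elements. -/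
def kk (v w : H →ₗ[k] Module.End k W) : (W ⊗[k] H) ⊗[k] H →ₗ[k] W :=
  Q.kap hS v ∘ₗ Q.kap hS (onl H w)

theorem kk_tmul (u : W) (a b : H) : Q.kk hS v w ((u ⊗ₜ a) ⊗ₜ b) =
    v (Q.Sinv hS (Q.α * a)) (w (Q.Sinv hS (Q.α * b)) u) := rfl

/-- A coherence identity below the two evaluations: one pentagon, and deletion of the reassociator
whose last slot the inner evaluation trivializes. -/
theorem word_identity (t : (W ⊗[k] H) ⊗[k] H) :
    Q.kk hS v w (Q.as (onl H (onl H e)) (onl H (onl H v)) (onl H (la W))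
      (Q.as (Q.cv (onl H (onl H e)) (onl H (onl H v))) (onl H (onl H w)) (la (W ⊗[k] H))
        (Q.asi (onl H (onl H e)) (onl H (onl H v)) (onl H (onl H w)) t))) =
    Q.kk hS v w (Q.as (onl H (onl H v)) (onl H (onl H w)) (la (W ⊗[k] H))
      (Q.as (onl H (onl H e)) (Q.cv (Q.cv (onl H (onl H v)) (onl H (onl H w))) (la (W ⊗[k] H)))
        (onl H (la W)) (Q.as (onl H (onl H e)) (Q.cv (onl H (onl H v)) (onl H (onl H w)))
          (la (W ⊗[k] H)) t))) := by
  have i1 : Intw (Q.kap hS (onl H w)) (Q.cv (onl H (onl H v))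
      (Q.cv (onl H (onl H w)) (la (W ⊗[k] H)))) (onl H v) := by
    have : Intw (Q.kap hS (onl H w)) (Q.cv (onl H (onl H v))
      (Q.cv (onl H (onl H w)) (la (W ⊗[k] H)))) (Q.cv (onl H v) (Q.tr _)) := inferInstance
    rwa [cv_tr] at this
  simp only [kk, LinearMap.comp_apply]
  rw [pentagon_as_asi, Q.intw_as (Q.kap hS (onl H w)) _ _ _ (onl H e) (onl H v) (la W),
    Q.kill_asi3,
    Q.intw_as (Q.as (onl H (onl H v)) (onl H (onl H w)) (la (W ⊗[k] H))) (onl H (onl H e))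
      (Q.cv (Q.cv (onl H (onl H v)) (onl H (onl H w))) (la (W ⊗[k] H))) (onl H (la W))
      (onl H (onl H e)) (Q.cv (onl H (onl H v)) (Q.cv (onl H (onl H w)) (la (W ⊗[k] H))))
      (onl H (la W)),
    Q.intw_as (Q.kap hS (onl H w)) (onl H (onl H e))
      (Q.cv (onl H (onl H v)) (Q.cv (onl H (onl H w)) (la (W ⊗[k] H))))
      (onl H (la W)) (onl H e) (onl H v) (la W)]

/-- The maps `cv`, `cw`, `cvw` stand for the braidings of v, w and v ⊗ w. Postponing both
evaluations lets the two braidings meet, and the hexagon `hc` merges them. -/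
theorem qq_qq (cv cw cvw : W →ₗ[k] W) [Intw cv (Q.cv v e) (Q.cv e v)] [Intw cv w w]
    [Intw cw (Q.cv w e) (Q.cv e w)] [Intw cw v v]
    (hc : ∀ u, cv (Q.asi v e w (cw u)) = Q.asi e v w (cvw (Q.asi v w e u))) (u : W) :
    Q.qq hS e v (cv (Q.qq hS e w (cw u))) =
    Q.kk hS v w (Q.as (onl H (onl H v)) (onl H (onl H w)) (la (W ⊗[k] H))
      (Q.as (onl H (onl H e)) (Q.cv (Q.cv (onl H (onl H v)) (onl H (onl H w))) (la (W ⊗[k] H)))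
        (onl H (la W)) (Q.as (onl H (onl H e)) (Q.cv (onl H (onl H v)) (onl H (onl H w)))
          (la (W ⊗[k] H)) ((cvw.rTensor H).rTensor H (Q.asi (onl H (onl H v)) (onl H (onl H w))
          (onl H (onl H e)) (Q.asi (onl H (onl H v)) (Q.cv (onl H (onl H w)) (onl H (onl H e)))
            (la (W ⊗[k] H)) (ist k H _ (ist k H W u)))))))) := by
  have l : ∀ (c : W →ₗ[k] W) (x y z : H →ₗ[k] Module.End k W), Intw c (Q.cv x y) z →
      Intw ((c.rTensor H).rTensor H) (Q.cv (onl H (onl H x)) (onl H (onl H y)))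
        (onl H (onl H z)) := by
    intro c x y z h
    rw [← onl_cv, ← onl_cv]; infer_instance
  have l1 := l cv v e (Q.cv e v) inferInstance
  have l2 := l cw w e (Q.cv e w) inferInstance
  simp only [onl_cv] at l1 l2
  have h1 : Q.qq hS e v (cv (Q.qq hS e w (cw u))) = Q.kk hS v w
      (Q.as (onl H (onl H e)) (onl H (onl H v)) (onl H (la W)) ((cv.rTensor H).rTensor H
        (Q.as (onl H (onl H e)) (onl H (onl H w)) (la (W ⊗[k] H))
          ((cw.rTensor H).rTensor H (ist k H _ (ist k H W u)))))) := by
    have n : ∀ (c : W →ₗ[k] W) y, ist k H W (c y) = c.rTensor H (ist k H W y) := fun c y => rfl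
    have n' : ist k H (W ⊗[k] H) (ist k H W (cw u)) =
      (cw.rTensor H).rTensor H (ist k H _ (ist k H W u)) := rfl
    have n2 : (ist k H W).rTensor H (ist k H W (cw u)) = ist k H _ (ist k H W (cw u)) := rfl
    rw [qq_apply, qq_apply, n, Q.kap_natural hS (ist k H W) w (onl H w),
      Q.kap_natural hS (cv.rTensor H) (onl H w) (onl H w),
      ← Q.intw_as (Q.kap hS (onl H w)) (onl H (onl H e)) (onl H (onl H v)) (onl H (la W)),
      Q.intw_as ((ist k H W).rTensor H) _ _ _ (onl H (onl H e)) (onl H (onl H w))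
        (la (W ⊗[k] H)), n2, n']
    rfl
  -- The reassociator between the braidings is expanded by a pentagon so that the hexagon applies;
  -- the outermost new factor is deleted in `h4` by the evaluations.
  have h2 : ∀ t, Q.as (onl H (onl H e)) (onl H (onl H w)) (la (W ⊗[k] H)) t =
      Q.as (onl H (onl H v)) (onl H (onl H e)) (Q.cv (onl H (onl H w)) (la (W ⊗[k] H)))
        (Q.as (Q.cv (onl H (onl H v)) (onl H (onl H e))) (onl H (onl H w)) (la (W ⊗[k] H))
          (Q.asi (onl H (onl H v)) (onl H (onl H e)) (onl H (onl H w))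
            (Q.asi (onl H (onl H v)) (Q.cv (onl H (onl H e)) (onl H (onl H w)))
              (la (W ⊗[k] H)) t))) := by
    intro t
    rw [← pentagon, as_asi, as_asi]
  have h3 : ∀ t, (cv.rTensor H).rTensor H (Q.asi (onl H (onl H v)) (onl H (onl H e))
      (onl H (onl H w)) ((cw.rTensor H).rTensor H t)) = Q.asi (onl H (onl H e)) (onl H (onl H v))
      (onl H (onl H w)) ((cvw.rTensor H).rTensor H
        (Q.asi (onl H (onl H v)) (onl H (onl H w)) (onl H (onl H e)) t)) := by
    intro t
    have o : ∀ x y z : H →ₗ[k] Module.End k W, Q.asi (onl H (onl H x)) (onl H (onl H y))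
        (onl H (onl H z)) = ((Q.asi x y z).rTensor H).rTensor H := by
      intro x y z
      rw [← show Q.asi (onl H x) (onl H y) (onl H z) = (Q.asi x y z).rTensor H from
        LinearMap.ext (Q.onl_asi x y z)]
      exact LinearMap.ext (Q.onl_asi _ _ _)
    have hc' : cv ∘ₗ Q.asi v e w ∘ₗ cw = Q.asi e v w ∘ₗ cvw ∘ₗ Q.asi v w e := LinearMap.ext hc
    simp only [o, ← LinearMap.comp_apply, ← LinearMap.rTensor_comp]
    rw [hc']
  have k1 : Intw (Q.kk hS v w) (Q.cv (onl H (onl H w)) (la (W ⊗[k] H))) (Q.tr W) :=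
    intw_comp _ _ _ (Q.tr _) _
  have k2 := intw_comp ((cv.rTensor H).rTensor H)
    (Q.as (onl H (onl H e)) (onl H (onl H v)) (onl H (la W)))
    (Q.cv (onl H (onl H w)) (la (W ⊗[k] H))) (Q.cv (onl H (onl H w)) (la (W ⊗[k] H)))
    (Q.cv (onl H (onl H w)) (la (W ⊗[k] H)))
  have k3 := k1.comp k2
  have h4 := Q.kill_as3 (Q.kk hS v w ∘ₗ (Q.as (onl H (onl H e)) (onl H (onl H v)) (onl H (la W)) ∘ₗ
    (cv.rTensor H).rTensor H)) (onl H (onl H v)) (onl H (onl H e))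
    (Q.cv (onl H (onl H w)) (la (W ⊗[k] H)))
  simp only [LinearMap.comp_apply] at h4
  rw [h1, h2, h4, Q.intw_as ((cv.rTensor H).rTensor H) _ _ _
      (Q.cv (onl H (onl H e)) (onl H (onl H v))) (onl H (onl H w)) (la (W ⊗[k] H)),
    ← Q.intw_asi ((cw.rTensor H).rTensor H) (onl H (onl H v))
      (Q.cv (onl H (onl H w)) (onl H (onl H e))) (la (W ⊗[k] H)) _ _ _, h3, word_identity]

end Storage

end QuasiHopfAlgebra

section Sweedler

variable {k A B C D E P : Type*} [Field k]
  [AddCommMonoid A] [Module k A] [AddCommMonoid B] [Module k B] [AddCommMonoid C] [Module k C]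
  [AddCommMonoid D] [Module k D] [AddCommMonoid E] [Module k E] [AddCommMonoid P] [Module k P]

theorem sw3_sw_comm (T : A ⊗[k] (B ⊗[k] C)) (T' : D ⊗[k] E) (F : A → B → C → D → E → P) :
    (sw3 T fun a b c => sw T' fun d e => F a b c d e) =
      sw T' fun d e => sw3 T fun a b c => F a b c d e := by
  rw [sw3, show (sw T' fun d e => sw3 T fun a b c => F a b c d e) = _ from sw_comm T' T _]
  exact sw_congr _ fun a t => sw_comm _ _ _

theorem sw3_comm {B' : Type*} [AddCommMonoid B'] [Module k B'] (T : A ⊗[k] (B ⊗[k] C))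
    (T' : D ⊗[k] (E ⊗[k] B')) (F : A → B → C → D → E → B' → P) :
    (sw3 T fun a b c => sw3 T' fun d e g => F a b c d e g) =
      sw3 T' fun d e g => sw3 T fun a b c => F a b c d e g :=
  (sw3_sw_comm T T' fun a b c d t => sw t fun e g => F a b c d e g).trans
    (sw_congr _ fun d t => sw3_sw_comm T t fun a b c e g => F a b c d e g)

theorem sw5_apply (L : A ⊗[k] (B ⊗[k] (C ⊗[k] (D ⊗[k] E))) →ₗ[k] P)
    (T : A ⊗[k] (B ⊗[k] (C ⊗[k] (D ⊗[k] E)))) :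
    sw5 T (fun a b c d e => L (a ⊗ₜ (b ⊗ₜ (c ⊗ₜ (d ⊗ₜ e))))) = L T := by
  rw [← sw_apply L T, sw5]
  congr 1; funext a t
  exact sw4_apply (L ∘ₗ TensorProduct.mk k A (B ⊗[k] (C ⊗[k] (D ⊗[k] E))) a) t

end Sweedler

/-! ### The element Ω from the composition of two operators q_R. -/

namespace QuasiHopfAlgebra

variable {k H W W' : Type*} [Field k] [Ring H] [Algebra k H] (Q : QuasiHopfAlgebra k H)
  [AddCommGroup W] [Module k W] [AddCommGroup W'] [Module k W']
  (hS : Function.Bijective Q.S)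

section Storage

variable (e v w : H →ₗ[k] Module.End k W) [Rep e] [Rep v] [Rep w] [Cm e v] [Cm v e] [Cm e w]
  [Cm w e] [Cm v w] [Cm w v]

/-- The operators `s ⊗ t ↦ w(S⁻¹(s b₁)) v(S⁻¹(t b₂))`. -/
def tw (v w : H →ₗ[k] Module.End k W) (b₁ b₂ : H) : H ⊗[k] H →ₗ[k] Module.End k W :=
  ac (w ∘ₗ Q.Sinv hS ∘ₗ LinearMap.mulRight k b₁) (v ∘ₗ Q.Sinv hS ∘ₗ LinearMap.mulRight k b₂)

theorem tw_tmul (b₁ b₂ s t : H) (u : W) : Q.tw hS v w b₁ b₂ (s ⊗ₜ t) u =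
    w (Q.Sinv hS (s * b₁)) (v (Q.Sinv hS (t * b₂)) u) := by
  simp [tw]

theorem tw_mul_tmul (b₁ b₂ c₁ c₂ : H) (t : H ⊗[k] H) :
    Q.tw hS v w (c₁ * b₁) (c₂ * b₂) t = Q.tw hS v w b₁ b₂ (t * c₁ ⊗ₜ c₂) := by
  refine ext_tmul (F := Q.tw hS v w (c₁ * b₁) (c₂ * b₂))
    (G := Q.tw hS v w b₁ b₂ ∘ₗ LinearMap.mulRight k (c₁ ⊗ₜ c₂)) (fun s t => ?_) t
  ext u
  simp [tw_tmul, mul_assoc]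

theorem tw_SΔ_mul (b₁ b₂ a : H) (t : H ⊗[k] H) (u : W) :
    Q.tw hS v w b₁ b₂ (Q.SΔ a * t) u = Q.tw hS v w b₁ b₂ t (Q.cv v w a u) := by
  refine ext_tmul (F := LinearMap.applyₗ u ∘ₗ Q.tw hS v w b₁ b₂ ∘ₗ LinearMap.mulLeft k (Q.SΔ a))
    (G := LinearMap.applyₗ (Q.cv v w a u) ∘ₗ Q.tw hS v w b₁ b₂) (fun p q => ?_) t
  simp only [LinearMap.comp_apply, LinearMap.applyₗ_apply_apply, LinearMap.mulLeft_apply]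
  rw [← LinearMap.mulRight_apply (R := k), ← LinearMap.comp_apply, SΔ_apply, map_sw,
    ← LinearMap.applyₗ_apply_apply (R := k), map_sw, tw_tmul, cv_apply_sw, map_sw, map_sw]
  refine sw_congr _ fun a1 a2 => ?_
  simp [tw_tmul, Sinv_mul, Sinv_S, Rep.mul, mul_assoc, Cm.comm (i := w) (j := v)]

/-- The two reassociators are those of A, so evaluating both stored factors with α produces γ. -/
theorem kk_as_asi (u : W) (c₁ c₂ : H) :
    Q.kk hS v w (Q.as (onl H (onl H v)) (onl H (onl H w)) (la (W ⊗[k] H))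
      (Q.asi (Q.cv (onl H (onl H v)) (onl H (onl H w))) (la (W ⊗[k] H)) (onl H (la W))
        ((u ⊗ₜ c₂) ⊗ₜ c₁))) = Q.tw hS v w c₁ c₂ Q.γ u := by
  rw [← ac_tA]
  have h := sw4_apply (Q.kk hS v w ∘ₗ LinearMap.applyₗ ((u ⊗ₜ c₂) ⊗ₜ c₁) ∘ₗ
    ac (onl H (onl H v)) (ac (onl H (onl H w)) (ac (la (W ⊗[k] H)) (onl H (la W))))) Q.tA
  refine h.symm.trans ?_
  rw [← LinearMap.applyₗ_apply_apply (R := k) u (Q.tw hS v w c₁ c₂ Q.γ), ← LinearMap.comp_apply, γ,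
    map_sw4]
  congr 1; funext A1 A2 A3 A4
  simp [tw_tmul, kk_tmul, Sinv_mul, Sinv_S, Rep.mul, mul_assoc, Cm.comm (i := w) (j := v)]

theorem kk_as_asi_as (u : W) (b₁ b₂ : H) :
    Q.kk hS v w (Q.as (onl H (onl H v)) (onl H (onl H w)) (la (W ⊗[k] H))
      (Q.asi (Q.cv (onl H (onl H v)) (onl H (onl H w))) (la (W ⊗[k] H)) (onl H (la W))
        (Q.as (onl H (onl H e)) (Q.cv (onl H (onl H v)) (onl H (onl H w)))
          (Q.cv (la (W ⊗[k] H)) (onl H (la W))) ((u ⊗ₜ b₂) ⊗ₜ b₁)))) =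
    sw Q.f fun f1 f2 => v (Q.Sinv hS (f2 * b₂)) (w (Q.Sinv hS (f1 * b₁))
      (Q.qq hS e (Q.cv v w) u)) := by
  have h := sw_apply (LinearMap.applyₗ (Q.qq hS e (Q.cv v w) u) ∘ₗ Q.tw hS v w b₁ b₂) Q.f
  simp only [LinearMap.comp_apply, LinearMap.applyₗ_apply_apply, tw_tmul] at h
  simp only [Cm.comm (i := v) (j := w)]
  rw [h, Q.as_apply_sw (onl H (onl H e)), map_sw3, map_sw3, map_sw3, qq_apply, as_apply_sw, map_sw3, map_sw3]
  refine sw3_congr _ fun Z1 Z2 Z3 => ?_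
  have h1 := sw_apply (Q.kk hS v w ∘ₗ (Q.as (onl H (onl H v)) (onl H (onl H w)) (la (W ⊗[k] H))) ∘ₗ
    (Q.asi (Q.cv (onl H (onl H v)) (onl H (onl H w))) (la (W ⊗[k] H)) (onl H (la W))) ∘ₗ
    onl H (onl H e) Z1 ∘ₗ Q.cv (onl H (onl H v)) (onl H (onl H w)) Z2 ∘ₗ
    LinearMap.applyₗ ((u ⊗ₜ b₂) ⊗ₜ b₁) ∘ₗ ac (la (W ⊗[k] H)) (onl H (la W))) (Q.Δ Z3)
  simp only [LinearMap.comp_apply, LinearMap.applyₗ_apply_apply] at h1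
  rw [Q.cv_apply (la (W ⊗[k] H)), ← h1]
  have h2 : Q.tw hS v w b₁ b₂ Q.f (Q.kap hS (Q.cv v w) ((onl H e Z1)
      (onl H (Q.cv v w) Z2 (la W Z3 (ist k H W u))))) =
      Q.tw hS v w b₁ b₂ (Q.γ * Q.Δ Z3) (e Z1 (Q.cv v w Z2 u)) := by
    -- The passage from γ to f: γΔ(Z³) = fΔ(αZ³). Writing αZ³ = S(a), the relation for f moves a
    -- through as the action of v ⊗ w, leaving the evaluation of q_R on v ⊗ w.
    rw [← f_mul_Δα, mul_assoc, ← map_mul, ← Q.S_Sinv hS (Q.α * Z3), ← SΔ_mul_f, tw_SΔ_mul]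
    simp
  rw [h2]
  have h3 := sw_apply (LinearMap.applyₗ (e Z1 (Q.cv v w Z2 u)) ∘ₗ Q.tw hS v w b₁ b₂ ∘ₗ
    LinearMap.mulLeft k Q.γ) (Q.Δ Z3)
  simp only [LinearMap.comp_apply, LinearMap.applyₗ_apply_apply, LinearMap.mulLeft_apply] at h3
  rw [← h3]
  refine sw_congr _ fun a b => ?_
  rw [← tw_mul_tmul, ← kk_as_asi]
  simp only [← onl_cv]
  simp

/-- The composition of two operators `q_R`, expressed through `Ω`. -/
theorem qq_qq_Ω (cv cw cvw : W →ₗ[k] W) [Intw cv (Q.cv v e) (Q.cv e v)] [Intw cv w w]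
    [Intw cw (Q.cv w e) (Q.cv e w)] [Intw cw v v]
    [Intw cvw (Q.cv (Q.cv v w) e) (Q.cv e (Q.cv v w))]
    (hc : ∀ u, cv (Q.asi v e w (cw u)) = Q.asi e v w (cvw (Q.asi v w e u))) (u : W) :
    Q.qq hS e v (cv (Q.qq hS e w (cw u))) =
      sw5 (Q.Ω hS) fun Ω1 Ω2 Ω3 Ω4 Ω5 => v Ω5 (w Ω4 (Q.qq hS e (Q.cv v w)
        (cvw (v Ω1 (w Ω2 (e Ω3 u)))))) := by
  have hΩ := sw5_apply (LinearMap.applyₗ u ∘ₗ LinearMap.applyₗ (Q.qq hS e (Q.cv v w) ∘ₗ cvw) ∘ₗ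
    ac ((LinearMap.mul k (Module.End k W)).flip ∘ₗ v) (ac ((LinearMap.mul k (Module.End k W)).flip ∘ₗ w)
    (ac ((LinearMap.mul k (Module.End k W)).flip ∘ₗ e) (ac (LinearMap.mul k (Module.End k W) ∘ₗ w)
    (LinearMap.mul k (Module.End k W) ∘ₗ v))))) (Q.Ω hS)
  have h1 : ∀ t, Q.as (onl H (onl H e)) (Q.cv (Q.cv (onl H (onl H v)) (onl H (onl H w)))
      (la (W ⊗[k] H))) (onl H (la W)) (Q.as (onl H (onl H e)) (Q.cv (onl H (onl H v))
      (onl H (onl H w))) (la (W ⊗[k] H)) t) = Q.asi (Q.cv (onl H (onl H v)) (onl H (onl H w)))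
      (la (W ⊗[k] H)) (onl H (la W)) (Q.as (onl H (onl H e)) (Q.cv (onl H (onl H v)) (onl H (onl H w)))
      (Q.cv (la (W ⊗[k] H)) (onl H (la W))) (Q.as (Q.cv (onl H (onl H e)) (Q.cv (onl H (onl H v))
      (onl H (onl H w)))) (la (W ⊗[k] H)) (onl H (la W)) t)) := by
    intro t
    rw [← pentagon, asi_as]
  have h2 : ∀ y b, Q.as (Q.cv (onl H (onl H e)) (Q.cv (onl H (onl H v))
      (onl H (onl H w)))) (la (W ⊗[k] H)) (onl H (la W)) ((y ⊗ₜ[k] 1) ⊗ₜ[k] b) =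
      sw3 Q.Φ fun X1 X2 X3 => (Q.cv e (Q.cv v w) X1 y ⊗ₜ[k] X3) ⊗ₜ[k] (X2 * b) := by
    intro y b
    rw [as_apply_sw, ← onl_cv, ← onl_cv, ← onl_cv, ← onl_cv]
    refine sw3_congr _ fun X1 X2 X3 => ?_
    simp
  have h3 : (cvw.rTensor H).rTensor H (Q.asi (onl H (onl H v)) (onl H (onl H w))
          (onl H (onl H e)) (Q.asi (onl H (onl H v)) (Q.cv (onl H (onl H w)) (onl H (onl H e)))
            (la (W ⊗[k] H)) (ist k H _ (ist k H W u)))) = sw3 Q.Φinv fun x1 x2 x3 =>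
      (cvw (Q.asi v w e (v x1 (Q.cv w e x2 u))) ⊗ₜ[k] 1) ⊗ₜ[k] x3 := by
    rw [Q.asi_apply_sw (onl H (onl H v)) (Q.cv (onl H (onl H w)) (onl H (onl H e))), map_sw3, map_sw3,
      ← onl_cv]
    simp only [Q.onl_asi]
    refine sw3_congr _ fun X1 X2 X3 => ?_
    simp only [ist_apply, la, onl_tmul, onr_tmul, lm_apply, LinearMap.rTensor_tmul, mul_one]
    rw [← onl_cv, Q.onl_asi]
    simp
  rw [Q.qq_qq hS e v w cv cw cvw hc, h1, h3]
  simp only [map_sw3, h2, kk_as_asi_as]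
  refine Eq.trans ?_ (hΩ.symm.trans ?_)
  · simp only [LinearMap.comp_apply, LinearMap.applyₗ_apply_apply, Ω, map_sw3, map_sw]
    rw [sw3_comm]
    refine sw3_congr _ fun X1 X2 X3 => ?_
    rw [sw3_comm]
    refine sw3_congr _ fun x1 x2 x3 => ?_
    rw [sw3_sw_comm]
    refine sw_congr _ fun f1 f2 => ?_
    -- X¹ is moved inside the merged braiding by linearity; it becomes the iterated coproduct of X¹
    -- in the first three legs of Ω.
    rw [← Intw.intw (F := cvw) (i := Q.cv (Q.cv v w) e), cv_apply_sw, sw3_sw_comm]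
    simp only [map_sw]
    refine sw_congr _ fun X11 X12 => ?_
    rw [cv_apply_sw, sw3_sw_comm]
    simp only [map_sw]
    refine sw_congr _ fun X111 X112 => ?_
    rw [asi_apply_sw]
    simp only [map_sw3]
    refine sw3_congr _ fun y1 y2 y3 => ?_
    rw [cv_apply_sw]
    simp only [map_sw]
    refine sw_congr _ fun x21 x22 => ?_
    simp [Rep.mul, mul_assoc, Cm.comm (i := v) (j := w), Cm.comm (i := e) (j := w),
      Cm.comm (i := e) (j := v)]
  · congr 1; funext Ω1 Ω2 Ω3 Ω4 Ω5
    simp [Cm.comm (i := v) (j := w), Cm.comm (i := e) (j := w), Cm.comm (i := e) (j := v)]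

end Storage

end QuasiHopfAlgebra

section Sweedler

variable {k A B C D E P P' : Type*} [Field k]
  [AddCommMonoid A] [Module k A] [AddCommMonoid B] [Module k B] [AddCommMonoid C] [Module k C]
  [AddCommMonoid D] [Module k D] [AddCommMonoid E] [Module k E] [AddCommMonoid P] [Module k P]
  [AddCommMonoid P'] [Module k P']

theorem map_sw5 (F : P →ₗ[k] P') (T : A ⊗[k] (B ⊗[k] (C ⊗[k] (D ⊗[k] E))))
    (G : A → B → C → D → E → P) : F (sw5 T G) = sw5 T fun a b c d e => F (G a b c d e) := by
  rw [sw5, map_sw]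
  exact sw_congr _ fun a t => map_sw4 _ _ _

theorem sw5_congr (T : A ⊗[k] (B ⊗[k] (C ⊗[k] (D ⊗[k] E)))) {F G : A → B → C → D → E → P}
    (h : ∀ a b c d e, F a b c d e = G a b c d e) : sw5 T F = sw5 T G := by
  congr 1; funext a b c d e; exact h a b c d e

theorem sw5_sw_comm {C' D' : Type*} [AddCommMonoid C'] [Module k C'] [AddCommMonoid D'] [Module k D']
    (T : A ⊗[k] (B ⊗[k] (C ⊗[k] (D ⊗[k] E)))) (T' : C' ⊗[k] D')
    (F : A → B → C → D → E → C' → D' → P) :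
    (sw5 T fun a b c d e => sw T' fun x y => F a b c d e x y) =
      sw T' fun x y => sw5 T fun a b c d e => F a b c d e x y := by
  refine Eq.trans (sw_congr _ fun a t => ?_) (sw_comm T T' _)
  refine Eq.trans (sw_congr _ fun b t => ?_) (sw_comm t T' _)
  exact sw3_sw_comm t T' _

end Sweedler

theorem sw_pure {k A B P : Type*} [Field k] [AddCommMonoid A] [Module k A] [AddCommMonoid B]
    [Module k B] [AddCommMonoid P] [Module k P] {F : A → B → P} (h1 : ∀ b, IsLinearMap k fun a => F a b)
    (h2 : ∀ a, IsLinearMap k fun b => F a b) (a : A) (b : B) : sw (a ⊗ₜ[k] b) F = F a b :=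
  sw_eq_lift (bilin F h1 h2) (a ⊗ₜ b)

/-! ### The map θ: the braiding followed by q_R. -/

namespace QuasiHopfAlgebra

variable {k H P P' : Type*} [Field k] [Ring H] [Algebra k H] (Q : QuasiHopfAlgebra k H)
  [AddCommGroup P] [Module k P] [AddCommGroup P'] [Module k P']
  (hS : Function.Bijective Q.S)

section Theta

variable (v w : H →ₗ[k] Module.End k P) [Rep v] [Rep w] [Cm v w] [Cm w v]

/-- The braiding of `H₀` with `v`, followed by the action of `q_R`. -/
def th (v : H →ₗ[k] Module.End k P) : P ⊗[k] H →ₗ[k] P ⊗[k] H :=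
  Q.qq hS (Q.es P) (onl H v) ∘ₗ Q.cc hS v

theorem th_apply (v : H →ₗ[k] Module.End k P) (u : P ⊗[k] H) :
    Q.th hS v u = Q.qq hS (Q.es P) (onl H v) (Q.cc hS v u) := rfl

theorem th_natural (F : P →ₗ[k] P') (v : H →ₗ[k] Module.End k P) (v' : H →ₗ[k] Module.End k P')
    [Intw F v v'] (u : P ⊗[k] H) : F.rTensor H (Q.th hS v u) = Q.th hS v' (F.rTensor H u) := by
  rw [th_apply, th_apply, Q.qq_natural hS (F.rTensor H) _ _ (Q.es P') (onl H v'),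
    Q.cc_natural hS F v v']

theorem act_th (h : H) (u : P ⊗[k] H) : Q.es P h (Q.th hS v u) = sw (Q.Δ h) fun h1 h2 =>
    onl H v (Q.Sinv hS h2) (Q.th hS v (Q.cv (onl H v) (Q.es P) h1 u)) := by
  rw [th_apply, act_qq]
  refine sw_congr _ fun h1 h2 => ?_
  rw [th_apply, Intw.intw (F := Q.cc hS v) (i' := Q.cv (Q.es P) (onl H v))]

/-- Here `qq_qq_Ω` is applied to actual braidings, with the hexagon `cc_cc` as its hypothesis. -/
theorem th_th (u : P ⊗[k] H) : Q.th hS v (Q.th hS w u) =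
    sw5 (Q.Ω hS) fun Ω1 Ω2 Ω3 Ω4 Ω5 => onl H v Ω5 (onl H w Ω4 (Q.th hS (Q.cv v w)
      (onl H v Ω1 (onl H w Ω2 (Q.es P Ω3 u))))) := by
  have : Intw (Q.cc hS (Q.cv v w)) (Q.cv (Q.cv (onl H v) (onl H w)) (Q.es P))
      (Q.cv (Q.es P) (Q.cv (onl H v) (onl H w))) := by
    rw [← onl_cv]; infer_instance
  simp only [th_apply]
  rw [Q.qq_qq_Ω hS (Q.es P) (onl H v) (onl H w) (Q.cc hS v) (Q.cc hS w) (Q.cc hS (Q.cv v w))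
    (Q.cc_cc hS v w), onl_cv]

theorem th_ins (p : P) : Q.th hS v (p ⊗ₜ Q.β) = v (Q.Sinv hS Q.α) p ⊗ₜ Q.β := by
  have h := Q.qq_inv hS (Q.ins P) (Q.es P) (onl H v) p
  have h' := Q.cc_ins hS v p
  rw [ins_apply] at h h'
  rw [th_apply, h', h]
  rfl

theorem th_tr (u : P ⊗[k] H) : Q.th hS (Q.tr P) u = Q.ε (Q.Sinv hS Q.α) • u := by
  rw [th_apply, cc_tr, onl_tr, qq_tr]

end Theta

end QuasiHopfAlgebra
-- The Schrödinger action as a matrix coefficient of θ.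
namespace QuasiHopfAlgebra

variable {k H P P' : Type*} [Field k] [Ring H] [Algebra k H] (Q : QuasiHopfAlgebra k H)
  [AddCommGroup P] [Module k P] [AddCommGroup P'] [Module k P']
  (hS : Function.Bijective Q.S)

/-- Evaluation of a functional at the first tensor factor. -/
def dl (φ : Module.Dual k P) : P ⊗[k] P' →ₗ[k] P' :=
  (TensorProduct.lid k P').toLinearMap ∘ₗ φ.rTensor P'

@[simp]
theorem dl_tmul (φ : Module.Dual k P) (p : P) (h : P') : dl φ (p ⊗ₜ[k] h) = φ p • h := by
  simp [dl]

theorem dl_rTensor (φ : Module.Dual k P) (F : P' →ₗ[k] P) (u : P' ⊗[k] H) :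
    dl φ (F.rTensor H u) = dl (φ ∘ₗ F) u :=
  ext_tmul (F := dl φ ∘ₗ F.rTensor H) (G := dl (φ ∘ₗ F)) (fun p h => by simp) u

theorem schrodingerAux_eq (φ : Module.Dual k H) (t : H) :
    Q.schrodingerAux hS φ t = dl φ (Q.th hS (lm k H) (1 ⊗ₜ t)) := by
  rw [schrodingerAux, bilin_apply, th_apply, qq_apply_sw, map_sw]
  refine sw_congr _ fun q1 q2 => ?_
  rw [es, cv_apply_sw, map_sw]
  refine sw_congr _ fun q11 q12 => ?_
  rw [cc_one_tmul, coaction, IsLinearMap.mk'_apply]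
  simp only [map_sw3, map_sw]
  refine sw3_congr _ fun x1 x2 x3 => sw3_congr _ fun y1 y2 y3 => sw_congr _ fun r1 r2 =>
    sw_congr _ fun g1 g2 => sw_congr _ fun y21 y22 => sw_congr _ fun y31 y32 =>
    sw_congr _ fun t1 t2 => ?_
  simp [mul_assoc, Q.S_mul]

theorem schrodinger_tmul (φ : Module.Dual k H) (h m : H) :
    Q.schrodinger hS (φ ⊗ₜ h) m = dl φ (Q.th hS (lm k H) (1 ⊗ₜ Q.adj h m)) := by
  rw [schrodinger, TensorProduct.lift.tmul, bilin_apply, LinearMap.comp_apply, schrodingerAux_eq]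

/-- Apply ε to S(h₁)αh₂ = ε(h)α; the normalization of α removes ε(α). -/
theorem ε_S (hα : Q.ε Q.α = 1) (h : H) : Q.ε (Q.S h) = Q.ε h := by
  have := congrArg Q.ε.toLinearMap (Q.antipode_left h)
  rw [map_sw] at this
  have h2 := sw_apply (LinearMap.mul' k k ∘ₗ TensorProduct.map (Q.ε.toLinearMap ∘ₗ Q.S)
    Q.ε.toLinearMap) (Q.Δ h)
  have h3 := congrArg (LinearMap.mul' k k ∘ₗ (Q.ε.toLinearMap ∘ₗ Q.S).rTensor k) (Q.counit_right h)
  rw [← LinearMap.comp_apply] at h3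
  have e : (LinearMap.mul' k k ∘ₗ (Q.ε.toLinearMap ∘ₗ Q.S).rTensor k) ∘ₗ
    Q.ε.toLinearMap.lTensor H = LinearMap.mul' k k ∘ₗ TensorProduct.map (Q.ε.toLinearMap ∘ₗ Q.S)
      Q.ε.toLinearMap := by
    ext; simp
  rw [e, ← h2] at h3
  simp [hα] at this h3
  rw [← this, ← h3]

theorem ε_Sinv_α (hα : Q.ε Q.α = 1) : Q.ε (Q.Sinv hS Q.α) = 1 := by
  rw [← Q.ε_S hα, S_Sinv, hα]

/-- ε intertwines the regular with the trivial representation, on which θ is the scalar ε(S⁻¹(α)) =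
1. -/
theorem schrodinger_iD (hα : Q.ε Q.α = 1) (h m : H) :
    Q.schrodinger hS (Q.iD h) m = Q.adj h m := by
  have : Intw Q.ε.toLinearMap (lm k H) (Q.tr k) := ⟨fun a u => by simp⟩
  rw [iD, TensorProduct.mk_apply, schrodinger_tmul, dl, LinearMap.comp_apply,
    Q.th_natural hS Q.ε.toLinearMap (lm k H) (Q.tr k), th_tr, Q.ε_Sinv_α hS hα]
  simp

theorem schrodinger_β (d : Double k H) :
    Q.schrodinger hS d Q.β = Q.doubleCounit hS d • Q.β := by
  refine ext_tmul (F := (Q.schrodinger hS).flip Q.β)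
    (G := (Q.doubleCounit hS).smulRight Q.β) (fun φ h => ?_) d
  rw [LinearMap.flip_apply, schrodinger_tmul, adj_β, TensorProduct.tmul_smul, map_smul, th_ins]
  simp [doubleCounit, bilin_apply, smul_smul]

theorem doubleMul_tmul (φ ψ : Module.Dual k H) (h h' : H) :
    Q.doubleMul hS (φ ⊗ₜ h) (ψ ⊗ₜ h') = Q.doubleMulAux hS φ h ψ h' := by
  rw [doubleMul, bilin_apply, sw_pure, sw_pure]
  · exact fun h' => Q.lin_doubleMulAux_trd hS φ h h'
  · exact fun ψ => Q.lin_doubleMulAux_fth hS φ h ψ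
  · exact fun h => lin_sw _ fun ψ h' => Q.lin_doubleMulAux_fst hS h ψ h'
  · exact fun φ => lin_sw _ fun ψ h' => Q.lin_doubleMulAux_snd hS φ ψ h'

end QuasiHopfAlgebra
-- Multiplicativity of the Schrödinger action.
namespace QuasiHopfAlgebra

variable {k H : Type*} [Field k] [Ring H] [Algebra k H] (Q : QuasiHopfAlgebra k H)
  (hS : Function.Bijective Q.S)

/-- Evaluation of two functionals at the first two tensor factors. -/
def dl₂ (φ ψ : Module.Dual k H) : (H ⊗[k] H) ⊗[k] H →ₗ[k] H :=
  dl (LinearMap.mul' k k ∘ₗ TensorProduct.map φ ψ)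

instance : Intw (k := k) Q.Δ.toLinearMap (lm k H)
    (Q.cv (onl H (lm k H)) (onr H (lm k H))) where
  intw a u := by
    have : ∀ s t : H ⊗[k] H, ac (onl H (lm k H)) (onr H (lm k H)) s t = s * t := fun s t =>
      ext_tmul (F := (ac (onl H (lm k H)) (onr H (lm k H))).flip t)
        (G := LinearMap.mulRight k t) (fun a b =>
        ext_tmul (F := ac (onl H (lm k H)) (onr H (lm k H)) (a ⊗ₜ b))
          (G := LinearMap.mulLeft k (a ⊗ₜ b)) (fun c d => by simp) t) s
    rw [cv_apply, this]
    simp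

/-- Two regular slots are used, one for each functional, and both evaluations are postponed to the
end; naturality of θ permits this. -/
theorem schrodinger_schrodinger (φ ψ : Module.Dual k H) (h h' m : H) :
    Q.schrodinger hS (φ ⊗ₜ h) (Q.schrodinger hS (ψ ⊗ₜ h') m) =
    dl₂ φ ψ (Q.th hS (onl H (lm k H)) (Q.es (H ⊗[k] H) h
      (Q.th hS (onr H (lm k H)) ((1 ⊗ₜ 1) ⊗ₜ Q.adj h' m)))) := by
  let F : H →ₗ[k] H ⊗[k] H := TensorProduct.mk k H H 1
  let G : H ⊗[k] H →ₗ[k] H := (TensorProduct.rid k H).toLinearMap ∘ₗ ψ.lTensor H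
  have hF : Intw F (lm k H) (onr H (lm k H)) := ⟨fun a u => by simp [F]⟩
  have hG : Intw G (onl H (lm k H)) (lm k H) := ⟨fun a u =>
    ext_tmul (F := G ∘ₗ onl H (lm k H) a) (G := lm k H a ∘ₗ G) (fun p q => by simp [G]) u⟩
  have h1 : ((1 : H) ⊗ₜ[k] (1 : H)) ⊗ₜ[k] Q.adj h' m = F.rTensor H (1 ⊗ₜ Q.adj h' m) := by simp [F]
  have h2 : ∀ t, G.rTensor H (F.rTensor H t) = 1 ⊗ₜ dl ψ t := fun t =>
    ext_tmul (F := G.rTensor H ∘ₗ F.rTensor H) (G := TensorProduct.mk k H H 1 ∘ₗ dl ψ)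
      (fun p q => by simp [F, G, TensorProduct.smul_tmul']) t
  have h3 : ∀ t, dl₂ φ ψ t = dl φ (G.rTensor H t) := by
    intro t
    rw [dl_rTensor, dl₂]
    congr 2
    ext
    simp [G, mul_comm]
  rw [h3, Q.th_natural hS G (onl H (lm k H)) (lm k H), h1, ← Q.th_natural hS F (lm k H),
    Intw.intw (F := G.rTensor H) (i := Q.es _) (i' := Q.es _), h2, es_eq, onr_tmul,
    schrodinger_tmul, schrodinger_tmul]

/-- Convolution evaluates on Δ, which intertwines the regular representation with its tensor square;
the right factors a, a' pass through θ because right multiplications are intertwiners. -/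
theorem dl_conv (φ ψ : Module.Dual k H) (a b a' b' n : H) :
    dl (Q.conv (bimod a φ b) (bimod a' ψ b')) (Q.th hS (lm k H) (1 ⊗ₜ n)) =
    dl₂ φ ψ (onl H (onl H (lm k H)) b (onl H (onr H (lm k H)) b'
      (Q.th hS (Q.cv (onl H (lm k H)) (onr H (lm k H))) ((a ⊗ₜ a') ⊗ₜ n)))) := by
  let R : H ⊗[k] H →ₗ[k] H ⊗[k] H := TensorProduct.map (LinearMap.mulRight k a)
    (LinearMap.mulRight k a')
  have h1 : Intw R (onl H (lm k H)) (onl H (lm k H)) := ⟨fun c u =>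
    ext_tmul (F := R ∘ₗ onl H (lm k H) c) (G := onl H (lm k H) c ∘ₗ R)
      (fun p q => by simp [R, mul_assoc]) u⟩
  have h2 : Intw R (onr H (lm k H)) (onr H (lm k H)) := ⟨fun c u =>
    ext_tmul (F := R ∘ₗ onr H (lm k H) c) (G := onr H (lm k H) c ∘ₗ R)
      (fun p q => by simp [R, mul_assoc]) u⟩
  have h3 : (a ⊗ₜ[k] a') ⊗ₜ[k] n = R.rTensor H (Q.Δ.toLinearMap.rTensor H (1 ⊗ₜ n)) := by
    simp [R, Algebra.TensorProduct.one_def]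
  have h4 : ∀ t, dl₂ φ ψ (onl H (onl H (lm k H)) b (onl H (onr H (lm k H)) b' (R.rTensor H t))) =
      dl (LinearMap.mul' k k ∘ₗ TensorProduct.map (bimod a φ b) (bimod a' ψ b')) t := by
    intro t
    change dl₂ φ ψ (LinearMap.rTensor H (onl H (lm k H) b) (LinearMap.rTensor H
      (onr H (lm k H) b') (R.rTensor H t))) = _
    rw [dl₂, dl_rTensor, dl_rTensor, dl_rTensor]
    congr 2
    ext
    simp [R, bimod]
  rw [h3, ← Q.th_natural hS R (Q.cv (onl H (lm k H)) (onr H (lm k H))), h4,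
    ← Q.th_natural hS Q.Δ.toLinearMap (lm k H), dl_rTensor]
  rfl

theorem th_comm {P : Type*} [AddCommGroup P] [Module k P] (j v : H →ₗ[k] Module.End k P) [Cm j v]
    (c : H) (u : P ⊗[k] H) : Q.th hS v (onl H j c u) = onl H j c (Q.th hS v u) :=
  haveI := intw_of_cm j v c
  (Q.th_natural hS (j c) v v u).symm

theorem schrodinger_mul (d e : Double k H) (m : H) : Q.schrodinger hS (Q.doubleMul hS d e) m =
    Q.schrodinger hS d (Q.schrodinger hS e m) := by
  refine ext_tmul (F := (Q.schrodinger hS).flip m ∘ₗ (Q.doubleMul hS).flip e)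
    (G := (Q.schrodinger hS).flip (Q.schrodinger hS e m)) (fun φ h => ?_) d
  refine ext_tmul (F := (Q.schrodinger hS).flip m ∘ₗ (Q.doubleMul hS) (φ ⊗ₜ h))
    (G := Q.schrodinger hS (φ ⊗ₜ h) ∘ₗ (Q.schrodinger hS).flip m) (fun ψ h' => ?_) e
  simp only [LinearMap.comp_apply, LinearMap.flip_apply]
  -- Moving h past the inner θ yields the terms S⁻¹(h₂), h₍₁,₁₎ and h₍₁,₂₎ of the product; the two
  -- adjacent θ's then produce Ω.
  rw [doubleMul_tmul, schrodinger_schrodinger, act_th, ← LinearMap.flip_apply, doubleMulAux, map_sw5]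
  simp only [map_sw]
  rw [sw5_sw_comm]
  refine sw_congr _ fun h1 h2 => ?_
  rw [sw5_sw_comm, cv_apply_sw]
  simp only [map_sw]
  refine sw_congr _ fun h11 h12 => ?_
  rw [th_comm, th_th]
  simp only [map_sw5]
  refine sw5_congr _ fun Ω1 Ω2 Ω3 Ω4 Ω5 => ?_
  rw [LinearMap.flip_apply, schrodinger_tmul, dl_conv, Rep.mul,
    Cm.comm (i := onl H (onr H (lm k H))) (j := onl H (onl H (lm k H))), Rep.mul]
  simp [es_eq, Rep.mul]

end QuasiHopfAlgebra
-- Products in H₀ and the comultiplication of the double.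
namespace QuasiHopfAlgebra

variable {k H P : Type*} [Field k] [Ring H] [Algebra k H] (Q : QuasiHopfAlgebra k H)
  [AddCommGroup P] [Module k P] (hS : Function.Bijective Q.S)

theorem cc_eq_th (v : H →ₗ[k] Module.End k P) [Rep v] (u : P ⊗[k] H) : Q.cc hS v u =
    sw Q.pR fun p1 p2 => onl H v (Q.Sinv hS p2) (Q.th hS v (Q.cv (onl H v) (Q.es P) p1 u)) := by
  rw [← Q.pR_qq hS (Q.es P) (onl H v) (Q.cc hS v u)]
  refine sw_congr _ fun p1 p2 => ?_
  rw [th_apply, Intw.intw (F := Q.cc hS v) (i' := Q.cv (Q.es P) (onl H v))]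

theorem rTensor_cc (v : H →ₗ[k] Module.End k P) [Rep v] (u : (P ⊗[k] H) ⊗[k] H) :
    (Q.cc hS v).rTensor H u = sw Q.pR fun p1 p2 => onl H (onl H v) (Q.Sinv hS p2)
      ((Q.th hS v).rTensor H (Q.cv (onl H (onl H v)) (Q.es' P) p1 u)) := by
  refine ext_tmul (F := (Q.cc hS v).rTensor H) (G := IsLinearMap.mk' _ (lin_sw Q.pR fun p1 p2 =>
    (onl H (onl H v) (Q.Sinv hS p2) ∘ₗ (Q.th hS v).rTensor H ∘ₗ
      Q.cv (onl H (onl H v)) (Q.es' P) p1).isLinear)) (fun t h => ?_) u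
  rw [LinearMap.rTensor_tmul, cc_eq_th, sw_tmul, IsLinearMap.mk'_apply]
  refine sw_congr _ fun p1 p2 => ?_
  have : Q.es' P = onl H (Q.es P) := by rw [es_eq, es'_eq]
  rw [this, ← onl_cv]
  simp

/-- `cc_mu` followed by `qq_as`. Only the last braiding becomes a θ here; the first is rewritten by
`rTensor_cc`, which explains p_R in Δ_D. -/
theorem th_mu (v : H →ₗ[k] Module.End k P) [Rep v] (u : (P ⊗[k] H) ⊗[k] H) :
    Q.th hS v (Q.mu hS P u) = Q.mu hS P (sw3 Q.Φ fun X1 X2 X3 => Q.es' P X1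
      (onl H (onl H v) (Q.Sinv hS X3) (Q.th hS (onl H v)
        (Q.cv (onl H (onl H v)) (Q.es (P ⊗[k] H)) X2
          (Q.as (Q.es' P) (onl H (onl H v)) (Q.es _) ((Q.cc hS v).rTensor H
            (Q.asi (onl H (onl H v)) (Q.es' P) (Q.es _) u))))))) := by
  rw [th_apply, cc_mu, ← Q.qq_natural hS (Q.mu hS P) (Q.cv (Q.es' P) (Q.es (P ⊗[k] H)))
    (onl H (onl H v)), ← qq_as]
  congr 1
  refine sw3_congr _ fun X1 X2 X3 => ?_
  rw [th_apply, Intw.intw (F := Q.cc hS (onl H v)) (i' := Q.cv (Q.es _) (onl H (onl H v)))]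

theorem sw_dualComul [FiniteDimensional k H] (φ : Module.Dual k H) (a b : H) :
    (sw (dualComul φ) fun φ1 φ2 => φ1 a * φ2 b) = φ (a * b) := by
  have := sw_apply (LinearMap.applyₗ (a ⊗ₜ[k] b) ∘ₗ TensorProduct.dualDistrib k H H) (dualComul φ)
  simpa [dualComul_spec] using this

/-- Both θ's multiply on the left in one regular slot, so the later contribution stands before the
earlier. Hence φ₁ belongs to the second factor of the product and φ₂ to the first. -/
theorem sw_dualComul_circ [FiniteDimensional k H] (φ : Module.Dual k H) (r c c' d g a b : H) :
    (sw (dualComul φ) fun φ1 φ2 => Q.circ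
      (Q.adj g (dl (bimod r φ2 c') (Q.th hS (lm k H) (1 ⊗ₜ a))))
      (dl (bimod d φ1 c) (Q.th hS (lm k H) (1 ⊗ₜ b)))) =
    dl φ (Q.mu hS H (Q.es' H g (onl H (onl H (lm k H)) c (Q.th hS (onl H (lm k H))
      (onl H (onl H (lm k H)) d (onl H (onl H (lm k H)) c' ((Q.th hS (lm k H)).rTensor H
        ((r ⊗ₜ a) ⊗ₜ b)))))))) := by
  have h1 : ∀ φ2, dl (bimod r φ2 c') (Q.th hS (lm k H) (1 ⊗ₜ a)) =
      dl (φ2 ∘ₗ LinearMap.mulLeft k c') (Q.th hS (lm k H) (r ⊗ₜ a)) := by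
    intro φ2
    have : Intw (LinearMap.mulRight k r) (lm k H) (lm k H) := ⟨fun x y => by simp [mul_assoc]⟩
    have e := Q.th_natural hS (LinearMap.mulRight k r) (lm k H) (lm k H) (1 ⊗ₜ a)
    rw [LinearMap.rTensor_tmul, LinearMap.mulRight_apply, one_mul] at e
    rw [← e, dl_rTensor]
    rfl
  simp only [h1]
  rw [LinearMap.rTensor_tmul]
  generalize Q.th hS (lm k H) (r ⊗ₜ a) = t
  -- Right multiplication by the accumulated element d c' s is an intertwiner, so the second θ can
  -- be computed at 1 and multiplied afterwards.
  have h2 : ∀ s n : H, Q.th hS (onl H (lm k H)) (onl H (onl H (lm k H)) d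
      (onl H (onl H (lm k H)) c' ((s ⊗ₜ n) ⊗ₜ b))) =
      ((TensorProduct.mk k H H).flip n ∘ₗ LinearMap.mulRight k (d * (c' * s))).rTensor H
        (Q.th hS (lm k H) (1 ⊗ₜ b)) := by
    intro s n
    have : Intw ((TensorProduct.mk k H H).flip n ∘ₗ LinearMap.mulRight k (d * (c' * s)))
      (lm k H) (onl H (lm k H)) := ⟨fun x y => by simp [mul_assoc]⟩
    rw [Q.th_natural hS _ (lm k H) (onl H (lm k H))]
    simp [mul_assoc]
  generalize Q.th hS (lm k H) (1 ⊗ₜ b) = t' at h2 ⊢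
  refine ext_tmul (F := IsLinearMap.mk' _ (lin_sw (dualComul φ) fun φ1 φ2 =>
      (Q.circ.flip (dl (bimod d φ1 c) t') ∘ₗ Q.adj g ∘ₗ
        dl (φ2 ∘ₗ LinearMap.mulLeft k c')).isLinear))
    (G := dl φ ∘ₗ Q.mu hS H ∘ₗ Q.es' H g ∘ₗ onl H (onl H (lm k H)) c ∘ₗ
      Q.th hS (onl H (lm k H)) ∘ₗ onl H (onl H (lm k H)) d ∘ₗ onl H (onl H (lm k H)) c' ∘ₗ
      (TensorProduct.mk k _ H).flip b) (fun s n => ?_) t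
  rw [IsLinearMap.mk'_apply]
  simp only [LinearMap.comp_apply, LinearMap.flip_apply, TensorProduct.mk_apply]
  rw [h2]
  clear h2
  refine ext_tmul (F := IsLinearMap.mk' _ (lin_sw (dualComul φ) fun φ1 φ2 =>
      (Q.circ (Q.adj g (dl (φ2 ∘ₗ LinearMap.mulLeft k c') (s ⊗ₜ n))) ∘ₗ
        dl (bimod d φ1 c)).isLinear))
    (G := dl φ ∘ₗ Q.mu hS H ∘ₗ Q.es' H g ∘ₗ onl H (onl H (lm k H)) c ∘ₗ
      ((TensorProduct.mk k H H).flip n ∘ₗ LinearMap.mulRight k (d * (c' * s))).rTensor H)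
      (fun r m => ?_) t'
  rw [IsLinearMap.mk'_apply]
  have e := map_sw (LinearMap.toSpanSingleton k H (Q.circ (Q.adj g n) m)) (dualComul φ)
    fun φ1 φ2 => φ1 (c * r * d) * φ2 (c' * s)
  rw [sw_dualComul] at e
  simp only [es'_eq, LinearMap.comp_apply, LinearMap.rTensor_tmul, onl_tmul]
  simp [mu_tmul, bimod, mul_assoc, smul_smul] at e ⊢
  exact e.symm

end QuasiHopfAlgebra
-- H₀ as a module algebra over the quantum double.
namespace QuasiHopfAlgebra

variable {k H : Type*} [Field k] [Ring H] [Algebra k H] (Q : QuasiHopfAlgebra k H)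
  (hS : Function.Bijective Q.S)

theorem doubleComul_tmul [FiniteDimensional k H] (φ : Module.Dual k H) (h : H) :
    Q.doubleComul hS (φ ⊗ₜ h) =
    sw3 Q.Φ fun X1 X2 X3 => sw3 Q.Φ fun Y1 Y2 Y3 => sw3 Q.Φinv fun x1 x2 x3 =>
      sw Q.pR fun p1 p2 => sw (Q.Δ p1) fun p11 p12 => sw (Q.Δ X2) fun X21 X22 =>
      sw (dualComul φ) fun φ1 φ2 => sw (Q.Δ h) fun h1 h2 =>
        Q.doubleMul hS (Q.iD (X1 * Y1))
            (bow (bimod (p11 * x1) φ2 (Y2 * Q.Sinv hS p2)) (p12 * x2 * h1)) ⊗ₜ[k]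
          bow (bimod X21 φ1 (Q.Sinv hS X3)) (X22 * Y3 * x3 * h2) := rfl

theorem schrodinger_circ_tmul (φ : Module.Dual k H) (h a b : H) :
    Q.schrodinger hS (φ ⊗ₜ h) (Q.circ a b) = sw (Q.Δ h) fun h1 h2 =>
      dl φ (Q.th hS (lm k H) (Q.mu hS H ((1 ⊗ₜ Q.adj h1 a) ⊗ₜ Q.adj h2 b))) := by
  have := Q.circ_adj hS h (a ⊗ₜ b)
  rw [TensorProduct.lift.tmul, tensorAct_eq, cv_apply_sw] at this
  rw [schrodinger_tmul, ← this]
  have e := map_sw (dl φ ∘ₗ Q.th hS (lm k H) ∘ₗ TensorProduct.mk k H H 1 ∘ₗ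
    TensorProduct.lift Q.circ) (Q.Δ h) fun h1 h2 => onl H Q.adj h1 (onr H Q.adj h2 (a ⊗ₜ[k] b))
  refine e.trans (sw_congr _ fun h1 h2 => ?_)
  simp [mu_tmul]

theorem schrodinger_circ [FiniteDimensional k H] (hα : Q.ε Q.α = 1) (d : Double k H) (a b : H) :
    Q.schrodinger hS d (Q.circ a b) = sw (Q.doubleComul hS d) fun d1 d2 =>
      Q.circ (Q.schrodinger hS d1 a) (Q.schrodinger hS d2 b) := by
  let L : Double k H ⊗[k] Double k H →ₗ[k] H := TensorProduct.lift
    (Q.circ.compl₁₂ ((Q.schrodinger hS).flip a) ((Q.schrodinger hS).flip b))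
  have hL : ∀ d e, L (d ⊗ₜ e) = Q.circ (Q.schrodinger hS d a) (Q.schrodinger hS e b) :=
    fun d e => rfl
  have e := sw_apply L (Q.doubleComul hS d)
  simp only [hL] at e
  rw [e]
  refine ext_tmul (F := (Q.schrodinger hS).flip (Q.circ a b)) (G := L ∘ₗ Q.doubleComul hS)
    (fun φ h => ?_) d
  rw [LinearMap.flip_apply, LinearMap.comp_apply, schrodinger_circ_tmul, doubleComul_tmul]
  -- The product with ε ⋈ X¹Y¹ in Δ_D becomes a composition, so this factor acts by the adjoint
  -- action.
  simp only [map_sw3, map_sw, hL, schrodinger_mul, Q.schrodinger_iD hS hα, bow, schrodinger_tmul]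
  -- The sum over φ₁ ⊗ φ₂ is moved innermost and contracted to one evaluation of φ; the remaining
  -- sums are then matched with those of `th_mu` one at a time.
  simp only [sw_comm (C := H) (D := H) (M := H) (dualComul φ)]
  simp only [sw_dualComul_circ]
  simp only [sw3_sw_comm (A := H) (B := H) (C := H) (P := H) _ (Q.Δ h), sw_comm (A := H) (B := H) (M := H) _ (Q.Δ h)]
  refine sw_congr _ fun h1 h2 => ?_
  rw [th_mu]
  simp only [map_sw3]
  refine sw3_congr _ fun X1 X2 X3 => ?_
  simp only [sw3_sw_comm (A := H) (B := H) (C := H) (P := H) _ (Q.Δ X2), sw_comm (A := H) (B := H) (M := H) _ (Q.Δ X2)]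
  rw [Q.cv_apply_sw (onl H (onl H (lm k H))) (Q.es (H ⊗[k] H)) X2]
  simp only [map_sw]
  refine sw_congr _ fun X21 X22 => ?_
  rw [as_apply_sw]
  simp only [map_sw3]
  refine sw3_congr _ fun Y1 Y2 Y3 => ?_
  rw [rTensor_cc, sw3_sw_comm (A := H) (B := H) (C := H) (P := H) _ Q.pR]
  simp only [map_sw]
  refine sw_congr _ fun p1 p2 => ?_
  rw [Q.cv_apply_sw (onl H (onl H (lm k H))) (Q.es' H) p1,
    sw3_sw_comm (A := H) (B := H) (C := H) (P := H) _ (Q.Δ p1)]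
  simp only [map_sw]
  refine sw_congr _ fun p11 p12 => ?_
  rw [asi_apply_sw]
  simp only [map_sw3]
  refine sw3_congr _ fun x1 x2 x3 => ?_
  have e1 : Q.es' H = onl H (Q.es H) := by rw [es_eq, es'_eq]
  have e2 : onl H (onl H (lm k H)) p11 (Q.es' H p12 (onl H (onl H (lm k H)) x1 (Q.es' H x2
      (Q.es (H ⊗[k] H) x3 (((1 : H) ⊗ₜ[k] Q.adj h1 a) ⊗ₜ Q.adj h2 b))))) =
      ((p11 * x1) ⊗ₜ Q.adj (p12 * x2 * h1) a) ⊗ₜ Q.adj (x3 * h2) b := by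
    simp [es_eq, es'_eq, Rep.mul]
  have e3 : ∀ (c : H) (t : H ⊗[k] H) (n : H), Q.es (H ⊗[k] H) c (t ⊗ₜ n) = t ⊗ₜ Q.adj c n := by
    simp [es_eq]
  rw [e2, LinearMap.rTensor_tmul, LinearMap.rTensor_tmul, e1, Rep.mul (i := onl H (Q.es H)) X1 Y1,
    Rep.mul (i := onl H (onl H (lm k H))) Y2, mul_assoc (X22 * Y3), mul_assoc X22, Rep.mul (i := Q.adj) X22, Rep.mul (i := Q.adj) Y3, ← e3 X22, ← e3 Y3]
  -- The two sides now differ only in the order of operators acting in different slots.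
  simp only [Cm.comm (i := Q.es (H ⊗[k] H)) (j := onl H (Q.es H)),
    Cm.comm (i := onl H (onl H (lm k H))) (j := onl H (Q.es H)), th_comm,
    Cm.comm (i := Q.es (H ⊗[k] H)) (j := onl H (onl H (lm k H)))]

/-- `H₀` with the Schrödinger action is a module algebra over the quantum double. -/
theorem isDoubleModuleAlgebra [FiniteDimensional k H] (hα : Q.ε Q.α = 1) :
    Q.IsDoubleModuleAlgebra hS (Q.schrodinger hS) Q.circ Q.β where
  one_act m := by rw [doubleOne, Q.schrodinger_iD hS hα, Rep.one_apply]
  mul_act := Q.schrodinger_mul hS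
  act_mul := Q.schrodinger_circ hS hα
  act_one := Q.schrodinger_β hS
  mul_assoc a b c := by
    let L : Double k H ⊗[k] (Double k H ⊗[k] Double k H) →ₗ[k] H :=
      TensorProduct.lift Q.circ ∘ₗ TensorProduct.map ((Q.schrodinger hS).flip a)
        (TensorProduct.lift Q.circ ∘ₗ
          TensorProduct.map ((Q.schrodinger hS).flip b) ((Q.schrodinger hS).flip c))
    have h1 := sw3_apply L Q.doubleReassoc
    -- Φ_D is the image of Φ, so associativity over D(H) reduces to associativity for the adjoint
    -- action.
    have h2 := sw3_apply (L ∘ₗ TensorProduct.map Q.iD (TensorProduct.map Q.iD Q.iD)) Q.Φ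
    rw [LinearMap.comp_apply, ← doubleReassoc, ← h1] at h2
    rw [Q.circ_assoc hS]
    refine Eq.trans (sw3_congr _ fun X1 X2 X3 => ?_) h2
    simp [L, Q.schrodinger_iD hS hα]
  one_mul := Q.β_circ hS
  mul_one := Q.circ_β hS

end QuasiHopfAlgebra
end QuasiHopf

end

theorem proposition3p2 {k H : Type*} [Field k] [Ring H] [Algebra k H]
    (Q : QuasiHopf.QuasiHopfAlgebra k H) (hS : Function.Bijective Q.S) :
    Q.IsYDAlgebra Q.adj (Q.coaction hS) Q.circ Q.β ∧
    ∀ [FiniteDimensional k H], Q.ε Q.α = 1 →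
      Q.IsDoubleModuleAlgebra hS (Q.schrodinger hS) Q.circ Q.β := by
  exact ⟨Q.isYDAlgebra hS, fun hα => Q.isDoubleModuleAlgebra hS hα⟩
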